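/- A ternary $\mathbb Z$-lattice $L$ is a full lattice on a 3-dimensional positive definite quadratic space $V$ over $\mathbb Q$ with quadratic form $Q$ and symmetric bilinear form $B$, $B(x,x)=Q(x)$, which is non-classic integral: its norm $\mathfrak n(L)$, the $\mathbb Z$-module generated by $\{Q(x):x\in L\}$, is contained in $\mathbb Z$. It is primitive if $\mathfrak n(L)=\mathbb Z$. Put $dL=\det(B(x_i,x_j))$ for a $\mathbb Z$-basis $x_1,x_2,x_3$ of $L$, $r(t,L)=|\{x\in L:Q(x)=t\}|$ for $t\in\mathbb Q$ (so $r(t,L)=0$ if $t\notin\mathbb Z$), and $o(L)=|O(L)|$. Let $\mathrm{gen}(L)$ be the set of $\mathbb Z$-lattices $L'$ on $V$ with $L'_q\simeq L_q$ for all primes $q$. For a prime $p$ let $$\Lambda_p(L)=\{x\in L: Q(x+z)\equiv Q(z)\ (\mathrm{mod}\ p)\text{ for all }z\in L\},$$ and let $\lambda_p(L)$ be the primitive lattice obtained from $\Lambda_p(L)$ by scaling the quadratic space by a suitable positive rational number. Let $L$ be a primitive ternary $\mathbb Z$-lattice and $p$ a prime such that, in a Jordan splitting of $L_p$, the $\frac12\mathbb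 Z_p$-modular component is nonzero isotropic, and such that $\mathrm{ord}_p(4\,dL)\ge 2$. Let $K=\lambda_p(L)$, and for an integer $n$ define $$r(n,\mathrm{gen}_p^K(L))=\sum_{[L']\in\mathrm{gen}(L),\ \lambda_p(L')\simeq K}\frac{r(n,L')}{o(L')},$$ the sum being over isometry classes. Then this sum has only finitely many terms, and the following hold. (1) For every integer $n$ not divisible by $p$, $$r(n,\mathrm{gen}_p^K(L))=\begin{cases}\dfrac{p-\left(\frac{-n\,dK}{p}\right)}2\cdot\dfrac{r(n,K)}{o(K)}&\text{if }p\ne2\text{ and }\mathrm{ord}_p(4\,dL)=2,\\[2mm]\dfrac{r(n,K)-r(n,\Lambda_1(K))}{o(K)}&\text{if }p=2\text{ and }\mathrm{ord}_p(4\,dL)=2,\\[2mm]p\,\dfrac{r(n,K)}{o(K)}&\text{if }\mathrm{ord}_p(4\,dL)\ge3,\end{cases}$$ where $\Lambda_1(K)=\{x\in K:B(x,K)\subset\mathbb Z\}$ and $\left(\frac{\cdot}{p}\right)$ is the Legendre symbol (for $p$ odd, extended to rational numbers with denominator prime to $p$ by reduction modulo $p$). (2) For every integer $n$ divisible by $p$,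 $$r(n,\mathrm{gen}_p^K(L))=\begin{cases}p\,\dfrac{r(n,K)}{o(K)}+\dfrac{p(p-1)}2\cdot\dfrac{r(n/p^2,K)}{o(K)}&\text{if }\mathrm{ord}_p(4\,dL)=2,\\[2mm]p\,\dfrac{r(n,K)}{o(K)}+p^2\,\dfrac{r(n/p^2,K)}{o(K)}-p\,\dfrac{r(n,\Lambda_p(K))}{o(K)}&\text{if }\mathrm{ord}_p(4\,dL)\ge3.\end{cases}$$ -/

import Mathlib

open scoped TensorProduct

noncomputable section

/-- A pair consisting of a rational quadratic form `Q` on `V` and a `ℤ`-submodule of `V`; the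
conditions making it a lattice on the quadratic space `(V, Q)` are in `QuadLattice.IsZLattice`.
The form is part of the data so that a lattice can be scaled. -/
structure QuadLattice (V : Type*) [AddCommGroup V] [Module ℚ V] where
  form : QuadraticForm ℚ V
  lat : Submodule ℤ V

namespace QuadLattice

variable {V : Type*} [AddCommGroup V] [Module ℚ V]

/-- The symmetric bilinear form `B` with `B(x, x) = Q(x)`. -/
def bilin (L : QuadLattice V) (x y : V) : ℚ := QuadraticMap.associated (R := ℚ) L.form x y

/-- The norm `n(L)`: the `ℤ`-submodule of `ℚ` generated by all `Q(x)`, `x ∈ L`. -/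
def norm (L : QuadLattice V) : Submodule ℤ ℚ :=
  Submodule.span ℤ ((fun x => L.form x) '' (L.lat : Set V))

/-- Positive definite non-classic integral `ℤ`-lattices on `V`: the form is positive definite, `L`
is a finitely generated `ℤ`-submodule spanning `V` over `ℚ`, and `n(L) ⊆ ℤ`. -/
structure IsZLattice (L : QuadLattice V) : Prop where
  posDef : L.form.PosDef
  fg : L.lat.FG
  span_eq_top : Submodule.span ℚ (L.lat : Set V) = ⊤
  norm_le : L.norm ≤ 1

/-- `L` is primitive: `n(L) = ℤ`. -/
def IsPrimitive (L : QuadLattice V) : Prop := L.norm = 1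

/-- The Gram determinant of a `ℤ`-basis of a ternary lattice. -/
def gramDet (L : QuadLattice V) (b : Module.Basis (Fin 3) ℤ L.lat) : ℚ :=
  (Matrix.of fun i j => L.bilin (b i : V) (b j : V)).det

/-- The Gram determinant does not depend on the basis. -/
theorem gramDet_eq (L : QuadLattice V) (b c : Module.Basis (Fin 3) ℤ L.lat) :
    L.gramDet b = L.gramDet c := by
  have key : ∀ b c : Module.Basis (Fin 3) ℤ L.lat,
      L.gramDet c = L.gramDet b * (((b.toMatrix c).det : ℤ) : ℚ) ^ 2 := by
    intro b c
    have hc : ∀ j, (c j : V) = ∑ i, ((b.toMatrix c i j : ℤ) : ℚ) • (b i : V) := by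
      intro j
      have h := b.sum_toMatrix_smul_self c j
      have h2 := congrArg (fun x : L.lat => (x : V)) h
      simp only [Submodule.coe_sum, Submodule.coe_smul] at h2
      rw [← h2]
      exact Finset.sum_congr rfl fun i _ => (Int.cast_smul_eq_zsmul ℚ _ _).symm
    have hm : (Matrix.of fun i j => L.bilin (c i : V) (c j : V)) =
        ((b.toMatrix c).map (Int.cast : ℤ → ℚ)).transpose *
          (Matrix.of fun i j => L.bilin (b i : V) (b j : V)) *
          ((b.toMatrix c).map (Int.cast : ℤ → ℚ)) := by
      ext i j
      simp only [Matrix.mul_apply, Matrix.of_apply, Matrix.transpose_apply, Matrix.map_apply,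
        bilin]
      rw [hc i, hc j]
      simp only [map_sum, map_smul, LinearMap.sum_apply, LinearMap.smul_apply, smul_eq_mul,
        Finset.sum_mul, Finset.mul_sum]
      refine Finset.sum_congr rfl fun k _ => Finset.sum_congr rfl fun l _ => ?_
      ring
    have hd : (((b.toMatrix c).map (Int.cast : ℤ → ℚ)).det : ℚ) =
        (((b.toMatrix c).det : ℤ) : ℚ) := by
      have := (Int.castRingHom ℚ).map_det (b.toMatrix c)
      simpa using this.symm
    unfold gramDet
    rw [hm, Matrix.det_mul, Matrix.det_mul, Matrix.det_transpose, hd]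
    ring
  have hu : IsUnit (c.toMatrix b).det := by
    have h : (c.toMatrix b) * (b.toMatrix c) = 1 := c.toMatrix_mul_toMatrix_flip b
    exact IsUnit.of_mul_eq_one _ (by rw [← Matrix.det_mul, h, Matrix.det_one])
  rw [key c b]
  rcases Int.isUnit_iff.mp hu with h | h <;> simp [h]

open Classical in
/-- The discriminant `dL = det (B(xᵢ, xⱼ))` of a ternary lattice, for any `ℤ`-basis `x₁, x₂, x₃`
of `L` (and `0` if there is no such basis). -/
def disc (L : QuadLattice V) : ℚ :=
  if h : Nonempty (Module.Basis (Fin 3) ℤ L.lat) then L.gramDet h.some else 0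

/-- Number of representations `r(t, L) = #{x ∈ L : Q(x) = t}` of a rational number `t`. -/
def rep (t : ℚ) (L : QuadLattice V) : ℕ := Nat.card {x : V // x ∈ L.lat ∧ L.form x = t}

/-- Isometries of `L` onto `M`. -/
def Isom (L M : QuadLattice V) : Type _ :=
  {σ : L.form.IsometryEquiv M.form // ∀ x, σ x ∈ M.lat ↔ x ∈ L.lat}

/-- `o(L) = #O(L)`. -/
def autCard (L : QuadLattice V) : ℕ := Nat.card (Isom L L)

/-- `L ≃ M`. -/
def IsIso (L M : QuadLattice V) : Prop := Nonempty (Isom L M)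

def Isom.refl (L : QuadLattice V) : Isom L L :=
  ⟨QuadraticMap.IsometryEquiv.refl _, fun _ => Iff.rfl⟩

def Isom.symm {L M : QuadLattice V} (σ : Isom L M) : Isom M L :=
  ⟨σ.1.symm, fun x => by
    have h := σ.2 (σ.1.symm x)
    rw [QuadraticMap.IsometryEquiv.apply_symm_apply] at h
    exact h.symm⟩

def Isom.trans {L M N : QuadLattice V} (σ : Isom L M) (τ : Isom M N) : Isom L N :=
  ⟨σ.1.trans τ.1, fun x => (τ.2 (σ.1 x)).trans (σ.2 x)⟩

instance isoSetoid (V : Type*) [AddCommGroup V] [Module ℚ V] : Setoid (QuadLattice V) where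
  r := IsIso
  iseqv :=
    { refl := fun L => ⟨Isom.refl L⟩
      symm := fun ⟨σ⟩ => ⟨σ.symm⟩
      trans := fun ⟨σ⟩ ⟨τ⟩ => ⟨σ.trans τ⟩ }

/-- Isometry classes `[L]`. -/
abbrev IsoClass (V : Type*) [AddCommGroup V] [Module ℚ V] : Type _ := Quotient (isoSetoid V)

theorem rep_congr (t : ℚ) {L M : QuadLattice V} (h : IsIso L M) : rep t L = rep t M := by
  obtain ⟨σ⟩ := h
  refine Nat.card_congr (σ.1.toLinearEquiv.toEquiv.subtypeEquiv fun x => ?_)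
  have h1 := σ.2 x
  have h2 : M.form (σ.1 x) = L.form x := σ.1.map_app x
  change _ ↔ (σ.1 x ∈ M.lat ∧ M.form (σ.1 x) = t)
  rw [h1, h2]

theorem autCard_congr {L M : QuadLattice V} (h : IsIso L M) : autCard L = autCard M := by
  obtain ⟨σ⟩ := h
  refine Nat.card_congr
    { toFun := fun τ => (σ.symm.trans τ).trans σ
      invFun := fun τ => (σ.trans τ).trans σ.symm
      left_inv := fun τ => ?_
      right_inv := fun τ => ?_ }
  · apply Subtype.ext
    apply DFunLike.ext
    intro x
    change σ.1.symm (σ.1 (τ.1 (σ.1.symm (σ.1 x)))) = τ.1 x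
    simp
  · apply Subtype.ext
    apply DFunLike.ext
    intro x
    change σ.1 (σ.1.symm (τ.1 (σ.1 (σ.1.symm x)))) = τ.1 x
    simp

/-- `r(t, L')` as a function of the class `[L']`. -/
def IsoClass.rep (t : ℚ) (c : IsoClass V) : ℕ :=
  Quotient.lift (QuadLattice.rep t) (fun _ _ h => rep_congr t h) c

/-- `o(L')` as a function of the class `[L']`. -/
def IsoClass.autCard (c : IsoClass V) : ℕ :=
  Quotient.lift QuadLattice.autCard (fun _ _ h => autCard_congr h) c

/-- The quadratic form on `V_p = ℚ_p ⊗ V`. -/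
def localForm (p : ℕ) [Fact p.Prime] (L : QuadLattice V) : QuadraticForm ℚ_[p] (ℚ_[p] ⊗[ℚ] V) :=
  L.form.baseChange ℚ_[p]

/-- The localization `L_p = ℤ_p L ⊆ V_p`. -/
def localLat (p : ℕ) [Fact p.Prime] (L : QuadLattice V) : Submodule ℤ_[p] (ℚ_[p] ⊗[ℚ] V) :=
  Submodule.span ℤ_[p] ((fun x : V => (1 : ℚ_[p]) ⊗ₜ[ℚ] x) '' (L.lat : Set V))

/-- `L_p ≃ M_p`. -/
def LocalIso (p : ℕ) [Fact p.Prime] (L M : QuadLattice V) : Prop :=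
  ∃ σ : (L.localForm p).IsometryEquiv (M.localForm p),
    ∀ x, σ x ∈ M.localLat p ↔ x ∈ L.localLat p

/-- `M ∈ gen(L)`: `M` is a lattice on the quadratic space of `L` with `M_q ≃ L_q` for all `q`. -/
structure InGenus (L M : QuadLattice V) : Prop where
  isZLattice : M.IsZLattice
  form_eq : M.form = L.form
  localIso : ∀ (q : ℕ) [Fact q.Prime], LocalIso q L M

/-- The bilinear form on `V_p` with `B(x, x) = Q(x)`. -/
def localBilin (p : ℕ) [Fact p.Prime] (L : QuadLattice V) (x y : ℚ_[p] ⊗[ℚ] V) : ℚ_[p] :=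
  QuadraticMap.associated (R := ℚ_[p]) (L.localForm p) x y

/-- The `ℤ_p`-lattice `J` (a finitely generated `ℤ_p`-submodule of `V_p`) is `a ℤ_p`-modular:
`J = {x ∈ ℚ_p J : B(x, J) ⊆ a ℤ_p}`. -/
def IsModular (p : ℕ) [Fact p.Prime] (L : QuadLattice V) (a : ℚ_[p])
    (J : Submodule ℤ_[p] (ℚ_[p] ⊗[ℚ] V)) : Prop :=
  ∀ x ∈ Submodule.span ℚ_[p] (J : Set (ℚ_[p] ⊗[ℚ] V)),
    x ∈ J ↔ ∀ y ∈ J, ∃ t : ℤ_[p], L.localBilin p x y = a * t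

/-- In a Jordan splitting of `L_p` (with `n(L) ⊆ ℤ`) the `½ℤ_p`-modular component is nonzero
isotropic. As the scale of `L_p` lies in `½ℤ_p`, the `½ℤ_p`-modular component `J` of a Jordan
splitting is characterized by `L_p = J ⟂ J'` with `J` being `½ℤ_p`-modular and the scale of `J'`
(the orthogonal sum of the other components) being contained in `(p/2)ℤ_p`. -/
def HalfModularIsotropic (p : ℕ) [Fact p.Prime] (L : QuadLattice V) : Prop :=
  ∃ J J' : Submodule ℤ_[p] (ℚ_[p] ⊗[ℚ] V),
    J ⊔ J' = L.localLat p ∧ J ⊓ J' = ⊥ ∧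
    (∀ x ∈ J, ∀ y ∈ J', L.localBilin p x y = 0) ∧
    L.IsModular p (1 / 2) J ∧
    (∀ x ∈ J', ∀ y ∈ J', ∃ t : ℤ_[p], L.localBilin p x y = (p / 2 : ℚ_[p]) * t) ∧
    ∃ x ∈ J, x ≠ 0 ∧ L.localForm p x = 0

/-- `a ≡ b (mod m)` for rational numbers: `a - b ∈ mℤ`. -/
def RatModEq (m : ℕ) (a b : ℚ) : Prop := ∃ k : ℤ, a - b = m * k

/-- The elements of `Λ_p(L) = {x ∈ L : Q(x + z) ≡ Q(z) (mod p) for all z ∈ L}`. -/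
def watsonSet (p : ℕ) (L : QuadLattice V) : Set V :=
  {x | x ∈ L.lat ∧ ∀ z ∈ L.lat, RatModEq p (L.form (x + z)) (L.form z)}

/-- `Λ_p(L)`, on the same quadratic space. The set `watsonSet p L` is a subgroup of `V`
(see `mem_watson`), so it is the subgroup it generates. -/
def watson (p : ℕ) (L : QuadLattice V) : QuadLattice V where
  form := L.form
  lat := Submodule.span ℤ (watsonSet p L)

theorem mem_watson (p : ℕ) (L : QuadLattice V) (x : V) :
    x ∈ (watson p L).lat ↔ x ∈ watsonSet p L := by
  refine ⟨fun h => ?_, fun h => Submodule.subset_span h⟩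
  refine Submodule.span_induction (p := fun y _ => y ∈ watsonSet p L) (fun y hy => hy) ?_ ?_ ?_ h
  · exact ⟨L.lat.zero_mem, fun z _ => ⟨0, by simp⟩⟩
  · rintro y w _ _ ⟨hy, hy'⟩ ⟨hw, hw'⟩
    refine ⟨L.lat.add_mem hy hw, fun z hz => ?_⟩
    obtain ⟨k, hk⟩ := hy' (w + z) (L.lat.add_mem hw hz)
    obtain ⟨l, hl⟩ := hw' z hz
    refine ⟨k + l, ?_⟩
    rw [add_assoc]
    push_cast
    linear_combination hk + hl
  · rintro a y _ ⟨hy, hy'⟩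
    refine ⟨L.lat.smul_mem a hy, fun z hz => ?_⟩
    induction a using Int.induction_on with
    | zero => exact ⟨0, by simp⟩
    | succ i ih =>
      obtain ⟨k, hk⟩ := ih
      obtain ⟨l, hl⟩ := hy' ((i : ℤ) • y + z) (L.lat.add_mem (L.lat.smul_mem _ hy) hz)
      refine ⟨k + l, ?_⟩
      rw [show ((i : ℤ) + 1) • y + z = y + ((i : ℤ) • y + z) by rw [add_smul, one_smul]; abel]
      push_cast
      linear_combination hk + hl
    | pred i ih =>
      obtain ⟨k, hk⟩ := ih
      obtain ⟨l, hl⟩ := hy' ((-(i : ℤ) - 1) • y + z) (L.lat.add_mem (L.lat.smul_mem _ hy) hz)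
      rw [show y + ((-(i : ℤ) - 1) • y + z) = (-(i : ℤ)) • y + z by
        rw [sub_smul, one_smul]; abel] at hl
      refine ⟨k - l, ?_⟩
      push_cast
      linear_combination hk - hl

/-- The lattice `L^c` obtained by scaling the quadratic space by `c`. -/
def scale (c : ℚ) (L : QuadLattice V) : QuadLattice V where
  form := c • L.form
  lat := L.lat

open Classical in
/-- `λ_p(L)`: the primitive lattice obtained from `Λ_p(L)` by scaling by the suitable (unique)
positive rational number. -/
def lambda (p : ℕ) (L : QuadLattice V) : QuadLattice V :=
  if h : ∃ c : ℚ, 0 < c ∧ (scale c (watson p L)).IsPrimitive then scale h.choose (watson p L)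
  else watson p L

/-- `Λ_1(K) = {x ∈ K : B(x, K) ⊆ ℤ}`. -/
def LambdaOne (K : QuadLattice V) : QuadLattice V where
  form := K.form
  lat :=
    { carrier := {x | x ∈ K.lat ∧ ∀ y ∈ K.lat, ∃ m : ℤ, K.bilin x y = m}
      zero_mem' := ⟨K.lat.zero_mem, fun y _ => ⟨0, by simp [bilin]⟩⟩
      add_mem' := by
        rintro x w ⟨hx, hx'⟩ ⟨hw, hw'⟩
        refine ⟨K.lat.add_mem hx hw, fun y hy => ?_⟩
        obtain ⟨k, hk⟩ := hx' y hy
        obtain ⟨l, hl⟩ := hw' y hy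
        refine ⟨k + l, ?_⟩
        simp only [bilin, map_add, LinearMap.add_apply] at hk hl ⊢
        rw [hk, hl]
        push_cast
        rfl
      smul_mem' := by
        rintro a x ⟨hx, hx'⟩
        refine ⟨K.lat.smul_mem a hx, fun y hy => ?_⟩
        obtain ⟨k, hk⟩ := hx' y hy
        refine ⟨a * k, ?_⟩
        simp only [bilin, map_zsmul, LinearMap.smul_apply] at hk ⊢
        rw [hk]
        simp }

/-- The isometry classes `[L']` with `L' ∈ gen(L)` and `λ_p(L') ≃ K`. -/
def genClasses (p : ℕ) (K L : QuadLattice V) : Set (IsoClass V) :=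
  {c | ∃ L' : QuadLattice V, InGenus L L' ∧ IsIso (lambda p L') K ∧ c = Quotient.mk _ L'}

/-- `r(n, gen_p^K(L))`: the sum of `r(n, L') / o(L')` over the classes `[L']` in `gen(L)` with
`λ_p(L') ≃ K`. -/
def repGen (p : ℕ) (n : ℤ) (K L : QuadLattice V) : ℚ :=
  ∑ᶠ c ∈ genClasses p K L, (IsoClass.rep (n : ℚ) c : ℚ) / (IsoClass.autCard c : ℚ)

end QuadLattice

/-- The Legendre symbol `(a / p)` of a rational number `a` whose denominator is prime to `p`
(for an odd prime `p`). -/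
def ratLegendre (p : ℕ) [Fact p.Prime] (a : ℚ) : ℤ := quadraticChar (ZMod p) (a : ZMod p)

end

/-! Put `M = p⁻¹Λ_p(L)`. The hypotheses give a splitting of `L_p` into a hyperbolic plane `H` and a
line on which `Q` is divisible by `p²`; passing to `M_p` keeps `H` and divides the generator of the
line by `p`. So `M` is integral, contains `L`, is therefore primitive, and is isometric to `K`
(`lambda_isIso`). In the other direction `L = ℤe + ℤf + pM` for a pair `e, f` that is hyperbolic
modulo `p`: `L` is the preimage of a hyperbolic plane of the quadratic space `M/pM`. Conversely
every such preimage `N` lies in `gen(L)` (`inGenus_hypLat`) and gives back `M = p⁻¹Λ_p(N)`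
(`IsHypPair.overLat_hypLat`). Hence the classes in the sum are exactly the classes of these finitely
many sublattices of `M` (`genClasses_eq`).

An isometry between two of these sublattices preserves `M`, so the classes are the orbits of `O(M)`,
and the stabilizer of `N` is `O(N)`. Orbit counting turns the sum into `o(M)⁻¹ ∑_N r(n, N)`
(`repGen_eq_sum`). Interchanging summations, each `x ∈ M` with `Q(x) = n` is weighted by the number
of hyperbolic planes of `M/pM` through its reduction (`sum_rep_eq`, `repGen_eq_sum_of_planeCount`).

The rest is geometry over `𝔽_p`. The reduced space is a hyperbolic plane plus an orthogonal vector
of value `c`, with `c ≠ 0` exactly when `ord_p(4 dL) = 2`. Through an isotropic vector outside the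
radical pass `p` hyperbolic planes; through a nonzero radical vector none; through `0` there are
`p(p+1)/2` if `c ≠ 0` and `p²` if `c = 0`. Through a vector of value `n ≠ 0` outside the radical
there are `p` if `c = 0`, `(p - χ(nc))/2` if `c ≠ 0` and `p` is odd, and `1` if `c ≠ 0` and `p = 2`.
Up to squares `c` is `-dK` for odd `p`. The vectors of `pM` account for `r(n/p², K)`, and the
radical is detected by `Λ₁(K)` or `Λ_p(K)`. -/

set_option linter.unusedSectionVars false

noncomputable section

namespace QuadLattice

open QuadraticMap Module

/-! ### Frames: a hyperbolic pair and an orthogonal third vector -/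

section Frames

variable {R N : Type*} [CommRing R] [AddCommGroup N] [Module R N] (q : QuadraticForm R N)

theorem form_smul_add_smul (e f : N) (x y : R) :
    q (x • e + y • f) = x ^ 2 * q e + y ^ 2 * q f + x * y * polar q e f := by
  rw [QuadraticMap.map_add (⇑q), q.map_smul, q.map_smul, polar_smul_left, polar_smul_right]
  simp only [smul_eq_mul]
  ring

theorem form_combination (e f g : N) (x y z : R) :
    q (x • e + y • f + z • g) = x ^ 2 * q e + y ^ 2 * q f + z ^ 2 * q g + x * y * polar q e f +
      x * z * polar q e g + y * z * polar q f g := by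
  rw [QuadraticMap.map_add (⇑q), form_smul_add_smul, q.map_smul, polar_add_left]
  simp only [polar_smul_left, polar_smul_right, smul_eq_mul]
  ring

theorem polar_combination (e f g w : N) (x y z : R) :
    polar q (x • e + y • f + z • g) w =
      x * polar q e w + y * polar q f w + z * polar q g w := by
  simp only [polar_add_left, polar_smul_left, smul_eq_mul]

theorem polar_self_eq (x : N) : polar q x x = 2 * q x := by
  rw [polar_self]
  simp

theorem form_sub (x y : N) : q (x - y) = q x + q y - polar q x y := by
  rw [sub_eq_add_neg, QuadraticMap.map_add (⇑q), q.map_neg, polar_neg_right]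
  ring

/-- A basis `e, f, g` with `e, f` a hyperbolic pair and `g` orthogonal to it. -/
structure IsFrame (b : Basis (Fin 3) R N) : Prop where
  form_zero : q (b 0) = 0
  form_one : q (b 1) = 0
  polar_zero_one : polar q (b 0) (b 1) = 1
  polar_zero_two : polar q (b 0) (b 2) = 0
  polar_one_two : polar q (b 1) (b 2) = 0

variable {q}

theorem basis_sum (b : Basis (Fin 3) R N) (v : N) :
    v = b.repr v 0 • b 0 + b.repr v 1 • b 1 + b.repr v 2 • b 2 := by
  conv_lhs => rw [← b.sum_repr v]
  rw [Fin.sum_univ_three]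

theorem repr_combination (b : Basis (Fin 3) R N) (x y z : R) :
    ⇑(b.repr (x • b 0 + y • b 1 + z • b 2)) = ![x, y, z] := by
  ext i
  fin_cases i <;> simp

theorem combination_inj (b : Basis (Fin 3) R N) {x y z x' y' z' : R}
    (h : x • b 0 + y • b 1 + z • b 2 = x' • b 0 + y' • b 1 + z' • b 2) :
    x = x' ∧ y = y' ∧ z = z' := by
  have h2 : ![x, y, z] = ![x', y', z'] := by
    rw [← repr_combination b, ← repr_combination b, h]
  exact ⟨congrFun h2 0, congrFun h2 1, congrFun h2 2⟩

theorem IsFrame.form_eq {b : Basis (Fin 3) R N} (h : IsFrame q b) (x y z : R) :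
    q (x • b 0 + y • b 1 + z • b 2) = x * y + z ^ 2 * q (b 2) := by
  rw [form_combination, h.form_zero, h.form_one, h.polar_zero_one, h.polar_zero_two,
    h.polar_one_two]
  ring

theorem IsFrame.polar_zero {b : Basis (Fin 3) R N} (h : IsFrame q b) (x y z : R) :
    polar q (x • b 0 + y • b 1 + z • b 2) (b 0) = y := by
  rw [polar_combination, polar_self_eq, h.form_zero, polar_comm q (b 1), h.polar_zero_one,
    polar_comm q (b 2), h.polar_zero_two]
  ring

theorem IsFrame.polar_one {b : Basis (Fin 3) R N} (h : IsFrame q b) (x y z : R) :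
    polar q (x • b 0 + y • b 1 + z • b 2) (b 1) = x := by
  rw [polar_combination, polar_self_eq, h.form_one, h.polar_zero_one,
    polar_comm q (b 2), h.polar_one_two]
  ring

theorem IsFrame.polar_two {b : Basis (Fin 3) R N} (h : IsFrame q b) (x y z : R) :
    polar q (x • b 0 + y • b 1 + z • b 2) (b 2) = z * (2 * q (b 2)) := by
  rw [polar_combination, polar_self_eq, h.polar_zero_two, h.polar_one_two]
  ring

/-- Pairing with `f` and `e` maps `N` onto `R × R`, split by the pair itself, so `N` is the direct
sum of the plane and its orthogonal complement. -/
theorem exists_frame [IsDomain R] [IsPrincipalIdealRing R] [Module.Free R N] [Module.Finite R N]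
    (hN : finrank R N = 3) {e f : N} (he : q e = 0) (hf : q f = 0) (hef : polar q e f = 1) :
    ∃ b : Basis (Fin 3) R N, IsFrame q b ∧ b 0 = e ∧ b 1 = f := by
  set φ : N →ₗ[R] R × R := (q.polarBilin f).prod (q.polarBilin e) with hφ
  have φ_apply : ∀ x, φ x = (polar q f x, polar q e x) := fun x => rfl
  have hee : polar q e e = 0 := by rw [polar_self_eq, he, mul_zero]
  have hff : polar q f f = 0 := by rw [polar_self_eq, hf, mul_zero]
  have hfe : polar q f e = 1 := by rw [polar_comm, hef]
  have φe : φ e = (1, 0) := by rw [φ_apply, hfe, hee]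
  have φf : φ f = (0, 1) := by rw [φ_apply, hff, hef]
  have hsurj : Function.Surjective φ := by
    rintro ⟨a, c⟩
    refine ⟨a • e + c • f, ?_⟩
    rw [map_add, map_smul, map_smul, φe, φf]
    simp
  -- The complement has rank 3 - 2 = 1 and is free over a principal ideal domain; its generator is
  -- the third vector.
  have hrk : finrank R (LinearMap.ker φ) = 1 := by
    have h1 := Submodule.finrank_quotient_add_finrank (LinearMap.ker φ)
    rw [(φ.quotKerEquivOfSurjective hsurj).finrank_eq, hN, finrank_prod, finrank_self] at h1
    omega
  let bk := finBasisOfFinrankEq R (LinearMap.ker φ) hrk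
  set g : N := ((bk 0 : LinearMap.ker φ) : N) with hg
  have φg : φ g = 0 := (bk 0).2
  have hker : ∀ x, φ x = 0 → ∃ z : R, x = z • g := by
    intro x hx
    have h := bk.sum_repr ⟨x, hx⟩
    rw [Fin.sum_univ_one] at h
    exact ⟨_, (congrArg Subtype.val h).symm⟩
  have hz : ∀ z : R, z • g = 0 → z = 0 := by
    intro z h0
    have h1 : z • bk 0 = 0 := Subtype.ext h0
    have h2 := congrArg (fun t => bk.repr t 0) h1
    simpa using h2
  have hli : LinearIndependent R ![e, f, g] := by
    rw [Fintype.linearIndependent_iff]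
    intro c hc
    simp only [Fin.sum_univ_three, Matrix.cons_val_zero, Matrix.cons_val_one,
      Matrix.cons_val] at hc
    have h1 := congrArg φ hc
    rw [map_add, map_add, map_smul, map_smul, map_smul, φe, φf, φg, map_zero] at h1
    simp only [Prod.smul_mk, smul_eq_mul, mul_one, mul_zero, smul_zero, add_zero, Prod.mk_add_mk,
      zero_add, Prod.mk_eq_zero] at h1
    have h2 : c 2 = 0 := by
      apply hz
      simpa [h1.1, h1.2] using hc
    intro i
    fin_cases i
    · exact h1.1
    · exact h1.2
    · exact h2
  have hsp : ⊤ ≤ Submodule.span R (Set.range ![e, f, g]) := by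
    intro x _
    obtain ⟨z, hz'⟩ := hker (x - (polar q f x • e + polar q e x • f)) (by
      rw [map_sub, map_add, map_smul, map_smul, φe, φf, φ_apply]
      simp)
    have hx : x = polar q f x • e + polar q e x • f + z • g := by
      rw [← hz']
      abel
    rw [hx]
    have hmem : ∀ i, ![e, f, g] i ∈ Submodule.span R (Set.range ![e, f, g]) :=
      fun i => Submodule.subset_span ⟨i, rfl⟩
    exact add_mem (add_mem (Submodule.smul_mem _ _ (hmem 0)) (Submodule.smul_mem _ _ (hmem 1)))
      (Submodule.smul_mem _ _ (hmem 2))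
  refine ⟨Basis.mk hli hsp, ⟨?_, ?_, ?_, ?_, ?_⟩, ?_, ?_⟩
  all_goals simp only [Basis.mk_apply, Matrix.cons_val_zero, Matrix.cons_val_one, Matrix.cons_val]
  · exact he
  · exact hf
  · exact hef
  · exact congrArg Prod.snd φg
  · exact congrArg Prod.fst φg

variable (q) in
/-- The Gram determinant of the polar form. -/
def polarGram (v : Fin 3 → N) : R := (Matrix.of fun i j => polar q (v i) (v j)).det

theorem polarGram_eq (b : Basis (Fin 3) R N) (v : Fin 3 → N) :
    polarGram q v = polarGram q b * (b.toMatrix v).det ^ 2 := by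
  have hm : (Matrix.of fun i j => polar q (v i) (v j)) =
      (b.toMatrix v).transpose * (Matrix.of fun i j => polar q (b i) (b j)) * b.toMatrix v := by
    ext i j
    simp only [Matrix.mul_apply, Matrix.of_apply, Matrix.transpose_apply, Basis.toMatrix_apply]
    conv_lhs => rw [← b.sum_repr (v i), ← b.sum_repr (v j)]
    simp only [Fin.sum_univ_three, polar_add_left, polar_add_right, polar_smul_left,
      polar_smul_right, smul_eq_mul]
    ring
  unfold polarGram
  rw [hm, Matrix.det_mul, Matrix.det_mul, Matrix.det_transpose]
  ring

variable (q) in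
/-- Half the Gram determinant of the polar form, which is defined in every characteristic. -/
def halfGram (v : Fin 3 → N) : R :=
  4 * q (v 0) * q (v 1) * q (v 2) + polar q (v 0) (v 1) * polar q (v 0) (v 2) * polar q (v 1) (v 2) -
    q (v 0) * polar q (v 1) (v 2) ^ 2 - q (v 1) * polar q (v 0) (v 2) ^ 2 -
    q (v 2) * polar q (v 0) (v 1) ^ 2

theorem two_mul_halfGram (v : Fin 3 → N) : 2 * halfGram q v = polarGram q v := by
  unfold halfGram polarGram
  rw [Matrix.det_fin_three]
  simp only [Matrix.of_apply, polar_self_eq, polar_comm q (v 1) (v 0), polar_comm q (v 2) (v 0),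
    polar_comm q (v 2) (v 1)]
  ring

theorem halfGram_eq [IsDomain R] [CharZero R] (b : Basis (Fin 3) R N) (v : Fin 3 → N) :
    halfGram q v = halfGram q b * (b.toMatrix v).det ^ 2 := by
  have h := polarGram_eq (q := q) b v
  rw [← two_mul_halfGram, ← two_mul_halfGram, mul_assoc] at h
  exact mul_left_cancel₀ two_ne_zero h

theorem IsFrame.halfGram_eq {b : Basis (Fin 3) R N} (h : IsFrame q b) :
    halfGram q b = -q (b 2) := by
  rw [halfGram, h.form_zero, h.form_one, h.polar_zero_one, h.polar_zero_two, h.polar_one_two]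
  ring

theorem isUnit_det_toMatrix (b c : Basis (Fin 3) R N) : IsUnit (b.toMatrix c).det :=
  IsUnit.of_mul_eq_one (c.toMatrix b).det (by
    rw [← Matrix.det_mul, b.toMatrix_mul_toMatrix_flip c, Matrix.det_one])

/-- Compare Gram determinants: that of a frame is `-2` times the value at the third vector, and a
change of basis multiplies it by the square of a unit. -/
theorem IsFrame.exists_unit {b c : Basis (Fin 3) R N} (hb : IsFrame q b) (hc : IsFrame q c) :
    ∃ u : R, IsUnit u ∧ 2 * q (c 2) = u ^ 2 * (2 * q (b 2)) := by
  refine ⟨_, isUnit_det_toMatrix b c, ?_⟩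
  have h := polarGram_eq (q := q) b c
  rw [← two_mul_halfGram, ← two_mul_halfGram, hb.halfGram_eq, hc.halfGram_eq] at h
  linear_combination -h

end Frames

/-! ### Integral forms from forms over the fraction field -/

section Restriction

variable {R K W : Type*} [CommRing R] [Field K] [Algebra R K] [Module.IsTorsionFree R K] [IsDomain R]
  [AddCommGroup W]
  [Module R W] [Module K W] [IsScalarTower R K W]

/-- A quadratic form with values in `R` on the `R`-submodule `P`. -/
def intForm (Q : QuadraticForm K W) (P : Submodule R W)
    (h : ∀ x ∈ P, ∃ t : R, Q x = algebraMap R K t) : QuadraticForm R P :=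
  have hinj : Function.Injective (algebraMap R K) := FaithfulSMul.algebraMap_injective R K
  have hQ : ∀ x : P, algebraMap R K (h x x.2).choose = Q x := fun x => (h x x.2).choose_spec.symm
  have hp : ∀ x y : P, algebraMap R K (polar (fun x : P => (h x x.2).choose) x y) =
      polar Q (x : W) y := fun x y => by
    rw [polar, map_sub, map_sub]
    exact congrArg₂ _ (congrArg₂ _ (hQ (x + y)) (hQ x)) (hQ y)
  QuadraticMap.ofPolar (fun x => (h x x.2).choose)
    (fun a x => hinj (by
      rw [hQ, smul_eq_mul, map_mul, map_mul, hQ, Submodule.coe_smul,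
        ← algebraMap_smul K a (x : W), Q.map_smul, smul_eq_mul]))
    (fun x x' y => hinj (by
      rw [hp, map_add, hp, hp, Submodule.coe_add, polar_add_left]))
    (fun a x y => hinj (by
      rw [hp, smul_eq_mul, map_mul, hp, Submodule.coe_smul, ← algebraMap_smul K a (x : W),
        polar_smul_left, smul_eq_mul]))

theorem algebraMap_intForm (Q : QuadraticForm K W) (P : Submodule R W)
    (h : ∀ x ∈ P, ∃ t : R, Q x = algebraMap R K t) (x : P) :
    algebraMap R K (intForm Q P h x) = Q x := (h x x.2).choose_spec.symm

theorem algebraMap_polar_intForm (Q : QuadraticForm K W) (P : Submodule R W)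
    (h : ∀ x ∈ P, ∃ t : R, Q x = algebraMap R K t) (x y : P) :
    algebraMap R K (polar (intForm Q P h) x y) = polar Q (x : W) y := by
  simp only [polar, map_sub, algebraMap_intForm, Submodule.coe_add]

end Restriction

/-! ### Hyperbolic planes through a vector and their isotropic duals -/

section FiniteField

variable {F U : Type*} [Field F] [AddCommGroup U] [Module F U] (q : QuadraticForm F U)

/-- The hyperbolic planes contained in a quadratic space. -/
def hypPlanes : Set (Submodule F U) :=
  {W | ∃ e f, q e = 0 ∧ q f = 0 ∧ polar q e f = 1 ∧ W = Submodule.span F {e, f}}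

/-- The number of hyperbolic planes through a given vector. -/
def planeCount (v : U) : ℕ := {W | W ∈ hypPlanes q ∧ v ∈ W}.ncard

/-- The isotropic vectors `e` with `polar q e v = 1`. -/
def isotropicDual (v : U) : Set U := {e | q e = 0 ∧ polar q e v = 1}

variable {q}

theorem smul_mem_hypPair {e f : U} (he : q e = 0) (hf : q f = 0) (hef : polar q e f = 1)
    (x y : F) : q (x • e + y • f) = x * y := by
  rw [form_smul_add_smul, he, hf, hef]
  ring

theorem span_pair_eq {W : Submodule F U} {e f v w : U} (hv : v ∈ Submodule.span F {e, f})
    (hw : w ∈ Submodule.span F {e, f}) (he : e ∈ Submodule.span F {v, w})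
    (hf : f ∈ Submodule.span F {v, w}) (hW : W = Submodule.span F {e, f}) :
    W = Submodule.span F {v, w} := by
  rw [hW]
  apply le_antisymm <;> rw [Submodule.span_le] <;> rintro x (rfl | rfl) <;> assumption

/-- A hyperbolic plane through `v` has one further isotropic line, and exactly one vector on it
pairs to 1 with `v`; planes and duals correspond bijectively. -/
theorem planeCount_of_isotropic {v : U} (hv : q v = 0) (hv0 : v ≠ 0) :
    planeCount q v = (isotropicDual q v).ncard := by
  have himg : {W | W ∈ hypPlanes q ∧ v ∈ W} =
      (fun e => Submodule.span F {v, e}) '' isotropicDual q v := by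
    ext W
    constructor
    · rintro ⟨⟨e, f, he, hf, hef, hW⟩, hvW⟩
      rw [hW] at hvW
      obtain ⟨x, y, rfl⟩ := Submodule.mem_span_pair.1 hvW
      rw [smul_mem_hypPair he hf hef, mul_eq_zero] at hv
      rcases hv with rfl | rfl
      · have hy : y ≠ 0 := by
          rintro rfl
          simp at hv0
        refine ⟨y⁻¹ • e, ⟨by rw [q.map_smul, he, smul_zero], ?_⟩, ?_⟩
        · rw [polar_smul_left, polar_add_right, polar_smul_right, polar_smul_right, hef]
          simp [hy]
        · refine (span_pair_eq ?_ ?_ ?_ ?_ hW).symm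
          · exact Submodule.mem_span_pair.2 ⟨0, y, rfl⟩
          · exact Submodule.mem_span_pair.2 ⟨y⁻¹, 0, by simp⟩
          · exact Submodule.mem_span_pair.2 ⟨0, y, by simp [smul_smul, hy]⟩
          · exact Submodule.mem_span_pair.2 ⟨y⁻¹, 0, by simp [smul_smul, hy]⟩
      · have hx : x ≠ 0 := by
          rintro rfl
          simp at hv0
        refine ⟨x⁻¹ • f, ⟨by rw [q.map_smul, hf, smul_zero], ?_⟩, ?_⟩
        · rw [polar_smul_left, polar_add_right, polar_smul_right, polar_smul_right,
            polar_comm q f e, hef]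
          simp [hx]
        · refine (span_pair_eq ?_ ?_ ?_ ?_ hW).symm
          · exact Submodule.mem_span_pair.2 ⟨x, 0, rfl⟩
          · exact Submodule.mem_span_pair.2 ⟨0, x⁻¹, by simp⟩
          · exact Submodule.mem_span_pair.2 ⟨x⁻¹, 0, by simp [smul_smul, hx]⟩
          · exact Submodule.mem_span_pair.2 ⟨0, x, by simp [smul_smul, hx]⟩
    · rintro ⟨e, ⟨he, hev⟩, rfl⟩
      exact ⟨⟨v, e, hv, he, by rw [polar_comm, hev], rfl⟩, Submodule.subset_span (by simp)⟩
  rw [planeCount, himg, Set.InjOn.ncard_image]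
  rintro e ⟨he, hev⟩ e' ⟨he', hev'⟩ h
  have h1 : e' ∈ Submodule.span F {v, e} := by
    have h2 : e' ∈ Submodule.span F {v, e'} := Submodule.subset_span (by simp)
    have h3 : Submodule.span F {v, e} = Submodule.span F {v, e'} := h
    rwa [h3]
  obtain ⟨x, y, rfl⟩ := Submodule.mem_span_pair.1 h1
  rw [polar_add_left, polar_smul_left, polar_smul_left, polar_self_eq, hv, hev] at hev'
  have hy : y = 1 := by simpa using hev'
  rw [smul_mem_hypPair hv he (by rw [polar_comm, hev])] at he'
  subst hy
  have hx : x = 0 := by simpa using he'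
  simp [hx]

/-- Up to sign, `(q v)⁻¹ • v - e` is the reflection of `e` in `v`. This interchanges the two
isotropic lines of the plane spanned by `v` and `e`. -/
theorem isotropicDual_flip {v e : U} (hv : q v ≠ 0) (he : e ∈ isotropicDual q v) :
    (q v)⁻¹ • v - e ∈ isotropicDual q v ∧ (q v)⁻¹ • v - e ≠ e := by
  obtain ⟨h1, h2⟩ := he
  refine ⟨⟨?_, ?_⟩, fun h => ?_⟩
  · rw [form_sub, q.map_smul, h1, polar_smul_left, polar_comm q v e, h2]
    simp [hv]
  · rw [polar_sub_left, polar_smul_left, polar_self_eq, h2]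
    simp only [smul_eq_mul]
    field_simp
    ring
  · have h3 : (q v)⁻¹ • v = (2 : F) • e := by
      rw [two_smul, ← sub_eq_iff_eq_add, h]
    have h4 : q ((q v)⁻¹ • v) = 0 := by rw [h3, q.map_smul, h1, smul_zero]
    rw [q.map_smul] at h4
    simp [hv] at h4

theorem isotropicDual_sub_mem_iff {v e e' : U} (hv : q v ≠ 0) (he : e ∈ isotropicDual q v)
    (he' : e' ∈ isotropicDual q v) :
    Submodule.span F {v, e'} = Submodule.span F {v, e} ↔ e' = e ∨ e' = (q v)⁻¹ • v - e := by
  constructor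
  · intro h
    have h1 : e' ∈ Submodule.span F {v, e} := by
      rw [← h]
      exact Submodule.subset_span (by simp)
    obtain ⟨x, y, rfl⟩ := Submodule.mem_span_pair.1 h1
    obtain ⟨h2, h3⟩ := he'
    rw [form_smul_add_smul, polar_comm q v e, he.1, he.2] at h2
    rw [polar_add_left, polar_smul_left, polar_smul_left, polar_self_eq, he.2] at h3
    simp only [smul_eq_mul] at h3
    -- The two roots in `x` are the two dual vectors inside one plane.
    have h4 : x * (1 - x * q v) = 0 := by linear_combination h2 - x * h3
    rcases mul_eq_zero.1 h4 with rfl | h5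
    · left
      have : y = 1 := by linear_combination h3
      simp [this]
    · right
      have hx : x = (q v)⁻¹ := by
        field_simp
        linear_combination -h5
      have hy : y = -1 := by linear_combination h3 + 2 * h5
      rw [hx, hy]
      simp [sub_eq_add_neg]
  · rintro (rfl | rfl)
    · rfl
    · refine (span_pair_eq ?_ ?_ ?_ ?_ rfl)
      · exact Submodule.mem_span_pair.2 ⟨1, 0, by simp⟩
      · exact Submodule.mem_span_pair.2 ⟨(q v)⁻¹, -1, by simp [sub_eq_add_neg]⟩
      · exact Submodule.mem_span_pair.2 ⟨1, 0, by simp⟩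
      · exact Submodule.mem_span_pair.2 ⟨(q v)⁻¹, -1, by simp [sub_eq_add_neg]⟩

/-- An anisotropic `v = x e + y f` has `x` and `y` nonzero, so rescaling `e` makes it dual to `v`.
Conversely `v - q(v) e` is the isotropic partner of a dual vector `e`. -/
theorem hypPlanes_through_eq_image {v : U} (hv : q v ≠ 0) :
    {W | W ∈ hypPlanes q ∧ v ∈ W} = (fun e => Submodule.span F {v, e}) '' isotropicDual q v := by
  ext W
  constructor
  · rintro ⟨⟨e, f, he, hf, hef, hW⟩, hvW⟩
    rw [hW] at hvW
    obtain ⟨x, y, rfl⟩ := Submodule.mem_span_pair.1 hvW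
    rw [smul_mem_hypPair he hf hef] at hv
    have hx : x ≠ 0 := left_ne_zero_of_mul hv
    have hy : y ≠ 0 := right_ne_zero_of_mul hv
    refine ⟨y⁻¹ • e, ⟨by rw [q.map_smul, he, smul_zero], ?_⟩, ?_⟩
    · rw [polar_smul_left, polar_add_right, polar_smul_right, polar_smul_right, hef,
        polar_self_eq, he]
      simp [hy]
    · refine (span_pair_eq ?_ ?_ ?_ ?_ hW).symm
      · exact Submodule.mem_span_pair.2 ⟨x, y, rfl⟩
      · exact Submodule.mem_span_pair.2 ⟨y⁻¹, 0, by simp⟩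
      · exact Submodule.mem_span_pair.2 ⟨0, y, by simp [smul_smul, hy]⟩
      · refine Submodule.mem_span_pair.2 ⟨y⁻¹, -x, ?_⟩
        rw [smul_add, smul_smul, smul_smul, smul_smul, inv_mul_cancel₀ hy, neg_mul, neg_smul,
          mul_comm x]
        simp
  · rintro ⟨e, ⟨he, hev⟩, rfl⟩
    refine ⟨⟨v - q v • e, e, ?_, he, ?_, ?_⟩, Submodule.subset_span (by simp)⟩
    · rw [form_sub, q.map_smul, he, polar_smul_right, polar_comm q v e, hev]
      simp
    · rw [polar_sub_left, polar_smul_left, polar_self_eq, he, polar_comm, hev]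
      simp
    · refine (span_pair_eq ?_ ?_ ?_ ?_ rfl)
      · exact Submodule.mem_span_pair.2 ⟨1, -q v, by simp [sub_eq_add_neg]⟩
      · exact Submodule.mem_span_pair.2 ⟨0, 1, by simp⟩
      · exact Submodule.mem_span_pair.2 ⟨1, q v, by simp⟩
      · exact Submodule.mem_span_pair.2 ⟨0, 1, by simp⟩

/-- For anisotropic `v` the map from dual vectors to planes is exactly two-to-one. -/
theorem two_mul_planeCount [Finite U] {v : U} (hv : q v ≠ 0) :
    2 * planeCount q v = (isotropicDual q v).ncard := by
  classical
  have := Fintype.ofFinite U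
  rw [planeCount, hypPlanes_through_eq_image hv]
  set E : Finset U := (isotropicDual q v).toFinset with hE
  have hEm : ∀ e, e ∈ E ↔ e ∈ isotropicDual q v := fun e => Set.mem_toFinset
  set sp : U → Submodule F U := fun e => Submodule.span F {v, e}
  have h1 : (sp '' isotropicDual q v).ncard = (E.image sp).card := by
    rw [← Set.ncard_coe_finset, Finset.coe_image, hE, Set.coe_toFinset]
  have h2 : (isotropicDual q v).ncard = E.card := by
    rw [← Set.ncard_coe_finset, hE, Set.coe_toFinset]
  rw [h1, h2, Finset.card_eq_sum_card_image sp E]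
  rw [Finset.sum_const_nat (m := 2), mul_comm]
  intro W hW
  obtain ⟨e, he, rfl⟩ := Finset.mem_image.1 hW
  have hf := isotropicDual_flip hv ((hEm e).1 he)
  rw [Finset.card_eq_two]
  refine ⟨e, (q v)⁻¹ • v - e, hf.2.symm, ?_⟩
  ext e'
  rw [Finset.mem_filter, hEm, Finset.mem_insert, Finset.mem_singleton]
  constructor
  · rintro ⟨h, h'⟩
    exact (isotropicDual_sub_mem_iff hv ((hEm e).1 he) h).1 h'
  · intro h
    have h' : e' ∈ isotropicDual q v := by
      rcases h with rfl | rfl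
      · exact (hEm _).1 he
      · exact hf.1
    exact ⟨h', (isotropicDual_sub_mem_iff hv ((hEm e).1 he) h').2 h⟩

theorem ncard_isotropicDual_basis_zero [Finite F] {b : Basis (Fin 3) F U} (hb : IsFrame q b) :
    (isotropicDual q (b 0)).ncard = Nat.card F := by
  have h : isotropicDual q (b 0) =
      (fun z : F => (-(z ^ 2 * q (b 2))) • b 0 + (1 : F) • b 1 + z • b 2) '' Set.univ := by
    ext e
    constructor
    · rintro ⟨h1, h2⟩
      rw [basis_sum b e, hb.form_eq] at h1
      rw [basis_sum b e, hb.polar_zero] at h2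
      refine ⟨b.repr e 2, trivial, ?_⟩
      conv_rhs => rw [basis_sum b e]
      rw [h2] at h1 ⊢
      simp only []
      rw [show -((b.repr e) 2 ^ 2 * q (b 2)) = b.repr e 0 by linear_combination -h1]
    · rintro ⟨z, -, rfl⟩
      exact ⟨by rw [hb.form_eq]; ring, by rw [hb.polar_zero]⟩
  rw [h, Set.ncard_image_of_injective, Set.ncard_univ]
  intro z z' hz
  exact (combination_inj b hz).2.2

theorem IsFrame.polar_dual {b : Basis (Fin 3) F U} (hb : IsFrame q b) (n x y z : F) :
    polar q (x • b 0 + y • b 1 + z • b 2) (b 1 + n • b 0) = x + n * y := by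
  rw [polar_add_right, polar_smul_right, hb.polar_zero, hb.polar_one, smul_eq_mul]

/-- The points lie on `xy + cz² = 0` and `x + ny = 1`. For `x ≠ 0` the slope `s = z/x` is a
parameter, with `y = -cs²x` and `x(1 - ncs²) = 1`; the one point with `x = 0` is `n⁻¹ • b 1`. -/
theorem ncard_isotropicDual_of_ne [Finite F] {b : Basis (Fin 3) F U} (hb : IsFrame q b)
    (hc : q (b 2) ≠ 0) {n : F} (hn : n ≠ 0) :
    (isotropicDual q (b 1 + n • b 0)).ncard = {s : F | n * q (b 2) * s ^ 2 ≠ 1}.ncard + 1 := by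
  set c := q (b 2) with hcdef
  set A : Set F := {s : F | n * c * s ^ 2 ≠ 1} with hA
  set φ : F → U := fun s => ((1 - n * c * s ^ 2)⁻¹) • b 0 + ((1 - n * c * s ^ 2)⁻¹ * -(c * s ^ 2)) • b 1 +
    ((1 - n * c * s ^ 2)⁻¹ * s) • b 2 with hφ
  set w : U := (0 : F) • b 0 + n⁻¹ • b 1 + (0 : F) • b 2 with hw
  have hne : ∀ s ∈ A, 1 - n * c * s ^ 2 ≠ 0 := fun s hs h => hs (by linear_combination -h)
  have h : isotropicDual q (b 1 + n • b 0) = insert w (φ '' A) := by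
    ext e
    constructor
    · rintro ⟨h1, h2⟩
      rw [basis_sum b e, hb.form_eq, ← hcdef] at h1
      rw [basis_sum b e, hb.polar_dual] at h2
      set x := b.repr e 0
      set y := b.repr e 1
      set z := b.repr e 2
      have he : e = x • b 0 + y • b 1 + z • b 2 := basis_sum b e
      by_cases hx : x = 0
      · left
        have hz : z = 0 := by
          rw [hx, zero_mul, zero_add] at h1
          simpa [hc] using h1
        have hy : y = n⁻¹ := by
          field_simp
          linear_combination h2 - hx
        rw [he, hx, hy, hz]
      · right
        have hk : 1 - n * c * (z / x) ^ 2 = x⁻¹ := by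
          field_simp
          linear_combination h2 * x - n * h1
        refine ⟨z / x, fun hs => ?_, ?_⟩
        · rw [hs] at hk
          simp at hk
          exact hx hk.symm
        · rw [he, hφ]
          simp only []
          rw [hk, inv_inv, show x * -(c * (z / x) ^ 2) = y by
            field_simp
            linear_combination -h1, show x * (z / x) = z by field_simp]
    · rintro (rfl | ⟨s, hs, rfl⟩)
      · exact ⟨by rw [hw, hb.form_eq]; ring, by rw [hw, hb.polar_dual]; field_simp; ring⟩
      · have := hne s hs
        refine ⟨?_, ?_⟩
        · rw [hφ]
          simp only []
          rw [hb.form_eq]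
          ring
        · rw [hφ]
          simp only []
          rw [hb.polar_dual]
          field_simp
          ring
  rw [h, Set.ncard_insert_of_notMem _ ((Set.toFinite A).image φ), Set.InjOn.ncard_image]
  · intro s hs s' hs' hss
    obtain ⟨h1, -, h3⟩ := combination_inj b hss
    rw [h1] at h3
    exact mul_left_cancel₀ (inv_ne_zero (hne s' hs')) h3
  · rintro ⟨s, hs, hs'⟩
    obtain ⟨h1, -, -⟩ := combination_inj b hs'
    exact inv_ne_zero (hne s hs) h1

/-- Here the isotropy condition is `xy = 0`, and the duals form two disjoint affine lines with
parameter `z`. -/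
theorem ncard_isotropicDual_of_eq_zero [Finite F] {b : Basis (Fin 3) F U} (hb : IsFrame q b)
    (hc : q (b 2) = 0) {n : F} (hn : n ≠ 0) :
    (isotropicDual q (b 1 + n • b 0)).ncard = 2 * Nat.card F := by
  set φ : F → U := fun z => (1 : F) • b 0 + (0 : F) • b 1 + z • b 2 with hφ
  set ψ : F → U := fun z => (0 : F) • b 0 + n⁻¹ • b 1 + z • b 2 with hψ
  have h : isotropicDual q (b 1 + n • b 0) = φ '' Set.univ ∪ ψ '' Set.univ := by
    ext e
    constructor
    · rintro ⟨h1, h2⟩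
      rw [basis_sum b e, hb.form_eq, hc, mul_zero, add_zero, mul_eq_zero] at h1
      rw [basis_sum b e, hb.polar_dual] at h2
      rcases h1 with h1 | h1
      · right
        refine ⟨b.repr e 2, trivial, ?_⟩
        conv_rhs => rw [basis_sum b e]
        rw [h1, zero_add] at h2
        rw [hψ, h1, eq_inv_of_mul_eq_one_right h2]
      · left
        refine ⟨b.repr e 2, trivial, ?_⟩
        conv_rhs => rw [basis_sum b e]
        rw [h1, mul_zero, add_zero] at h2
        rw [hφ, h1, h2]
    · rintro (⟨z, -, rfl⟩ | ⟨z, -, rfl⟩)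
      · exact ⟨by rw [hφ]; simp only []; rw [hb.form_eq, hc]; ring,
          by rw [hφ]; simp only []; rw [hb.polar_dual]; ring⟩
      · exact ⟨by rw [hψ]; simp only []; rw [hb.form_eq, hc]; ring,
          by rw [hψ]; simp only []; rw [hb.polar_dual]; field_simp; ring⟩
  rw [h, Set.ncard_union_eq, Set.ncard_image_of_injective, Set.ncard_image_of_injective,
    Set.ncard_univ, two_mul]
  · intro z z' hz
    exact (combination_inj b hz).2.2
  · intro z z' hz
    exact (combination_inj b hz).2.2
  · rw [Set.disjoint_left]
    rintro _ ⟨z, -, rfl⟩ ⟨z', -, h'⟩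
    exact zero_ne_one (combination_inj b h').1
  
end FiniteField

/-! ### Counting hyperbolic planes in ternary spaces over a finite field -/

section FiniteField

variable {F U : Type*} [Field F] [AddCommGroup U] [Module F U] {q : QuadraticForm F U}

theorem exists_frame_of_isotropic [Module.Finite F U] (hU : finrank F U = 3) {v w : U}
    (hv : q v = 0) (hw : polar q v w ≠ 0) :
    ∃ b : Basis (Fin 3) F U, IsFrame q b ∧ b 0 = v := by
  obtain ⟨w', hw'⟩ : ∃ w', w' = (polar q v w)⁻¹ • w := ⟨_, rfl⟩
  have h1 : polar q v w' = 1 := by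
    rw [hw', polar_smul_right, smul_eq_mul, inv_mul_cancel₀ hw]
  obtain ⟨b, hb, hb0, -⟩ := exists_frame (q := q) hU hv (f := w' - q w' • v)
    (by rw [form_sub, q.map_smul, hv, polar_smul_right, polar_comm q w' v, h1]; simp)
    (by rw [polar_sub_right, polar_smul_right, polar_self_eq, hv, h1]; simp)
  exact ⟨b, hb, hb0⟩

/-- The pair `e, v - q(v) e` is hyperbolic, which puts `v` into the normal form used in the counts
above. -/
theorem exists_frame_of_isotropicDual [Module.Finite F U] (hU : finrank F U = 3) {v e : U}
    (he : e ∈ isotropicDual q v) :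
    ∃ b : Basis (Fin 3) F U, IsFrame q b ∧ v = b 1 + q v • b 0 := by
  obtain ⟨h1, h2⟩ := he
  obtain ⟨b, hb, hb0, hb1⟩ := exists_frame (q := q) hU h1 (f := v - q v • e)
    (by rw [form_sub, q.map_smul, h1, polar_smul_right, polar_comm q v e, h2]; simp)
    (by rw [polar_sub_right, polar_smul_right, polar_self_eq, h1, h2]; simp)
  exact ⟨b, hb, by rw [hb0, hb1]; simp⟩

theorem IsFrame.radical {b : Basis (Fin 3) F U} (hb : IsFrame q b) {v : U}
    (h0 : polar q v (b 0) = 0) (h1 : polar q v (b 1) = 0) : v = b.repr v 2 • b 2 := by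
  rw [basis_sum b v, hb.polar_zero] at h0
  rw [basis_sum b v, hb.polar_one] at h1
  conv_lhs => rw [basis_sum b v, h0, h1, zero_smul, zero_smul, zero_add, zero_add]

/-- An intrinsic form of degeneracy, so that it can be moved from one frame to another. Isotropy of
the radical vector matters in characteristic 2, where the polar form of a ternary space always has a
radical. -/
theorem IsFrame.form_two_eq_zero_iff {b : Basis (Fin 3) F U} (hb : IsFrame q b) :
    q (b 2) = 0 ↔ ∃ v, v ≠ 0 ∧ q v = 0 ∧ ∀ w, polar q v w = 0 := by
  constructor
  · intro h
    refine ⟨b 2, b.ne_zero 2, h, fun w => ?_⟩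
    rw [polar_comm, basis_sum b w, hb.polar_two, h]
    ring
  · rintro ⟨v, hv, hqv, hw⟩
    have h := hb.radical (hw _) (hw _)
    rw [h, q.map_smul] at hqv
    rcases mul_eq_zero.1 hqv with h2 | h2
    · rw [mul_self_eq_zero.1 h2, zero_smul] at h
      exact absurd h hv
    · exact h2

/-- The isotropic vectors span: besides `b 0` and `b 1` there is `-q(b 2) b 0 + b 1 + b 2`. So a
vector outside the radical cannot be orthogonal to all of them. -/
theorem IsFrame.exists_isotropicDual {b : Basis (Fin 3) F U} (hb : IsFrame q b) {v w : U}
    (hw : polar q v w ≠ 0) : ∃ e, e ∈ isotropicDual q v := by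
  suffices h : ∃ e, q e = 0 ∧ polar q v e ≠ 0 by
    obtain ⟨e, he, hve⟩ := h
    refine ⟨(polar q v e)⁻¹ • e, by rw [q.map_smul, he, smul_zero], ?_⟩
    rw [polar_smul_left, polar_comm q e v, smul_eq_mul, inv_mul_cancel₀ hve]
  by_contra! h
  have h0 := h _ hb.form_zero
  have h1 := h _ hb.form_one
  have h2 := h ((-q (b 2)) • b 0 + (1 : F) • b 1 + (1 : F) • b 2) (by rw [hb.form_eq]; ring)
  rw [polar_comm, polar_combination, polar_comm q _ v, polar_comm q _ v, polar_comm q _ v, h0, h1,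
    mul_zero, mul_zero, zero_add, zero_add, one_mul] at h2
  apply hw
  rw [basis_sum b w, polar_comm, polar_combination, polar_comm q _ v, polar_comm q _ v,
    polar_comm q _ v, h0, h1, h2]
  ring

theorem planeCount_eq_card [Finite U] [Finite F] (hU : finrank F U = 3) {v w : U}
    (hv : q v = 0) (hw : polar q v w ≠ 0) : planeCount q v = Nat.card F := by
  obtain ⟨b, hb, rfl⟩ := exists_frame_of_isotropic hU hv hw
  rw [planeCount_of_isotropic hv (b.ne_zero 0), ncard_isotropicDual_basis_zero hb]

theorem isotropicDual_eq_empty {v : U} (h : ∀ w, polar q v w = 0) : isotropicDual q v = ∅ := by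
  ext e
  simp [isotropicDual, polar_comm q e v, h e]

theorem planeCount_radical {v : U} (hv0 : v ≠ 0) (hv : q v = 0)
    (h : ∀ w, polar q v w = 0) : planeCount q v = 0 := by
  rw [planeCount_of_isotropic hv hv0, isotropicDual_eq_empty h, Set.ncard_empty]

theorem planeCount_radical_of_ne [Finite U] {v : U} (hv : q v ≠ 0)
    (h : ∀ w, polar q v w = 0) : planeCount q v = 0 := by
  have h1 := two_mul_planeCount hv
  rw [isotropicDual_eq_empty h, Set.ncard_empty] at h1
  omega

theorem planeCount_of_degenerate [Finite U] [Finite F] (hU : finrank F U = 3)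
    {b : Basis (Fin 3) F U} (hb : IsFrame q b) (hc : q (b 2) = 0) {v : U} (hv : q v ≠ 0) :
    planeCount q v = Nat.card F := by
  have hw : ∃ w, polar q v w ≠ 0 := by
    by_contra! h
    have h1 := hb.radical (h _) (h _)
    rw [h1, q.map_smul, hc, smul_zero] at hv
    exact hv rfl
  obtain ⟨w, hw⟩ := hw
  obtain ⟨e, he⟩ := hb.exists_isotropicDual hw
  obtain ⟨b', hb', h'⟩ := exists_frame_of_isotropicDual hU he
  have hc' : q (b' 2) = 0 := hb'.form_two_eq_zero_iff.2 (hb.form_two_eq_zero_iff.1 hc)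
  have h2 := two_mul_planeCount hv
  have h3 := ncard_isotropicDual_of_eq_zero hb' hc' hv
  rw [← h'] at h3
  omega

theorem planeCount_of_card_two [Finite U] [Finite F] (hF : ∀ x : F, x ≠ 0 → x = 1)
    (hU : finrank F U = 3) {b : Basis (Fin 3) F U} (hb : IsFrame q b) (hc : q (b 2) ≠ 0)
    {v w : U} (hv : q v ≠ 0) (hw : polar q v w ≠ 0) : planeCount q v = 1 := by
  obtain ⟨e, he⟩ := hb.exists_isotropicDual hw
  obtain ⟨b', hb', h'⟩ := exists_frame_of_isotropicDual hU he
  have hc' : q (b' 2) ≠ 0 :=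
    fun h => hc (hb.form_two_eq_zero_iff.2 (hb'.form_two_eq_zero_iff.1 h))
  have h2 := two_mul_planeCount hv
  have h3 := ncard_isotropicDual_of_ne hb' hc' hv
  rw [← h', hF _ hv, hF _ hc'] at h3
  have h4 : {s : F | (1 : F) * 1 * s ^ 2 ≠ 1} = {0} := by
    ext s
    simp only [one_mul, Set.mem_ofPred_eq, Set.mem_singleton_iff]
    constructor
    · intro h
      by_contra hs
      exact h (by rw [hF s hs, one_pow])
    · rintro rfl
      simp
  rw [h4, Set.ncard_singleton] at h3
  omega

/-- There are `1 + χ(m)` solutions of `m s² = 1`. Removing them from the field and adding the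
exceptional point leaves `|F| - χ(m)` dual vectors, two for each plane. -/
theorem two_mul_planeCount_of_odd [Fintype F] [DecidableEq F] [Finite U]
    (hF : ringChar F ≠ 2) (hU : finrank F U = 3) {b : Basis (Fin 3) F U} (hb : IsFrame q b)
    (hc : q (b 2) ≠ 0) {v : U} (hv : q v ≠ 0) :
    (2 * planeCount q v : ℤ) = Fintype.card F - quadraticChar F (q v * q (b 2)) := by
  have h20 : (2 : F) ≠ 0 := Ring.two_ne_zero hF
  have hw : polar q v v ≠ 0 := by
    rw [polar_self_eq]
    exact mul_ne_zero h20 hv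
  obtain ⟨e, he⟩ := hb.exists_isotropicDual hw
  obtain ⟨b', hb', h'⟩ := exists_frame_of_isotropicDual hU he
  obtain ⟨u, hu, hu2⟩ := hb.exists_unit hb'
  have hc'2 : q (b' 2) = u ^ 2 * q (b 2) := mul_left_cancel₀ h20 (by linear_combination hu2)
  have hc' : q (b' 2) ≠ 0 := by
    rw [hc'2]
    exact mul_ne_zero (pow_ne_zero 2 hu.ne_zero) hc
  have h2 := two_mul_planeCount hv
  have h3 := ncard_isotropicDual_of_ne hb' hc' hv
  rw [← h', ← h2] at h3
  have hm : q v * q (b' 2) ≠ 0 := mul_ne_zero hv hc'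
  set m := q v * q (b' 2) with hmdef
  have h4 : {s : F | m * s ^ 2 ≠ 1} = {s : F | s ^ 2 = m⁻¹}ᶜ := by
    ext s
    simp only [Set.mem_ofPred_eq, Set.mem_compl_iff]
    rw [← mul_eq_one_iff_eq_inv₀ hm, mul_comm]
  have h5 := quadraticChar_card_sqrts hF m⁻¹
  rw [← Set.ncard_eq_toFinset_card'] at h5
  have h6 := Set.ncard_add_ncard_compl {s : F | s ^ 2 = m⁻¹}
  rw [← h4, Nat.card_eq_fintype_card] at h6
  have h7 : quadraticChar F m⁻¹ = quadraticChar F (q v * q (b 2)) := by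
    -- Inverting `m` and passing from the frame `b'` to `b` both change it by a square only.
    have h8 : m⁻¹ = q v * q (b 2) * (u * m⁻¹) ^ 2 := by
      field_simp
      rw [hmdef, hc'2]
      ring
    rw [h8, map_mul, map_pow, quadraticChar_sq_one (mul_ne_zero hu.ne_zero (inv_ne_zero hm)),
      mul_one]
  rw [h7] at h5
  have h9 : ((2 * planeCount q v : ℕ) : ℤ) = _ := congrArg Nat.cast h3
  push_cast at h9
  have h10 : ((({s : F | s ^ 2 = m⁻¹}).ncard + ({s : F | m * s ^ 2 ≠ 1}).ncard : ℕ) : ℤ) =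
    Fintype.card F := congrArg Nat.cast h6
  push_cast at h10
  linarith

variable (q) in
/-- The isotropic vectors outside the radical. -/
def properIsotropic : Set U := {v | q v = 0 ∧ ∃ w, polar q v w ≠ 0}

theorem ncard_ne_zero [Finite F] : {x : F | x ≠ 0}.ncard = Nat.card F - 1 := by
  have h1 : {x : F | x ≠ 0} = {0}ᶜ := by
    ext
    simp
  have h := Set.ncard_add_ncard_compl ({0} : Set F)
  rw [← h1, Set.ncard_singleton] at h
  omega

theorem ncard_properIsotropic_inter [Finite F] {e f : U} (he : q e = 0) (hf : q f = 0)
    (hef : polar q e f = 1) :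
    {v | v ∈ properIsotropic q ∧ v ∈ Submodule.span F {e, f}}.ncard = 2 * (Nat.card F - 1) := by
  have hee : polar q e e = 0 := by rw [polar_self_eq, he, mul_zero]
  have h : {v | v ∈ properIsotropic q ∧ v ∈ Submodule.span F {e, f}} =
      (fun x : F => x • e) '' {x | x ≠ 0} ∪ (fun x : F => x • f) '' {x | x ≠ 0} := by
    ext v
    constructor
    · rintro ⟨⟨h1, w, h2⟩, h3⟩
      obtain ⟨x, y, rfl⟩ := Submodule.mem_span_pair.1 h3
      rw [smul_mem_hypPair he hf hef, mul_eq_zero] at h1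
      rcases h1 with rfl | rfl
      · right
        refine ⟨y, ?_, by simp⟩
        rintro rfl
        simp at h2
      · left
        refine ⟨x, ?_, by simp⟩
        rintro rfl
        simp at h2
    · rintro (⟨x, hx, rfl⟩ | ⟨x, hx, rfl⟩)
      · refine ⟨⟨by simp [q.map_smul, he], f, ?_⟩, Submodule.mem_span_pair.2 ⟨x, 0, by simp⟩⟩
        simpa [polar_smul_left, hef] using hx
      · refine ⟨⟨by simp [q.map_smul, hf], e, ?_⟩, Submodule.mem_span_pair.2 ⟨0, x, by simp⟩⟩
        simpa [polar_smul_left, polar_comm q f e, hef] using hx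
  have hi1 : Function.Injective (fun x : F => x • e) := fun x y hxy => by
    have := congrArg (fun t => polar q t f) hxy
    simpa [polar_smul_left, hef] using this
  have hi2 : Function.Injective (fun x : F => x • f) := fun x y hxy => by
    have := congrArg (fun t => polar q e t) hxy
    simpa [polar_smul_right, hef] using this
  rw [h, Set.ncard_union_eq, Set.ncard_image_of_injective _ hi1, Set.ncard_image_of_injective _ hi2,
    ncard_ne_zero, two_mul]
  · rw [Set.disjoint_left]
    rintro _ ⟨x, hx, rfl⟩ ⟨y, hy, h'⟩
    have := congrArg (fun t => polar q e t) h'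
    simp only [polar_smul_right, hef, hee] at this
    exact hy (by simpa using this)

/-- Double count incidences: each proper isotropic vector lies on `|F|` hyperbolic planes, and each
plane contains two punctured isotropic lines. This yields the number of all planes, that is, the
count through 0. -/
theorem ncard_properIsotropic_mul [Finite U] [Finite F] (hU : finrank F U = 3) :
    (properIsotropic q).ncard * Nat.card F =
      (hypPlanes q).ncard * (2 * (Nat.card F - 1)) := by
  classical
  have := Fintype.ofFinite U
  have := Fintype.ofFinite (Submodule F U)
  have h := Finset.sum_card_bipartiteAbove_eq_sum_card_bipartiteBelow
    (s := (properIsotropic q).toFinset) (t := (hypPlanes q).toFinset) (fun v W => v ∈ W)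
  rw [Finset.sum_const_nat (m := Nat.card F), Finset.sum_const_nat (m := 2 * (Nat.card F - 1)),
    ← Set.ncard_eq_toFinset_card', ← Set.ncard_eq_toFinset_card'] at h
  · exact h
  · intro W hW
    obtain ⟨e, f, he, hf, hef, rfl⟩ := Set.mem_toFinset.1 hW
    rw [← ncard_properIsotropic_inter he hf hef, ← Set.ncard_coe_finset]
    congr 1
    ext v
    simp [Finset.bipartiteBelow]
  · intro v hv
    obtain ⟨h1, w, h2⟩ := Set.mem_toFinset.1 hv
    rw [← planeCount_eq_card hU h1 h2, planeCount, ← Set.ncard_coe_finset]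
    congr 1
    ext W
    simp [Finset.bipartiteAbove]

theorem planeCount_zero : planeCount q 0 = (hypPlanes q).ncard := by
  simp [planeCount]

theorem IsFrame.properIsotropic_iff {b : Basis (Fin 3) F U} (hb : IsFrame q b) (x y z : F) :
    x • b 0 + y • b 1 + z • b 2 ∈ properIsotropic q ↔
      x * y + z ^ 2 * q (b 2) = 0 ∧ (x ≠ 0 ∨ y ≠ 0 ∨ z * (2 * q (b 2)) ≠ 0) := by
  rw [properIsotropic, Set.mem_ofPred_eq, hb.form_eq]
  refine and_congr_right fun _ => ⟨?_, ?_⟩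
  · rintro ⟨w, hw⟩
    by_contra! h
    apply hw
    rw [polar_comm, basis_sum b w, polar_combination, polar_comm q (b 0), polar_comm q (b 1),
      polar_comm q (b 2), hb.polar_zero, hb.polar_one, hb.polar_two, h.1, h.2.1, h.2.2]
    ring
  · rintro (h | h | h)
    · exact ⟨b 1, by rwa [hb.polar_one]⟩
    · exact ⟨b 0, by rwa [hb.polar_zero]⟩
    · exact ⟨b 2, by rwa [hb.polar_two]⟩

/-- If `y ≠ 0`, then `y` and `z` are free and determine `x`. If `y = 0`, then `z = 0` and `x` is any
nonzero scalar. -/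
theorem ncard_properIsotropic_of_ne [Finite F] {b : Basis (Fin 3) F U}
    (hb : IsFrame q b) (hc : q (b 2) ≠ 0) :
    (properIsotropic q).ncard = (Nat.card F - 1) * Nat.card F + (Nat.card F - 1) := by
  set c := q (b 2) with hcdef
  set φ : F × F → U := fun t => (-(t.2 ^ 2 * c) * t.1⁻¹) • b 0 + t.1 • b 1 + t.2 • b 2 with hφ
  set ψ : F → U := fun x => x • b 0 + (0 : F) • b 1 + (0 : F) • b 2 with hψ
  have h : properIsotropic q = φ '' ({x | x ≠ 0} ×ˢ Set.univ) ∪ ψ '' {x | x ≠ 0} := by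
    ext v
    constructor
    · intro hv
      rw [basis_sum b v, hb.properIsotropic_iff, ← hcdef] at hv
      obtain ⟨h1, h2⟩ := hv
      by_cases hy : b.repr v 1 = 0
      · right
        rw [hy, mul_zero, zero_add] at h1
        have hz : b.repr v 2 = 0 := by simpa [hc] using h1
        refine ⟨b.repr v 0, ?_, ?_⟩
        · simpa [hy, hz] using h2
        · conv_rhs => rw [basis_sum b v, hy, hz]
      · left
        refine ⟨(b.repr v 1, b.repr v 2), ⟨hy, trivial⟩, ?_⟩
        conv_rhs => rw [basis_sum b v]
        simp only [hφ]
        rw [show -(b.repr v 2 ^ 2 * c) * (b.repr v 1)⁻¹ = b.repr v 0 by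
          field_simp
          linear_combination -h1]
    · rintro (⟨⟨y, z⟩, ⟨hy, -⟩, rfl⟩ | ⟨x, hx, rfl⟩)
      · have hy' : y ≠ 0 := hy
        rw [hφ, hb.properIsotropic_iff]
        exact ⟨by field_simp; ring, Or.inr (Or.inl hy')⟩
      · rw [hψ, hb.properIsotropic_iff]
        exact ⟨by ring, Or.inl hx⟩
  rw [h, Set.ncard_union_eq _ ((Set.toFinite _).image _) ((Set.toFinite _).image _),
    Set.ncard_image_of_injective, Set.ncard_image_of_injective, Set.ncard_prod, Set.ncard_univ,
    ncard_ne_zero]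
  · intro x x' hx
    exact (combination_inj b hx).1
  · rintro ⟨y, z⟩ ⟨y', z'⟩ hy
    have := combination_inj b hy
    exact Prod.ext this.2.1 this.2.2
  · rw [Set.disjoint_left]
    rintro _ ⟨⟨y, z⟩, ⟨hy, -⟩, rfl⟩ ⟨x, -, h'⟩
    exact hy (combination_inj b h').2.1.symm

theorem ncard_properIsotropic_of_eq_zero [Finite F] {b : Basis (Fin 3) F U}
    (hb : IsFrame q b) (hc : q (b 2) = 0) :
    (properIsotropic q).ncard = 2 * ((Nat.card F - 1) * Nat.card F) := by
  set φ : F × F → U := fun t => (0 : F) • b 0 + t.1 • b 1 + t.2 • b 2 with hφ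
  set ψ : F × F → U := fun t => t.1 • b 0 + (0 : F) • b 1 + t.2 • b 2 with hψ
  have h : properIsotropic q =
      φ '' ({x | x ≠ 0} ×ˢ Set.univ) ∪ ψ '' ({x | x ≠ 0} ×ˢ Set.univ) := by
    ext v
    constructor
    · intro hv
      rw [basis_sum b v, hb.properIsotropic_iff, hc, mul_zero, add_zero, mul_eq_zero] at hv
      obtain ⟨h1 | h1, h2⟩ := hv
      · left
        refine ⟨(b.repr v 1, b.repr v 2), ⟨?_, trivial⟩, ?_⟩
        · simpa [h1] using h2
        · conv_rhs => rw [basis_sum b v, h1]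
      · right
        refine ⟨(b.repr v 0, b.repr v 2), ⟨?_, trivial⟩, ?_⟩
        · simpa [h1] using h2
        · conv_rhs => rw [basis_sum b v, h1]
    · rintro (⟨⟨y, z⟩, ⟨hy, -⟩, rfl⟩ | ⟨⟨y, z⟩, ⟨hy, -⟩, rfl⟩)
      · rw [hφ, hb.properIsotropic_iff, hc]
        exact ⟨by ring, Or.inr (Or.inl hy)⟩
      · rw [hψ, hb.properIsotropic_iff, hc]
        exact ⟨by ring, Or.inl hy⟩
  rw [h, Set.ncard_union_eq _ ((Set.toFinite _).image _) ((Set.toFinite _).image _),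
    Set.ncard_image_of_injective, Set.ncard_image_of_injective, Set.ncard_prod, Set.ncard_univ,
    ncard_ne_zero, two_mul]
  · rintro ⟨y, z⟩ ⟨y', z'⟩ hy
    have := combination_inj b hy
    exact Prod.ext this.1 this.2.2
  · rintro ⟨y, z⟩ ⟨y', z'⟩ hy
    have := combination_inj b hy
    exact Prod.ext this.2.1 this.2.2
  · rw [Set.disjoint_left]
    rintro _ ⟨⟨y, z⟩, ⟨hy, -⟩, rfl⟩ ⟨x, -, h'⟩
    exact hy (combination_inj b h').2.1.symm

theorem two_mul_ncard_hypPlanes [Finite U] [Finite F] (hU : finrank F U = 3)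
    {b : Basis (Fin 3) F U} (hb : IsFrame q b) (hc : q (b 2) ≠ 0) :
    2 * planeCount q 0 = Nat.card F * (Nat.card F + 1) := by
  have h := ncard_properIsotropic_mul (q := q) hU
  rw [ncard_properIsotropic_of_ne hb hc] at h
  rw [planeCount_zero]
  have h1 : 1 < Nat.card F := Finite.one_lt_card
  -- Writing `|F| = m + 2` removes the truncated subtraction; the factor to cancel is `m + 1`.
  obtain ⟨m, hm⟩ := Nat.exists_eq_add_of_lt h1
  rw [hm] at h ⊢
  have h2 : 1 + m + 1 - 1 = m + 1 := by omega
  rw [h2] at h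
  apply Nat.eq_of_mul_eq_mul_left (Nat.succ_pos m)
  rw [Nat.succ_eq_add_one]
  linarith

theorem ncard_hypPlanes_of_eq_zero [Finite U] [Finite F] (hU : finrank F U = 3)
    {b : Basis (Fin 3) F U} (hb : IsFrame q b) (hc : q (b 2) = 0) :
    planeCount q 0 = Nat.card F ^ 2 := by
  have h := ncard_properIsotropic_mul (q := q) hU
  rw [ncard_properIsotropic_of_eq_zero hb hc] at h
  rw [planeCount_zero]
  have h1 : 1 < Nat.card F := Finite.one_lt_card
  obtain ⟨m, hm⟩ := Nat.exists_eq_add_of_lt h1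
  rw [hm] at h ⊢
  have h2 : 1 + m + 1 - 1 = m + 1 := by omega
  rw [h2] at h
  apply Nat.eq_of_mul_eq_mul_left (Nat.succ_pos m)
  rw [Nat.succ_eq_add_one]
  linarith

end FiniteField

/-! ### Lifting hyperbolic pairs from the residue field to the p-adic integers -/

section PadicLift

variable {p : ℕ} [Fact p.Prime] {N : Type*} [AddCommGroup N] [Module ℤ_[p] N]
  {q : QuadraticForm ℤ_[p] N}

/-- Hensel's lemma at 0, where the value `c` is divisible by `p` and the derivative `β` is a unit.
-/
theorem exists_root_of_dvd {a β c : ℤ_[p]} (hc : (p : ℤ_[p]) ∣ c) (hβ : (p : ℤ_[p]) ∣ β - 1) :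
    ∃ t : ℤ_[p], (p : ℤ_[p]) ∣ t ∧ a * t ^ 2 + β * t + c = 0 := by
  have hβ1 : ‖β‖ = 1 := by
    have h1 : ‖β - 1‖ < 1 := PadicInt.norm_lt_one_iff_dvd _ |>.2 hβ
    have h2 : ‖(β - 1) + 1‖ = max ‖β - 1‖ ‖(1 : ℤ_[p])‖ :=
      PadicInt.norm_add_eq_max_of_ne (by rw [norm_one]; exact h1.ne)
    rw [sub_add_cancel, norm_one, max_eq_right h1.le] at h2
    exact h2
  let P : Polynomial ℤ_[p] := Polynomial.C a * Polynomial.X ^ 2 + Polynomial.C β * Polynomial.X +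
    Polynomial.C c
  have hP : ∀ t, Polynomial.aeval t P = a * t ^ 2 + β * t + c := fun t => by simp [P]
  have hP' : Polynomial.aeval 0 (Polynomial.derivative P) = β := by simp [P]
  obtain ⟨t, ht, ht0, -⟩ := hensels_lemma (F := P) (a := (0 : ℤ_[p])) (by
    rw [hP, hP', hβ1]
    simpa using (PadicInt.norm_lt_one_iff_dvd _).2 hc)
  rw [hP', hβ1, sub_zero] at ht0
  rw [hP] at ht
  exact ⟨t, (PadicInt.norm_lt_one_iff_dvd _).1 ht0, ht⟩

theorem exists_inverse_of_dvd {γ : ℤ_[p]} (h : (p : ℤ_[p]) ∣ γ - 1) :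
    ∃ δ : ℤ_[p], γ * δ = 1 ∧ (p : ℤ_[p]) ∣ δ - 1 := by
  have hpl : (p : ℤ_[p]) ∈ IsLocalRing.maximalIdeal ℤ_[p] := by
    rw [PadicInt.maximalIdeal_eq_span_p]
    exact Ideal.mem_span_singleton_self _
  have hu : IsUnit γ := by
    by_contra hγ
    have h1 : γ ∈ IsLocalRing.maximalIdeal ℤ_[p] := (IsLocalRing.mem_maximalIdeal _).2 hγ
    have h2 : γ - 1 ∈ IsLocalRing.maximalIdeal ℤ_[p] := Ideal.mem_of_dvd _ h hpl
    have h3 : (1 : ℤ_[p]) ∈ IsLocalRing.maximalIdeal ℤ_[p] := by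
      have := sub_mem h1 h2
      rwa [sub_sub_cancel] at this
    exact (IsLocalRing.mem_maximalIdeal _).1 h3 isUnit_one
  obtain ⟨δ, hδ⟩ := hu.exists_right_inv
  refine ⟨δ, hδ, ?_⟩
  obtain ⟨k, hk⟩ := h
  exact ⟨-k * δ, by linear_combination hδ - δ * hk⟩

/-- A hyperbolic pair modulo `p` lifts to a frame. -/
theorem exists_frame_lift [Module.Free ℤ_[p] N] [Module.Finite ℤ_[p] N]
    (hN : finrank ℤ_[p] N = 3) {e f : N} (he : (p : ℤ_[p]) ∣ q e) (hf : (p : ℤ_[p]) ∣ q f)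
    (hef : (p : ℤ_[p]) ∣ polar q e f - 1) :
    ∃ b : Basis (Fin 3) ℤ_[p] N, IsFrame q b ∧ (∃ y, b 0 = e + (p : ℤ_[p]) • y) ∧
      ∃ y, b 1 = f + (p : ℤ_[p]) • y := by
  -- `q(e + t f)` is the quadratic polynomial in `t` with coefficients `q f`, `polar q e f`, `q e`.
  -- Its root `t` is divisible by `p`, so `e` moves only modulo `p`.
  obtain ⟨t, ⟨t', ht'⟩, ht⟩ := exists_root_of_dvd (a := q f) he hef
  set e' := e + t • f with he'
  have hqe' : q e' = 0 := by
    rw [he', QuadraticMap.map_add (⇑q), q.map_smul, polar_smul_right, smul_eq_mul, smul_eq_mul]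
    linear_combination ht
  have hγ : polar q e' f = polar q e f + 2 * t * q f := by
    rw [he', polar_add_left, polar_smul_left, polar_self_eq, smul_eq_mul]
    ring
  obtain ⟨δ, hδ, hδ'⟩ := exists_inverse_of_dvd (p := p) (γ := polar q e' f) (by
    rw [hγ, show polar q e f + 2 * t * q f - 1 = (polar q e f - 1) + 2 * t * q f by ring]
    exact dvd_add hef (Dvd.dvd.mul_left hf _))
  obtain ⟨f', hf'⟩ : ∃ f', f' = δ • f := ⟨_, rfl⟩
  have hef' : polar q e' f' = 1 := by rw [hf', polar_smul_right, smul_eq_mul, mul_comm, hδ]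
  -- Subtracting `q(f') e'` makes the second vector isotropic without changing its pairing with
  -- `e'`; as `p` divides `q f`, this too is a change modulo `p`.
  obtain ⟨b, hb, hb0, hb1⟩ := exists_frame (q := q) hN hqe' (f := f' - q f' • e')
    (by rw [form_sub, q.map_smul, hqe', polar_smul_right, polar_comm q f' e', hef']; simp)
    (by rw [polar_sub_right, polar_smul_right, polar_self_eq, hqe', hef']; simp)
  obtain ⟨d, hd⟩ := hδ'
  obtain ⟨k, hk⟩ := hf
  refine ⟨b, hb, ⟨t' • f, ?_⟩, ⟨d • f - (δ * δ * k) • e', ?_⟩⟩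
  · rw [hb0, he', ht', smul_smul]
  · have h1 : δ = 1 + p * d := by linear_combination hd
    rw [hb1, hf', q.map_smul, hk, smul_eq_mul, smul_sub, smul_smul, smul_smul]
    rw [show δ * δ * (↑p * k) = ↑p * (δ * δ * k) by ring]
    conv_lhs => enter [1, 1]; rw [h1]
    rw [add_smul, one_smul]
    abel

end PadicLift

/-! ### Bases and integrality of localizations -/

section Localization

variable {V : Type*} [AddCommGroup V] [Module ℚ V]

theorem IsZLattice.exists_int {L : QuadLattice V} (hL : L.IsZLattice) {x : V} (hx : x ∈ L.lat) :
    ∃ k : ℤ, L.form x = k := by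
  obtain ⟨k, hk⟩ := Submodule.mem_one.1 (hL.norm_le (Submodule.subset_span ⟨x, hx, rfl⟩))
  exact ⟨k, hk.symm⟩

theorem exists_rat_basis {ι : Type*} {L : QuadLattice V}
    (hspan : Submodule.span ℚ (L.lat : Set V) = ⊤) (β : Basis ι ℤ L.lat) :
    ∃ b : Basis ι ℚ V, ∀ i, b i = β i := by
  have hli : LinearIndependent ℤ (fun i => (β i : V)) :=
    β.linearIndependent.map' L.lat.subtype (Submodule.ker_subtype _)
  have hli' : LinearIndependent ℚ (fun i => (β i : V)) :=
    (LinearIndependent.iff_fractionRing ℤ ℚ).1 hli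
  refine ⟨Basis.mk hli' ?_, fun i => Basis.mk_apply _ _ i⟩
  rw [← hspan, Submodule.span_le]
  intro x hx
  have h2 : (⟨x, hx⟩ : L.lat) ∈ Submodule.span ℤ (Set.range β) := by
    rw [β.span_eq]
    trivial
  have h3 := Submodule.mem_map_of_mem (f := L.lat.subtype) h2
  rw [Submodule.map_span, ← Set.range_comp] at h3
  exact Submodule.span_subset_span ℤ ℚ _ h3

theorem IsZLattice.exists_basis (hV : finrank ℚ V = 3) {L : QuadLattice V} (hL : L.IsZLattice) :
    Nonempty (Basis (Fin 3) ℤ L.lat) := by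
  have : Module.Finite ℤ L.lat := Module.Finite.iff_fg.2 hL.fg
  have : IsTorsionFree ℤ V := IsTorsionFree.trans_faithfulSMul ℤ ℚ V
  have : IsTorsionFree ℤ L.lat := inferInstance
  let b := Module.Free.chooseBasis ℤ L.lat
  obtain ⟨c, -⟩ := exists_rat_basis hL.span_eq_top b
  have h := Module.finrank_eq_card_basis c
  rw [hV] at h
  exact ⟨b.reindex (Fintype.equivFinOfCardEq h.symm)⟩

variable (p : ℕ) [Fact p.Prime]

@[simp] theorem localForm_one_tmul (L : QuadLattice V) (x : V) :
    L.localForm p (1 ⊗ₜ x) = (L.form x : ℚ_[p]) := by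
  rw [localForm, QuadraticForm.baseChange_tmul, mul_one, Rat.smul_one_eq_cast]

@[simp] theorem polar_localForm_one_tmul (L : QuadLattice V) (x y : V) :
    polar (L.localForm p) (1 ⊗ₜ x) (1 ⊗ₜ y) = ((polar L.form x y : ℚ) : ℚ_[p]) := by
  rw [polar, ← TensorProduct.tmul_add]
  simp [polar]

theorem one_tmul_mem {L : QuadLattice V} {x : V} (hx : x ∈ L.lat) :
    (1 : ℚ_[p]) ⊗ₜ[ℚ] x ∈ L.localLat p := Submodule.subset_span ⟨x, hx, rfl⟩

theorem intCast_smul_one_tmul (n : ℤ) (x : V) :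
    (n : ℤ_[p]) • ((1 : ℚ_[p]) ⊗ₜ[ℚ] x) = 1 ⊗ₜ (n • x) := by
  rw [Int.cast_smul_eq_zsmul]
  exact (map_zsmul (TensorProduct.mk ℚ ℚ_[p] V 1) n x).symm

theorem coe_smul_tensor (a : ℤ_[p]) (x : ℚ_[p] ⊗[ℚ] V) : (a : ℚ_[p]) • x = a • x :=
  algebraMap_smul ℚ_[p] a x

variable {p}

theorem mem_localLat_iff {L : QuadLattice V} (β : Basis (Fin 3) ℤ L.lat)
    {x : ℚ_[p] ⊗[ℚ] V} : x ∈ L.localLat p ↔ ∃ a b c : ℤ_[p],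
      x = a • (1 ⊗ₜ (β 0 : V)) + b • (1 ⊗ₜ (β 1 : V)) + c • (1 ⊗ₜ (β 2 : V)) := by
  constructor
  · intro hx
    refine Submodule.span_induction ?_ ?_ ?_ ?_ hx
    · rintro _ ⟨y, hy, rfl⟩
      refine ⟨(β.repr ⟨y, hy⟩ 0 : ℤ), (β.repr ⟨y, hy⟩ 1 : ℤ), (β.repr ⟨y, hy⟩ 2 : ℤ), ?_⟩
      have h := congrArg (fun t : L.lat => (t : V)) (basis_sum β ⟨y, hy⟩)
      rw [intCast_smul_one_tmul, intCast_smul_one_tmul, intCast_smul_one_tmul,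
        ← TensorProduct.tmul_add, ← TensorProduct.tmul_add]
      exact congrArg _ h
    · exact ⟨0, 0, 0, by simp⟩
    · rintro _ _ _ _ ⟨a, b, c, rfl⟩ ⟨a', b', c', rfl⟩
      exact ⟨a + a', b + b', c + c', by simp only [add_smul]; abel⟩
    · rintro t _ _ ⟨a, b, c, rfl⟩
      exact ⟨t * a, t * b, t * c, by simp only [smul_add, smul_smul]⟩
  · rintro ⟨a, b, c, rfl⟩
    exact add_mem (add_mem (Submodule.smul_mem _ _ (one_tmul_mem p (β 0).2))
      (Submodule.smul_mem _ _ (one_tmul_mem p (β 1).2)))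
      (Submodule.smul_mem _ _ (one_tmul_mem p (β 2).2))

theorem PadicInt.exists_int_add (k : ℕ) (a : ℤ_[p]) :
    ∃ (n : ℤ) (a' : ℤ_[p]), a = n + (p : ℤ_[p]) ^ k * a' := by
  obtain ⟨c, hc⟩ := Ideal.mem_span_singleton.1 (PadicInt.appr_spec k a)
  exact ⟨(a.appr k : ℕ), c, by rw [← hc]; push_cast; ring⟩

/-- Approximation of elements of `L_p` by elements of `L`. -/
theorem exists_approx {L : QuadLattice V} (k : ℕ) {x : ℚ_[p] ⊗[ℚ] V} (hx : x ∈ L.localLat p) :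
    ∃ y ∈ L.lat, ∃ z ∈ L.localLat p, x = 1 ⊗ₜ y + ((p : ℤ_[p]) ^ k) • z := by
  refine Submodule.span_induction ?_ ?_ ?_ ?_ hx
  · rintro _ ⟨y, hy, rfl⟩
    exact ⟨y, hy, 0, zero_mem _, by simp⟩
  · exact ⟨0, zero_mem _, 0, zero_mem _, by simp⟩
  · rintro _ _ _ _ ⟨y, hy, z, hz, rfl⟩ ⟨y', hy', z', hz', rfl⟩
    refine ⟨y + y', add_mem hy hy', z + z', add_mem hz hz', ?_⟩
    rw [TensorProduct.tmul_add, smul_add]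
    abel
  · rintro t _ _ ⟨y, hy, z, hz, rfl⟩
    obtain ⟨n, a, ha⟩ := PadicInt.exists_int_add k t
    refine ⟨n • y, L.lat.smul_mem n hy, a • (1 ⊗ₜ y) + t • z,
      add_mem (Submodule.smul_mem _ _ (one_tmul_mem p hy)) (Submodule.smul_mem _ _ hz), ?_⟩
    conv_lhs => rw [smul_add, ha, add_smul, intCast_smul_one_tmul]
    rw [ha, smul_smul, smul_add, smul_smul, smul_smul, mul_comm ((p : ℤ_[p]) ^ k) (_ + _)]
    abel

theorem smul_form_combination {W : Type*} [AddCommGroup W] [Module ℚ_[p] W] [Module ℤ_[p] W]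
    [IsScalarTower ℤ_[p] ℚ_[p] W] (Q : QuadraticForm ℚ_[p] W) (e f g : W) (a b c : ℤ_[p]) :
    Q (a • e + b • f + c • g) = a ^ 2 * Q e + b ^ 2 * Q f + c ^ 2 * Q g + a * b * polar Q e f +
      a * c * polar Q e g + b * c * polar Q f g := by
  rw [← form_combination]
  simp only [← algebraMap_smul ℚ_[p] (_ : ℤ_[p]) (_ : W)]
  rfl

theorem polar_of_form_multiple {L : QuadLattice V} {m : ℤ}
    (h : ∀ x ∈ L.lat, ∃ k : ℤ, L.form x = m * k) {x y : V} (hx : x ∈ L.lat) (hy : y ∈ L.lat) :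
    ∃ k : ℤ, polar L.form x y = m * k := by
  obtain ⟨k1, h1⟩ := h _ (add_mem hx hy)
  obtain ⟨k2, h2⟩ := h _ hx
  obtain ⟨k3, h3⟩ := h _ hy
  exact ⟨k1 - k2 - k3, by rw [polar, h1, h2, h3]; push_cast; ring⟩

/-- All values on `L_p` are p-adic combinations of the values and polar values on a global basis.
The case `m = 1` is integrality; `m` prime serves for primitivity within the genus. -/
theorem localForm_multiple {L : QuadLattice V} (β : Basis (Fin 3) ℤ L.lat) {m : ℤ}
    (h : ∀ x ∈ L.lat, ∃ k : ℤ, L.form x = m * k) {x : ℚ_[p] ⊗[ℚ] V} (hx : x ∈ L.localLat p) :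
    ∃ t : ℤ_[p], L.localForm p x = m * t := by
  obtain ⟨a, b, c, rfl⟩ := (mem_localLat_iff β).1 hx
  obtain ⟨k0, h0⟩ := h _ (β 0).2
  obtain ⟨k1, h1⟩ := h _ (β 1).2
  obtain ⟨k2, h2⟩ := h _ (β 2).2
  obtain ⟨k3, h3⟩ := polar_of_form_multiple h (β 0).2 (β 1).2
  obtain ⟨k4, h4⟩ := polar_of_form_multiple h (β 0).2 (β 2).2
  obtain ⟨k5, h5⟩ := polar_of_form_multiple h (β 1).2 (β 2).2
  refine ⟨a ^ 2 * k0 + b ^ 2 * k1 + c ^ 2 * k2 + a * b * k3 + a * c * k4 + b * c * k5, ?_⟩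
  rw [smul_form_combination]
  simp only [localForm_one_tmul, polar_localForm_one_tmul, h0, h1, h2, h3, h4, h5]
  push_cast
  ring

theorem IsZLattice.localForm_int (hV : finrank ℚ V = 3) {L : QuadLattice V} (hL : L.IsZLattice)
    {x : ℚ_[p] ⊗[ℚ] V} (hx : x ∈ L.localLat p) :
    ∃ t : ℤ_[p], L.localForm p x = algebraMap ℤ_[p] ℚ_[p] t := by
  obtain ⟨β⟩ := hL.exists_basis hV
  obtain ⟨t, ht⟩ := localForm_multiple β (m := 1) (fun x hx => by
    obtain ⟨k, hk⟩ := hL.exists_int hx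
    exact ⟨k, by rw [hk]; simp⟩) hx
  exact ⟨t, by rw [ht]; simp⟩

theorem exists_localLat_basis (hV : finrank ℚ V = 3) {L : QuadLattice V} (hL : L.IsZLattice) :
    Nonempty (Basis (Fin 3) ℤ_[p] (L.localLat p)) := by
  obtain ⟨β⟩ := hL.exists_basis hV
  obtain ⟨b, hb⟩ := exists_rat_basis hL.span_eq_top β
  let B := Algebra.TensorProduct.basis ℚ_[p] b
  have hB : ∀ i, B i = 1 ⊗ₜ (β i : V) := fun i => by
    rw [← hb]
    exact Algebra.TensorProduct.basis_apply b i
  have hli : LinearIndependent ℤ_[p] B := B.linearIndependent.restrict_scalars (by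
    intro x y hxy
    exact Subtype.ext (by simpa [Algebra.smul_def] using hxy))
  have hspan : Submodule.span ℤ_[p] (Set.range B) = L.localLat p := by
    apply le_antisymm
    · rw [Submodule.span_le]
      rintro _ ⟨i, rfl⟩
      rw [hB]
      exact one_tmul_mem p (β i).2
    · intro x hx
      obtain ⟨a, b, c, rfl⟩ := (mem_localLat_iff β).1 hx
      rw [← hB, ← hB, ← hB]
      have hm : ∀ i, B i ∈ Submodule.span ℤ_[p] (Set.range B) :=
        fun i => Submodule.subset_span ⟨i, rfl⟩
      exact add_mem (add_mem (Submodule.smul_mem _ _ (hm 0)) (Submodule.smul_mem _ _ (hm 1)))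
        (Submodule.smul_mem _ _ (hm 2))
  exact ⟨(Basis.span hli).map (LinearEquiv.ofEq _ _ hspan)⟩

end Localization

/-! ### The sublattices ℤe + ℤf + pM all lie in one genus -/

section HyperbolicSublattices

variable {V : Type*} [AddCommGroup V] [Module ℚ V]

/-- `e, f ∈ M` is a hyperbolic pair modulo `p`. -/
structure IsHypPair (p : ℕ) (Q : QuadraticForm ℚ V) (M : Submodule ℤ V) (e f : V) : Prop where
  mem_left : e ∈ M
  mem_right : f ∈ M
  form_left : ∃ k : ℤ, Q e = p * k
  form_right : ∃ k : ℤ, Q f = p * k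
  polar_eq : ∃ k : ℤ, polar Q e f = 1 + p * k

/-- The lattice `ℤe + ℤf + pM`. -/
def hypLat (p : ℕ) (M : Submodule ℤ V) (e f : V) : Submodule ℤ V :=
  Submodule.span ℤ {e, f} ⊔ M.map ((p : ℤ) • LinearMap.id)

theorem mem_hypLat {p : ℕ} {M : Submodule ℤ V} {e f x : V} :
    x ∈ hypLat p M e f ↔ ∃ m n : ℤ, ∃ y ∈ M, x = m • e + n • f + (p : ℤ) • y := by
  rw [hypLat, Submodule.mem_sup]
  constructor
  · rintro ⟨_, hu, _, ⟨y, hy, rfl⟩, rfl⟩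
    obtain ⟨m, n, rfl⟩ := Submodule.mem_span_pair.1 hu
    exact ⟨m, n, y, hy, rfl⟩
  · rintro ⟨m, n, y, hy, rfl⟩
    exact ⟨_, Submodule.mem_span_pair.2 ⟨m, n, rfl⟩, _, ⟨y, hy, rfl⟩, rfl⟩

theorem smul_mem_hypLat {p : ℕ} {M : Submodule ℤ V} {e f y : V} (hy : y ∈ M) :
    (p : ℤ) • y ∈ hypLat p M e f :=
  mem_hypLat.2 ⟨0, 0, y, hy, by simp⟩

theorem left_mem_hypLat {p : ℕ} {M : Submodule ℤ V} {e f : V} : e ∈ hypLat p M e f :=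
  mem_hypLat.2 ⟨1, 0, 0, zero_mem _, by simp⟩

theorem right_mem_hypLat {p : ℕ} {M : Submodule ℤ V} {e f : V} : f ∈ hypLat p M e f :=
  mem_hypLat.2 ⟨0, 1, 0, zero_mem _, by simp⟩

theorem IsHypPair.hypLat_le {p : ℕ} {Q : QuadraticForm ℚ V} {M : Submodule ℤ V} {e f : V}
    (h : IsHypPair p Q M e f) : hypLat p M e f ≤ M := by
  intro x hx
  obtain ⟨m, n, y, hy, rfl⟩ := mem_hypLat.1 hx
  exact add_mem (add_mem (M.smul_mem _ h.mem_left) (M.smul_mem _ h.mem_right)) (M.smul_mem _ hy)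

theorem norm_le_one_iff {L : QuadLattice V} :
    L.norm ≤ 1 ↔ ∀ x ∈ L.lat, ∃ k : ℤ, L.form x = k := by
  rw [norm, Submodule.span_le]
  constructor
  · intro h x hx
    obtain ⟨k, hk⟩ := Submodule.mem_one.1 (h ⟨x, hx, rfl⟩)
    exact ⟨k, hk.symm⟩
  · rintro h _ ⟨x, hx, rfl⟩
    obtain ⟨k, hk⟩ := h x hx
    exact Submodule.mem_one.2 ⟨k, hk.symm⟩

theorem IsHypPair.isZLattice {p : ℕ} (hp : p ≠ 0) {Q : QuadraticForm ℚ V} {M : Submodule ℤ V}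
    {e f : V} (hM : IsZLattice ⟨Q, M⟩) (h : IsHypPair p Q M e f) :
    IsZLattice ⟨Q, hypLat p M e f⟩ where
  posDef := hM.posDef
  fg := (Submodule.fg_span (by simp)).sup (hM.fg.map _)
  span_eq_top := by
    rw [eq_top_iff, ← hM.span_eq_top, Submodule.span_le]
    intro x hx
    have h1 : (p : ℤ) • x ∈ Submodule.span ℚ (hypLat p M e f : Set V) :=
      Submodule.subset_span (smul_mem_hypLat hx)
    have h2 := Submodule.smul_mem _ ((p : ℚ)⁻¹) h1
    rw [← Int.cast_smul_eq_zsmul ℚ, smul_smul, Int.cast_natCast,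
      inv_mul_cancel₀ (Nat.cast_ne_zero.2 hp), one_smul] at h2
    exact h2
  norm_le := norm_le_one_iff.2 fun x hx => hM.exists_int (h.hypLat_le hx)

/-- Away from `p` the sublattice already contains `pM_q = M_q`, since `p` is a unit. -/
theorem localLat_hypLat_of_ne {p : ℕ} [Fact p.Prime] {q : ℕ} [Fact q.Prime] (hqp : q ≠ p)
    {Q : QuadraticForm ℚ V} {M : Submodule ℤ V} {e f : V} (h : IsHypPair p Q M e f) :
    localLat q ⟨Q, hypLat p M e f⟩ = localLat q ⟨Q, M⟩ := by
  apply le_antisymm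
  · exact Submodule.span_mono (Set.image_mono h.hypLat_le)
  · refine Submodule.span_le.2 ?_
    rintro _ ⟨x, hx, rfl⟩
    have hu : IsUnit (p : ℤ_[q]) := by
      rw [PadicInt.isUnit_iff]
      refine le_antisymm (PadicInt.norm_le_one _) (not_lt.1 fun hlt => ?_)
      have h1 : (q : ℤ) ∣ (p : ℤ) := (PadicInt.norm_int_lt_one_iff_dvd (p : ℤ)).1 (by
        simpa using hlt)
      exact hqp ((Nat.prime_dvd_prime_iff_eq Fact.out Fact.out).1 (Int.natCast_dvd_natCast.1 h1))
    obtain ⟨u, hu⟩ := hu.exists_left_inv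
    have h1 := one_tmul_mem q (L := ⟨Q, hypLat p M e f⟩) (smul_mem_hypLat (e := e) (f := f) hx)
    have h2 := Submodule.smul_mem _ u h1
    rw [← intCast_smul_one_tmul, smul_smul, Int.cast_natCast, hu, one_smul] at h2
    exact h2

/-- The `ℤ_p`-valued quadratic form on the localization. -/
def localInt (p : ℕ) [Fact p.Prime] (hV : finrank ℚ V = 3) (L : QuadLattice V)
    (hL : L.IsZLattice) : QuadraticForm ℤ_[p] (L.localLat p) :=
  intForm (L.localForm p) (L.localLat p) fun _ hx => hL.localForm_int hV hx

variable {p : ℕ} [Fact p.Prime]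

theorem coe_localInt (hV : finrank ℚ V = 3) {L : QuadLattice V} (hL : L.IsZLattice)
    (x : L.localLat p) : ((localInt p hV L hL x : ℤ_[p]) : ℚ_[p]) = L.localForm p x :=
  algebraMap_intForm _ _ _ x

theorem coe_polar_localInt (hV : finrank ℚ V = 3) {L : QuadLattice V} (hL : L.IsZLattice)
    (x y : L.localLat p) : ((polar (localInt p hV L hL) x y : ℤ_[p]) : ℚ_[p]) =
      polar (L.localForm p) (x : ℚ_[p] ⊗[ℚ] V) y :=
  algebraMap_polar_intForm _ _ _ x y

/-- The pair lifts to a frame of `M_p` that agrees with it modulo `p`. In this frame the sublattice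
is given by one condition, divisibility of the third coordinate by `p`. -/
theorem exists_local_frame (hV : finrank ℚ V = 3) {Q : QuadraticForm ℚ V} {M : Submodule ℤ V}
    {e f : V} (hM : IsZLattice ⟨Q, M⟩) (h : IsHypPair p Q M e f) :
    ∃ b : Basis (Fin 3) ℤ_[p] (localLat p ⟨Q, M⟩), IsFrame (localInt p hV ⟨Q, M⟩ hM) b ∧
      ∀ x, x ∈ localLat p ⟨Q, hypLat p M e f⟩ ↔ ∃ s t r : ℤ_[p],
        x = s • (b 0 : ℚ_[p] ⊗[ℚ] V) + t • (b 1 : ℚ_[p] ⊗[ℚ] V) +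
          (p * r) • (b 2 : ℚ_[p] ⊗[ℚ] V) := by
  obtain ⟨β⟩ := exists_localLat_basis (p := p) hV hM
  have := Module.Free.of_basis β
  have := Module.Finite.of_basis β
  have hrk : finrank ℤ_[p] (localLat p ⟨Q, M⟩) = 3 := by
    rw [finrank_eq_card_basis β, Fintype.card_fin]
  set e' : localLat p ⟨Q, M⟩ := ⟨1 ⊗ₜ e, one_tmul_mem p h.mem_left⟩
  set f' : localLat p ⟨Q, M⟩ := ⟨1 ⊗ₜ f, one_tmul_mem p h.mem_right⟩
  have he : (p : ℤ_[p]) ∣ localInt p hV ⟨Q, M⟩ hM e' := by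
    obtain ⟨k, hk⟩ := h.form_left
    refine ⟨k, Subtype.ext ?_⟩
    rw [coe_localInt, localForm_one_tmul]
    simp [hk]
  have hf : (p : ℤ_[p]) ∣ localInt p hV ⟨Q, M⟩ hM f' := by
    obtain ⟨k, hk⟩ := h.form_right
    refine ⟨k, Subtype.ext ?_⟩
    rw [coe_localInt, localForm_one_tmul]
    simp [hk]
  have hef : (p : ℤ_[p]) ∣ polar (localInt p hV ⟨Q, M⟩ hM) e' f' - 1 := by
    obtain ⟨k, hk⟩ := h.polar_eq
    refine ⟨k, Subtype.ext ?_⟩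
    rw [PadicInt.coe_sub, coe_polar_localInt, polar_localForm_one_tmul]
    simp [hk]
  obtain ⟨b, hb, ⟨y, hy⟩, ⟨z, hz⟩⟩ := exists_frame_lift hrk he hf hef
  refine ⟨b, hb, fun x => ?_⟩
  have hy' : (b 0 : ℚ_[p] ⊗[ℚ] V) = 1 ⊗ₜ e + (p : ℤ_[p]) • (y : ℚ_[p] ⊗[ℚ] V) :=
    congrArg Subtype.val hy
  have hz' : (b 1 : ℚ_[p] ⊗[ℚ] V) = 1 ⊗ₜ f + (p : ℤ_[p]) • (z : ℚ_[p] ⊗[ℚ] V) :=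
    congrArg Subtype.val hz
  have hp : ∀ w ∈ localLat p ⟨Q, M⟩, (p : ℤ_[p]) • w ∈ localLat p ⟨Q, hypLat p M e f⟩ := by
    intro w hw
    refine Submodule.span_induction (p := fun w _ => (p : ℤ_[p]) • w ∈
      localLat p ⟨Q, hypLat p M e f⟩) ?_ ?_ ?_ ?_ hw
    · rintro _ ⟨v, hv, rfl⟩
      have := one_tmul_mem p (L := ⟨Q, hypLat p M e f⟩) (smul_mem_hypLat (e := e) (f := f) hv)
      rw [← intCast_smul_one_tmul, Int.cast_natCast] at this
      exact this
    · simp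
    · intro a c _ _ ha hc
      rw [smul_add]
      exact add_mem ha hc
    · intro t a _ ha
      rw [smul_comm]
      exact Submodule.smul_mem _ _ ha
  constructor
  · intro hx
    refine Submodule.span_induction ?_ ?_ ?_ ?_ hx
    · rintro _ ⟨v, hv, rfl⟩
      obtain ⟨m, n, w, hw, rfl⟩ := mem_hypLat.1 hv
      set w' : localLat p ⟨Q, M⟩ := ⟨1 ⊗ₜ w, one_tmul_mem p hw⟩
      set d : localLat p ⟨Q, M⟩ := w' - (m : ℤ_[p]) • y - (n : ℤ_[p]) • z
      -- With `b 0 = e + p y` and `b 1 = f + p z`, the vector `m e + n f + p w` is `m b 0 + n b 1 +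
      -- p d` for `d = w - m y - n z`.
      refine ⟨m + p * b.repr d 0, n + p * b.repr d 1, b.repr d 2, ?_⟩
      have h1 := congrArg (fun t : localLat p ⟨Q, M⟩ => (p : ℤ_[p]) • (t : ℚ_[p] ⊗[ℚ] V))
        (basis_sum b d)
      have h2 : (p : ℤ_[p]) • (d : ℚ_[p] ⊗[ℚ] V) = (p : ℤ_[p]) • (1 ⊗ₜ w) -
          (m : ℤ_[p]) • (p : ℤ_[p]) • (y : ℚ_[p] ⊗[ℚ] V) -
          (n : ℤ_[p]) • (p : ℤ_[p]) • (z : ℚ_[p] ⊗[ℚ] V) := by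
        rw [smul_comm (m : ℤ_[p]), smul_comm (n : ℤ_[p]), ← smul_sub, ← smul_sub]
        rfl
      simp only [h2, Submodule.coe_add, Submodule.coe_smul, smul_add, smul_smul] at h1
      simp only [TensorProduct.tmul_add, ← intCast_smul_one_tmul, add_smul, Int.cast_natCast]
      rw [eq_sub_of_add_eq hy'.symm, eq_sub_of_add_eq hz'.symm, smul_sub, smul_sub, smul_smul,
        smul_smul]
      rw [add_add_add_comm, ← sub_eq_zero] 
      rw [← sub_eq_zero] at h1
      rw [← h1]
      abel
    · exact ⟨0, 0, 0, by simp⟩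
    · rintro _ _ _ _ ⟨s, t, r, rfl⟩ ⟨s', t', r', rfl⟩
      exact ⟨s + s', t + t', r + r', by simp only [add_smul, mul_add]; abel⟩
    · rintro a _ _ ⟨s, t, r, rfl⟩
      exact ⟨a * s, a * t, a * r, by simp only [smul_add, smul_smul, mul_left_comm]⟩
  · rintro ⟨s, t, r, rfl⟩
    have h0 : (b 0 : ℚ_[p] ⊗[ℚ] V) ∈ localLat p ⟨Q, hypLat p M e f⟩ := by
      rw [hy']
      exact add_mem (one_tmul_mem p (L := ⟨Q, hypLat p M e f⟩) left_mem_hypLat) (hp _ y.2)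
    have h1 : (b 1 : ℚ_[p] ⊗[ℚ] V) ∈ localLat p ⟨Q, hypLat p M e f⟩ := by
      rw [hz']
      exact add_mem (one_tmul_mem p (L := ⟨Q, hypLat p M e f⟩) right_mem_hypLat) (hp _ z.2)
    refine add_mem (add_mem (Submodule.smul_mem _ _ h0) (Submodule.smul_mem _ _ h1)) ?_
    rw [mul_comm, mul_smul]
    exact Submodule.smul_mem _ _ (hp _ (b 2).2)

theorem exists_padic_basis (hV : finrank ℚ V = 3) {P : Submodule ℤ_[p] (ℚ_[p] ⊗[ℚ] V)}
    (b : Basis (Fin 3) ℤ_[p] P) :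
    ∃ B : Basis (Fin 3) ℚ_[p] (ℚ_[p] ⊗[ℚ] V), ∀ i, B i = b i := by
  have hli : LinearIndependent ℤ_[p] (fun i => (b i : ℚ_[p] ⊗[ℚ] V)) :=
    b.linearIndependent.map' P.subtype (Submodule.ker_subtype _)
  have hli' := (LinearIndependent.iff_fractionRing ℤ_[p] ℚ_[p]).1 hli
  refine ⟨basisOfLinearIndependentOfCardEqFinrank hli' ?_, fun i => ?_⟩
  · rw [finrank_baseChange, hV, Fintype.card_fin]
  · rw [coe_basisOfLinearIndependentOfCardEqFinrank]

/-- The third vectors of two frames of `M_p` have values differing by the square of a unit `u`.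
Matching the hyperbolic pairs and sending `b 2` to `u⁻¹ c 2` is an isometry that respects
divisibility of the third coordinate by `p`. -/
theorem localIso_hypLat_self (hV : finrank ℚ V = 3) {Q : QuadraticForm ℚ V}
    {M : Submodule ℤ V} {e f e' f' : V} (hM : IsZLattice ⟨Q, M⟩) (h : IsHypPair p Q M e f)
    (h' : IsHypPair p Q M e' f') :
    LocalIso p (⟨Q, hypLat p M e f⟩ : QuadLattice V) ⟨Q, hypLat p M e' f'⟩ := by
  obtain ⟨b, hb, hbm⟩ := exists_local_frame hV hM h
  obtain ⟨c, hc, hcm⟩ := exists_local_frame hV hM h'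
  obtain ⟨u, hu, hu2⟩ := hb.exists_unit hc
  obtain ⟨w, hw⟩ := hu.exists_right_inv
  obtain ⟨B, hB⟩ := exists_padic_basis hV b
  obtain ⟨C, hC⟩ := exists_padic_basis hV c
  have hBf : IsFrame (localForm p (⟨Q, M⟩ : QuadLattice V)) B := by
    constructor <;> simp only [hB, ← coe_localInt hV hM, ← coe_polar_localInt hV hM]
    · rw [hb.form_zero]; rfl
    · rw [hb.form_one]; rfl
    · rw [hb.polar_zero_one]; rfl
    · rw [hb.polar_zero_two]; rfl
    · rw [hb.polar_one_two]; rfl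
  have hCf : IsFrame (localForm p (⟨Q, M⟩ : QuadLattice V)) C := by
    constructor <;> simp only [hC, ← coe_localInt hV hM, ← coe_polar_localInt hV hM]
    · rw [hc.form_zero]; rfl
    · rw [hc.form_one]; rfl
    · rw [hc.polar_zero_one]; rfl
    · rw [hc.polar_zero_two]; rfl
    · rw [hc.polar_one_two]; rfl
  have hBC : localForm p (⟨Q, M⟩ : QuadLattice V) (C 2) =
      (u : ℚ_[p]) ^ 2 * localForm p (⟨Q, M⟩ : QuadLattice V) (B 2) := by
    have h2 := congrArg (fun t : ℤ_[p] => (t : ℚ_[p])) hu2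
    simp only [PadicInt.coe_mul, PadicInt.coe_pow, coe_localInt] at h2
    rw [hB, hC]
    have h3 : ((2 : ℤ_[p]) : ℚ_[p]) ≠ 0 := by
      have : ((2 : ℤ_[p]) : ℚ_[p]) = 2 := by norm_cast
      rw [this]
      exact two_ne_zero
    exact mul_left_cancel₀ h3 (by rw [h2]; ring)
  have hw' : (u : ℚ_[p]) * (w : ℚ_[p]) = 1 := by
    rw [← PadicInt.coe_mul, hw, PadicInt.coe_one]
  have hw0 : (w : ℚ_[p]) ≠ 0 := right_ne_zero_of_mul_eq_one hw'
  let D := C.isUnitSMul (w := ![1, 1, (w : ℚ_[p])]) (by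
    intro i
    fin_cases i
    · exact isUnit_one
    · exact isUnit_one
    · exact hw0.isUnit)
  have hD : ∀ i, D i = ![1, 1, (w : ℚ_[p])] i • C i := fun i => Basis.isUnitSMul_apply _ i
  let σ : (ℚ_[p] ⊗[ℚ] V) ≃ₗ[ℚ_[p]] (ℚ_[p] ⊗[ℚ] V) := B.equiv D (Equiv.refl _)
  have hσ : ∀ x y z : ℚ_[p], σ (x • B 0 + y • B 1 + z • B 2) =
      x • C 0 + y • C 1 + (z * w) • C 2 := by
    intro x y z
    simp only [map_add, map_smul, σ, Basis.equiv_apply, Equiv.refl_apply, hD,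
      Matrix.cons_val_zero, Matrix.cons_val_one, Matrix.cons_val, one_smul, smul_smul]
  have hiso : ∀ x, localForm p (⟨Q, M⟩ : QuadLattice V) (σ x) =
      localForm p (⟨Q, M⟩ : QuadLattice V) x := by
    intro x
    rw [basis_sum B x, hσ, hBf.form_eq, hCf.form_eq, hBC]
    linear_combination (B.repr x 2) ^ 2 * localForm p (⟨Q, M⟩ : QuadLattice V) (B 2) *
      ((u : ℚ_[p]) * w + 1) * hw'
  refine ⟨⟨σ, hiso⟩, fun x => ?_⟩
  change σ x ∈ _ ↔ _
  rw [hbm, hcm]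
  simp only [← hB, ← hC, ← coe_smul_tensor]
  rw [basis_sum B x, hσ]
  constructor
  · rintro ⟨s, t, r, hx⟩
    obtain ⟨h1, h2, h3⟩ := combination_inj C hx
    refine ⟨s, t, r * u, ?_⟩
    rw [h1, h2, show B.repr x 2 = ((p * (r * u) : ℤ_[p]) : ℚ_[p]) by
      push_cast at h3 ⊢
      linear_combination (u : ℚ_[p]) * h3 - B.repr x 2 * hw']
  · rintro ⟨s, t, r, hx⟩
    obtain ⟨h1, h2, h3⟩ := combination_inj B hx
    refine ⟨s, t, r * w, ?_⟩
    rw [h1, h2, h3]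
    push_cast
    ring_nf

theorem localIso_of_localLat_eq {q : ℕ} [Fact q.Prime] {Q : QuadraticForm ℚ V}
    {A B : Submodule ℤ V} (h : localLat q ⟨Q, A⟩ = localLat q ⟨Q, B⟩) :
    LocalIso q (⟨Q, A⟩ : QuadLattice V) ⟨Q, B⟩ :=
  ⟨QuadraticMap.IsometryEquiv.refl _, fun x => by rw [← h]; rfl⟩

theorem localIso_hypLat (hV : finrank ℚ V = 3) {Q : QuadraticForm ℚ V}
    {M : Submodule ℤ V} {e f e' f' : V} (hM : IsZLattice ⟨Q, M⟩) (h : IsHypPair p Q M e f)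
    (h' : IsHypPair p Q M e' f') (q : ℕ) [Fact q.Prime] :
    LocalIso q (⟨Q, hypLat p M e f⟩ : QuadLattice V) ⟨Q, hypLat p M e' f'⟩ := by
  by_cases hqp : q = p
  · subst hqp
    exact localIso_hypLat_self hV hM h h'
  · exact localIso_of_localLat_eq
      ((localLat_hypLat_of_ne hqp h).trans (localLat_hypLat_of_ne hqp h').symm)

theorem inGenus_hypLat (hV : finrank ℚ V = 3) {Q : QuadraticForm ℚ V}
    {M : Submodule ℤ V} {e f e' f' : V} (hM : IsZLattice ⟨Q, M⟩) (h : IsHypPair p Q M e f)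
    (h' : IsHypPair p Q M e' f') :
    InGenus (⟨Q, hypLat p M e f⟩ : QuadLattice V) ⟨Q, hypLat p M e' f'⟩ :=
  ⟨h'.isZLattice (Fact.out : p.Prime).ne_zero hM, rfl, fun q _ => localIso_hypLat hV hM h h' q⟩

end HyperbolicSublattices

/-! ### The hyperbolic plane split off by L at p -/

section LocalSplitting

variable {V : Type*} [AddCommGroup V] [Module ℚ V]

theorem two_mul_bilin (L : QuadLattice V) (x y : V) : 2 * L.bilin x y = polar L.form x y := by
  have h := congrArg (fun B => B x y) (two_nsmul_associated ℚ L.form)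
  simp only [LinearMap.smul_apply, polarBilin_apply_apply] at h
  rw [← h, nsmul_eq_mul]
  rfl

variable {p : ℕ} [Fact p.Prime]

theorem two_mul_localBilin (L : QuadLattice V) (x y : ℚ_[p] ⊗[ℚ] V) :
    2 * L.localBilin p x y = polar (L.localForm p) x y := by
  have h := congrArg (fun B => B x y) (two_nsmul_associated ℚ_[p] (L.localForm p))
  simp only [LinearMap.smul_apply, polarBilin_apply_apply] at h
  rw [← h, nsmul_eq_mul]
  rfl

theorem polarGram_eq_gramDet (L : QuadLattice V) (β : Basis (Fin 3) ℤ L.lat) :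
    polarGram L.form (fun i => (β i : V)) = 2 * (4 * L.gramDet β) := by
  have h : (Matrix.of fun i j => polar L.form (β i : V) (β j)) =
      (2 : ℚ) • Matrix.of fun i j => L.bilin (β i : V) (β j) := by
    ext i j
    simp [← two_mul_bilin]
  rw [polarGram, h, Matrix.det_smul, gramDet, Fintype.card_fin]
  ring

theorem disc_eq_gramDet (L : QuadLattice V) (β : Basis (Fin 3) ℤ L.lat) :
    L.disc = L.gramDet β := by
  have h : Nonempty (Basis (Fin 3) ℤ L.lat) := ⟨β⟩
  rw [disc, dif_pos h, gramDet_eq L _ β]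

theorem polarGram_localForm (L : QuadLattice V) (v : Fin 3 → V) :
    polarGram (L.localForm p) (fun i => (1 : ℚ_[p]) ⊗ₜ[ℚ] v i) =
      ((polarGram L.form v : ℚ) : ℚ_[p]) := by
  have h := (Rat.castHom ℚ_[p]).map_det (Matrix.of fun i j => polar L.form (v i) (v j))
  rw [polarGram, polarGram]
  refine Eq.trans ?_ h.symm
  congr 1
  ext i j
  simp

/-- The localization splits off a hyperbolic plane, with orthogonal complement of norm
divisible by `p²`. -/
def HasLocalSplit (p : ℕ) [Fact p.Prime] (L : QuadLattice V) : Prop :=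
  ∃ e ∈ L.localLat p, ∃ f ∈ L.localLat p, L.localForm p e = 0 ∧ L.localForm p f = 0 ∧
    polar (L.localForm p) e f = 1 ∧ ∀ x ∈ L.localLat p, polar (L.localForm p) x e = 0 →
      polar (L.localForm p) x f = 0 → ∃ t : ℤ_[p], L.localForm p x = (p : ℚ_[p]) ^ 2 * t

theorem HasLocalSplit.congr {L M : QuadLattice V} (h : L.HasLocalSplit p) (hLM : LocalIso p L M) :
    M.HasLocalSplit p := by
  obtain ⟨e, he, f, hf, hqe, hqf, hef, hx⟩ := h
  obtain ⟨σ, hσ⟩ := hLM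
  have hq : ∀ x, M.localForm p (σ x) = L.localForm p x := fun x => σ.map_app x
  have hp : ∀ x y, polar (M.localForm p) (σ x) (σ y) = polar (L.localForm p) x y := fun x y => by
    rw [polar, ← map_add, hq, hq, hq]
    rfl
  refine ⟨σ e, (hσ e).2 he, σ f, (hσ f).2 hf, by rw [hq, hqe], by rw [hq, hqf], by rw [hp, hef],
    fun x hxM h1 h2 => ?_⟩
  obtain ⟨y, rfl⟩ : ∃ y, σ y = x := ⟨σ.symm x, σ.apply_symm_apply x⟩
  rw [hp] at h1 h2
  rw [hq]
  exact hx y ((hσ y).1 hxM) h1 h2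

theorem localForm_coe_smul (L : QuadLattice V) (a : ℤ_[p]) (x : ℚ_[p] ⊗[ℚ] V) :
    L.localForm p (a • x) = a * a * L.localForm p x := by
  rw [← coe_smul_tensor, (L.localForm p).map_smul, smul_eq_mul]

theorem polar_coe_smul_right (L : QuadLattice V) (a : ℤ_[p]) (x y : ℚ_[p] ⊗[ℚ] V) :
    polar (L.localForm p) x (a • y) = a * polar (L.localForm p) x y := by
  rw [← coe_smul_tensor, polar_smul_right, smul_eq_mul]

theorem eq_zero_of_forall_pow_smul (hV : finrank ℚ V = 3) {L : QuadLattice V} (hL : L.IsZLattice)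
    {x : ℚ_[p] ⊗[ℚ] V} (h : ∀ k : ℕ, ∃ y ∈ L.localLat p, x = ((p : ℤ_[p]) ^ k) • y) : x = 0 := by
  obtain ⟨b⟩ := exists_localLat_basis (p := p) hV hL
  obtain ⟨y0, hy0, hx0⟩ := h 0
  have hx : x ∈ L.localLat p := by
    rw [hx0, pow_zero, one_smul]
    exact hy0
  suffices h1 : (⟨x, hx⟩ : L.localLat p) = 0 from congrArg Subtype.val h1
  apply b.repr.injective
  ext i
  rw [map_zero, Finsupp.zero_apply]
  by_contra hne
  have hnu : ¬ IsUnit (p : ℤ_[p]) := PadicInt.p_nonunit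
  obtain ⟨n, hn⟩ := FiniteMultiplicity.of_not_isUnit hnu hne
  apply hn
  obtain ⟨y, hy, hxy⟩ := h (n + 1)
  have h2 : (⟨x, hx⟩ : L.localLat p) = ((p : ℤ_[p]) ^ (n + 1)) • ⟨y, hy⟩ := Subtype.ext hxy
  rw [h2, map_smul, Finsupp.smul_apply, smul_eq_mul]
  exact dvd_mul_right _ _

theorem exists_padicInt_eq {a : ℚ} {m : ℕ} (h : (m : ℤ) ≤ padicValRat p a) :
    ∃ t : ℤ_[p], (a : ℚ_[p]) = (p : ℚ_[p]) ^ m * t := by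
  have hp0 : (p : ℚ_[p]) ≠ 0 := Nat.cast_ne_zero.2 (Fact.out : p.Prime).ne_zero
  -- The valuation of 0 is 0 by convention, so this case is not covered by the norm computation.
  by_cases ha : a = 0
  · exact ⟨0, by simp [ha]⟩
  refine ⟨⟨(a : ℚ_[p]) / (p : ℚ_[p]) ^ m, ?_⟩, ?_⟩
  · rw [norm_div, Padic.eq_padicNorm, padicNorm.eq_zpow_of_nonzero ha, norm_pow, Padic.norm_p]
    have hp1 : (1 : ℝ) < p := by exact_mod_cast (Fact.out : p.Prime).one_lt
    have hp2 : (0 : ℝ) < p := by linarith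
    push_cast
    rw [inv_pow, div_inv_eq_mul, ← zpow_natCast, ← zpow_add₀ hp2.ne']
    apply zpow_le_one_of_nonpos₀ hp1.le
    linarith
  · change _ = (p : ℚ_[p]) ^ m * ((a : ℚ_[p]) / (p : ℚ_[p]) ^ m)
    field_simp

/-- The polar Gram determinant of `(e, f, x)` is `-2 Q(x)`. It is also `2 · 4dL` times the square of
a p-adic integral determinant, so `4dL` divides `Q(x)` in `ℤ_p`. -/
theorem localForm_orthogonal (hV : finrank ℚ V = 3) {L : QuadLattice V} (hL : L.IsZLattice)
    {m : ℕ} (hord : (m : ℤ) ≤ padicValRat p (4 * L.disc)) {e f x : ℚ_[p] ⊗[ℚ] V}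
    (he : e ∈ L.localLat p) (hf : f ∈ L.localLat p) (hx : x ∈ L.localLat p)
    (hqe : L.localForm p e = 0) (hqf : L.localForm p f = 0) (hef : polar (L.localForm p) e f = 1)
    (hxe : polar (L.localForm p) x e = 0) :
    ∃ t : ℤ_[p], L.localForm p x = (p : ℚ_[p]) ^ m * t := by
  obtain ⟨β⟩ := hL.exists_basis hV
  obtain ⟨c, hc⟩ := exists_rat_basis hL.span_eq_top β
  let B := Algebra.TensorProduct.basis ℚ_[p] c
  have hB : ∀ i, B i = 1 ⊗ₜ (β i : V) := fun i => by
    rw [← hc]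
    exact Algebra.TensorProduct.basis_apply c i
  set v : Fin 3 → ℚ_[p] ⊗[ℚ] V := ![e, f, x] with hv
  have hvm : ∀ i, v i ∈ L.localLat p := by
    intro i
    fin_cases i
    exacts [he, hf, hx]
  have hcoord : ∀ i j, ∃ t : ℤ_[p], B.toMatrix v i j = t := by
    intro i j
    obtain ⟨a, b, d, h⟩ := (mem_localLat_iff β).1 (hvm j)
    rw [← hB, ← hB, ← hB, ← coe_smul_tensor, ← coe_smul_tensor, ← coe_smul_tensor] at h
    rw [Basis.toMatrix_apply, h, repr_combination]
    fin_cases i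
    exacts [⟨a, rfl⟩, ⟨b, rfl⟩, ⟨d, rfl⟩]
  choose A hA using hcoord
  have hdet : (B.toMatrix v).det = ((Matrix.of A).det : ℤ_[p]) := by
    have h := (PadicInt.Coe.ringHom (p := p)).map_det (Matrix.of A)
    refine Eq.trans ?_ h.symm
    congr 1
    ext i j
    rw [hA]
    rfl
  have h1 : polarGram (L.localForm p) v = -2 * L.localForm p x := by
    rw [← two_mul_halfGram, halfGram]
    simp only [hv, Matrix.cons_val_zero, Matrix.cons_val_one, Matrix.cons_val]
    rw [hqe, hqf, hef, polar_comm _ e x, hxe]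
    ring
  have h2 : polarGram (L.localForm p) B = 2 * ((4 * L.disc : ℚ) : ℚ_[p]) := by
    have : (B : Fin 3 → ℚ_[p] ⊗[ℚ] V) = fun i => 1 ⊗ₜ (β i : V) := funext hB
    rw [this, polarGram_localForm, polarGram_eq_gramDet, ← disc_eq_gramDet]
    push_cast
    ring
  obtain ⟨t, ht⟩ := exists_padicInt_eq hord
  have h3 := polarGram_eq (q := L.localForm p) B v
  rw [h1, h2, hdet, ht] at h3
  refine ⟨-(t * (Matrix.of A).det ^ 2), mul_left_cancel₀ (two_ne_zero (α := ℚ_[p])) ?_⟩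
  push_cast
  linear_combination -h3

/-- Divide the isotropic vector by the largest power of `p` dividing all its pairings with `J`.
Modularity keeps the quotient in `J`, and it now pairs to a unit with some vector, which is
corrected to an isotropic partner. The discriminant controls the complement. -/
theorem hasLocalSplit_of_halfModularIsotropic (hV : finrank ℚ V = 3) {L : QuadLattice V}
    (hL : L.IsZLattice) (h : L.HalfModularIsotropic p) (hord : 2 ≤ padicValRat p (4 * L.disc)) :
    L.HasLocalSplit p := by
  obtain ⟨J, J', hsup, -, -, hmod, -, x, hxJ, hx0, hqx⟩ := h
  have hJL : J ≤ L.localLat p := hsup ▸ le_sup_left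
  have hp0 : (p : ℚ_[p]) ≠ 0 := Nat.cast_ne_zero.2 (Fact.out : p.Prime).ne_zero
  have hmod' : ∀ z ∈ Submodule.span ℚ_[p] (J : Set (ℚ_[p] ⊗[ℚ] V)),
      (∀ y ∈ J, ∃ t : ℤ_[p], polar (L.localForm p) z y = t) → z ∈ J := by
    intro z hz hzy
    refine (hmod z hz).2 fun y hy => ?_
    obtain ⟨t, ht⟩ := hzy y hy
    exact ⟨t, by rw [← ht, ← two_mul_localBilin]; ring⟩
  have hint : ∀ y ∈ J, ∃ t : ℤ_[p], polar (L.localForm p) x y = t := by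
    intro y hy
    obtain ⟨t, ht⟩ := (hmod x (Submodule.subset_span hxJ)).1 hxJ y hy
    exact ⟨t, by rw [← two_mul_localBilin, ht]; ring⟩
  have hdivmem : ∀ k : ℕ, (∀ y ∈ J, ∃ t : ℤ_[p], polar (L.localForm p) x y = (p : ℚ_[p]) ^ k * t) →
      ((p : ℚ_[p]) ^ k)⁻¹ • x ∈ J := by
    intro k hk
    refine hmod' _ (Submodule.smul_mem _ _ (Submodule.subset_span hxJ)) fun y hy => ?_
    obtain ⟨t, ht⟩ := hk y hy
    refine ⟨t, ?_⟩
    rw [polar_smul_left, ht, smul_eq_mul]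
    field_simp
  -- Otherwise `x` would be divisible in `L_p` by every power of `p`, hence zero.
  have hex : ∃ k : ℕ, ¬ ∀ y ∈ J, ∃ t : ℤ_[p], polar (L.localForm p) x y = (p : ℚ_[p]) ^ k * t := by
    by_contra! hall
    refine hx0 (eq_zero_of_forall_pow_smul hV hL fun k =>
      ⟨_, hJL (hdivmem k (hall k)), ?_⟩)
    rw [← coe_smul_tensor, PadicInt.coe_pow, PadicInt.coe_natCast, smul_smul,
      mul_inv_cancel₀ (pow_ne_zero k hp0), one_smul]
  classical
  obtain ⟨k, hk, hmin⟩ : ∃ k : ℕ, (∀ y ∈ J, ∃ t : ℤ_[p], polar (L.localForm p) x y =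
      (p : ℚ_[p]) ^ k * t) ∧ ¬ ∀ y ∈ J, ∃ t : ℤ_[p], polar (L.localForm p) x y =
      (p : ℚ_[p]) ^ (k + 1) * t := by
    have h1 := Nat.find_spec hex
    have h2 : Nat.find hex ≠ 0 := by
      intro h0
      rw [h0] at h1
      exact h1 fun y hy => by simpa using hint y hy
    obtain ⟨k, hk⟩ := Nat.exists_eq_succ_of_ne_zero h2
    refine ⟨k, ?_, by rw [← Nat.succ_eq_add_one, ← hk]; exact h1⟩
    have h3 := Nat.find_min hex (m := k) (by omega)
    exact not_not.1 h3
  set e := ((p : ℚ_[p]) ^ k)⁻¹ • x with he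
  have heJ : e ∈ J := hdivmem k hk
  have hqe : L.localForm p e = 0 := by rw [he, (L.localForm p).map_smul, hqx, smul_zero]
  push Not at hmin
  obtain ⟨y, hy, hyk⟩ := hmin
  obtain ⟨u, hu⟩ := hk y hy
  have hey : polar (L.localForm p) e y = u := by
    rw [he, polar_smul_left, hu, smul_eq_mul]
    field_simp
  have huu : IsUnit u := by
    by_contra hnu
    have h1 : u ∈ IsLocalRing.maximalIdeal ℤ_[p] := (IsLocalRing.mem_maximalIdeal _).2 hnu
    rw [PadicInt.maximalIdeal_eq_span_p] at h1
    obtain ⟨w, hw⟩ := Ideal.mem_span_singleton.1 h1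
    refine hyk w ?_
    rw [hu, hw]
    push_cast
    ring
  obtain ⟨w, hw⟩ := huu.exists_left_inv
  obtain ⟨y', hy'⟩ : ∃ y', y' = w • y := ⟨_, rfl⟩
  have hy'J : y' ∈ J := hy' ▸ J.smul_mem w hy
  have hey' : polar (L.localForm p) e y' = 1 := by
    rw [hy', polar_coe_smul_right, hey, ← PadicInt.coe_mul, hw, PadicInt.coe_one]
  obtain ⟨t, ht⟩ := hL.localForm_int hV (hJL hy'J)
  have ht' : L.localForm p y' = (t : ℚ_[p]) := ht
  obtain ⟨f, hf⟩ : ∃ f, f = y' - t • e := ⟨_, rfl⟩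
  have hfJ : f ∈ J := hf ▸ sub_mem hy'J (J.smul_mem t heJ)
  have hef : polar (L.localForm p) e f = 1 := by
    rw [hf, polar_sub_right, polar_coe_smul_right, polar_self_eq, hqe, hey']
    ring
  have hqf : L.localForm p f = 0 := by
    rw [hf, form_sub, localForm_coe_smul, hqe, polar_coe_smul_right, polar_comm _ y' e, hey', ht']
    ring
  refine ⟨e, hJL heJ, f, hJL hfJ, hqe, hqf, hef, fun z hz hze _ => ?_⟩
  exact localForm_orthogonal hV hL (m := 2) (by exact_mod_cast hord) (hJL heJ) (hJL hfJ) hz hqe hqf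
    hef hze

end LocalSplitting

/-! ### Passing between L and p⁻¹Λ_p(L) -/

section GlobalSplitting

variable {V : Type*} [AddCommGroup V] [Module ℚ V]

/-- A hyperbolic pair modulo `p²` in `L`, whose orthogonal complement modulo `p²` takes values
divisible by `p²`. -/
structure IsSplitPair (p : ℕ) (L : QuadLattice V) (e f : V) : Prop where
  mem_left : e ∈ L.lat
  mem_right : f ∈ L.lat
  form_left : ∃ k : ℤ, L.form e = p ^ 2 * k
  form_right : ∃ k : ℤ, L.form f = p ^ 2 * k
  polar_eq : ∃ k : ℤ, polar L.form e f = 1 + p ^ 2 * k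
  form_orthogonal : ∀ x ∈ L.lat, (∃ k : ℤ, polar L.form x e = p ^ 2 * k) →
    (∃ k : ℤ, polar L.form x f = p ^ 2 * k) → ∃ k : ℤ, L.form x = p ^ 2 * k

theorem IsZLattice.exists_int_polar {L : QuadLattice V} (hL : L.IsZLattice) {x y : V}
    (hx : x ∈ L.lat) (hy : y ∈ L.lat) : ∃ k : ℤ, polar L.form x y = k := by
  obtain ⟨k, hk⟩ := polar_of_form_multiple (m := 1) (fun x hx => by
    obtain ⟨k, hk⟩ := hL.exists_int hx
    exact ⟨k, by rw [hk]; simp⟩) hx hy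
  exact ⟨k, by rw [hk]; simp⟩

/-- Approximate the local pair by global vectors modulo `p²`; all the conditions are congruences
modulo `p²`, which descend from `ℤ_p` to `ℤ`. -/
theorem exists_isSplitPair {p : ℕ} [Fact p.Prime] (hV : finrank ℚ V = 3) {L : QuadLattice V}
    (hL : L.IsZLattice) (h : L.HasLocalSplit p) : ∃ e f, L.IsSplitPair p e f := by
  obtain ⟨e, he, f, hf, hqe, hqf, hef, hx⟩ := h
  set q := localInt p hV L hL with hq
  set E : L.localLat p := ⟨e, he⟩ with hE
  set F : L.localLat p := ⟨f, hf⟩ with hF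
  have hqE : q E = 0 := Subtype.ext (by rw [hq, coe_localInt]; exact hqe)
  have hqF : q F = 0 := Subtype.ext (by rw [hq, coe_localInt]; exact hqf)
  have hEF : polar q E F = 1 := Subtype.ext (by rw [hq, coe_polar_localInt]; exact hef)
  have hX : ∀ X, polar q X E = 0 → polar q X F = 0 → (p : ℤ_[p]) ^ 2 ∣ q X := by
    intro X h1 h2
    obtain ⟨t, ht⟩ := hx X X.2 (by rw [← coe_polar_localInt hV hL X E, ← hq, h1]; rfl)
      (by rw [← coe_polar_localInt hV hL X F, ← hq, h2]; rfl)
    refine ⟨t, Subtype.ext ?_⟩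
    rw [hq, coe_localInt, ht]
    push_cast
    rfl
  obtain ⟨e', he', y, hy, hey⟩ := exists_approx 2 he
  obtain ⟨f', hf', z, hz, hfz⟩ := exists_approx 2 hf
  let ι : ∀ x ∈ L.lat, L.localLat p := fun x hx => ⟨1 ⊗ₜ x, one_tmul_mem p hx⟩
  have hι : ∀ x (hx : x ∈ L.lat) (k : ℤ), L.form x = k → q (ι x hx) = k := fun x hx k hk =>
    Subtype.ext (by
      rw [hq, coe_localInt, localForm_one_tmul, hk]
      simp)
  have hιp : ∀ x (hx : x ∈ L.lat) y (hy : y ∈ L.lat) (k : ℤ), polar L.form x y = k →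
      polar q (ι x hx) (ι y hy) = k := fun x hx y hy k hk =>
    Subtype.ext (by
      rw [hq, coe_polar_localInt, polar_localForm_one_tmul, hk]
      simp)
  set Y : L.localLat p := ⟨y, hy⟩
  set Z : L.localLat p := ⟨z, hz⟩
  have hEY : E = ι e' he' + ((p : ℤ_[p]) ^ 2) • Y := Subtype.ext hey
  have hFZ : F = ι f' hf' + ((p : ℤ_[p]) ^ 2) • Z := Subtype.ext hfz
  have hE' : ι e' he' = E - ((p : ℤ_[p]) ^ 2) • Y := by rw [hEY]; simp
  have hF' : ι f' hf' = F - ((p : ℤ_[p]) ^ 2) • Z := by rw [hFZ]; simp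
  have descend : ∀ {a : ℚ} {k : ℤ}, a = k → (p : ℤ_[p]) ^ 2 ∣ (k : ℤ_[p]) →
      ∃ l : ℤ, a = p ^ 2 * l := by
    intro a k ha hk
    obtain ⟨l, hl⟩ := (PadicInt.pow_p_dvd_int_iff 2 k).1 hk
    exact ⟨l, by rw [ha, hl]; push_cast; ring⟩
  refine ⟨e', f', he', hf', ?_, ?_, ?_, ?_⟩
  · obtain ⟨k, hk⟩ := hL.exists_int he'
    refine descend hk ?_
    rw [← hι e' he' k hk, hE', form_sub, hqE, q.map_smul, polar_smul_right]
    exact ⟨p ^ 2 * q Y - polar q E Y, by simp only [smul_eq_mul]; ring⟩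
  · obtain ⟨k, hk⟩ := hL.exists_int hf'
    refine descend hk ?_
    rw [← hι f' hf' k hk, hF', form_sub, hqF, q.map_smul, polar_smul_right]
    exact ⟨p ^ 2 * q Z - polar q F Z, by simp only [smul_eq_mul]; ring⟩
  · obtain ⟨k, hk⟩ := hL.exists_int_polar he' hf'
    have h1 : (p : ℤ_[p]) ^ 2 ∣ ((k - 1 : ℤ) : ℤ_[p]) := by
      rw [Int.cast_sub, ← hιp e' he' f' hf' k hk, hE', hF']
      simp only [polar_sub_left, polar_sub_right, polar_smul_left, polar_smul_right, hEF]
      refine ⟨p ^ 2 * polar q Y Z - polar q E Z - polar q Y F, ?_⟩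
      simp only [smul_eq_mul]
      push_cast
      ring
    obtain ⟨l, hl⟩ := descend (a := ((k - 1 : ℤ) : ℚ)) rfl h1
    exact ⟨l, by rw [hk, ← hl]; push_cast; ring⟩
  · rintro x hx ⟨k1, h1⟩ ⟨k2, h2⟩
    obtain ⟨k, hk⟩ := hL.exists_int hx
    refine descend hk ?_
    rw [← hι x hx k hk]
    set X := ι x hx
    obtain ⟨a, ha⟩ : (p : ℤ_[p]) ^ 2 ∣ polar q X E := by
      rw [hEY, polar_add_right, polar_smul_right,
        hιp x hx e' he' (p ^ 2 * k1) (by rw [h1]; push_cast; ring)]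
      exact ⟨k1 + polar q X Y, by push_cast; rw [smul_eq_mul]; ring⟩
    obtain ⟨c, hc⟩ : (p : ℤ_[p]) ^ 2 ∣ polar q X F := by
      rw [hFZ, polar_add_right, polar_smul_right,
        hιp x hx f' hf' (p ^ 2 * k2) (by rw [h2]; push_cast; ring)]
      exact ⟨k2 + polar q X Z, by push_cast; rw [smul_eq_mul]; ring⟩
    -- Removing the projection to the exact plane changes the value by the product of the two
    -- pairings, both of which are divisible by `p²`.
    have hqX := hX (X - (polar q X F • E + polar q X E • F))
      (by
        simp only [polar_sub_left, polar_add_left, polar_smul_left, polar_self_eq, hqE,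
          polar_comm q F E, hEF, smul_eq_mul]
        ring)
      (by
        simp only [polar_sub_left, polar_add_left, polar_smul_left, polar_self_eq, hqF, hEF,
          smul_eq_mul]
        ring)
    rw [form_sub, form_smul_add_smul, hqE, hqF, hEF, polar_add_right, polar_smul_right,
      polar_smul_right, ha] at hqX
    simp only [smul_eq_mul] at hqX
    obtain ⟨d, hd⟩ := hqX
    exact ⟨d + a * polar q X F, by linear_combination hd⟩

/-- The lattice `p⁻¹Λ_p(L)`. -/
def overLat (p : ℕ) (L : QuadLattice V) : Submodule ℤ V :=
  (watson p L).lat.comap ((p : ℤ) • LinearMap.id)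

theorem mem_watson_iff {p : ℕ} {L : QuadLattice V} {x : V} :
    x ∈ (watson p L).lat ↔ x ∈ L.lat ∧ (∃ k : ℤ, L.form x = p * k) ∧
      ∀ z ∈ L.lat, ∃ k : ℤ, polar L.form x z = p * k := by
  rw [mem_watson]
  constructor
  · rintro ⟨hx, h⟩
    obtain ⟨k, hk⟩ := h 0 (zero_mem _)
    rw [add_zero, QuadraticMap.map_zero, sub_zero] at hk
    refine ⟨hx, ⟨k, hk⟩, fun z hz => ?_⟩
    obtain ⟨l, hl⟩ := h z hz
    refine ⟨l - k, ?_⟩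
    rw [polar]
    push_cast
    linear_combination hl - hk
  · rintro ⟨hx, ⟨k, hk⟩, h⟩
    refine ⟨hx, fun z hz => ?_⟩
    obtain ⟨l, hl⟩ := h z hz
    refine ⟨l + k, ?_⟩
    rw [polar] at hl
    push_cast
    linear_combination hl + hk

theorem mem_overLat {p : ℕ} {L : QuadLattice V} {x : V} :
    x ∈ overLat p L ↔ (p : ℤ) • x ∈ (watson p L).lat := Iff.rfl

theorem form_zsmul (Q : QuadraticForm ℚ V) (n : ℤ) (x : V) : Q (n • x) = n ^ 2 * Q x := by
  rw [← Int.cast_smul_eq_zsmul ℚ, Q.map_smul, smul_eq_mul]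
  ring

theorem polar_zsmul_left (Q : QuadraticForm ℚ V) (n : ℤ) (x y : V) :
    polar Q (n • x) y = n * polar Q x y := by
  rw [← Int.cast_smul_eq_zsmul ℚ, polar_smul_left, smul_eq_mul]

theorem polar_zsmul_right (Q : QuadraticForm ℚ V) (n : ℤ) (x y : V) :
    polar Q x (n • y) = n * polar Q x y := by
  rw [polar_comm, polar_zsmul_left, polar_comm]

theorem smul_mem_watson {p : ℕ} {L : QuadLattice V} (hL : L.IsZLattice) {x : V}
    (hx : x ∈ L.lat) : (p : ℤ) • x ∈ (watson p L).lat := by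
  refine mem_watson_iff.2 ⟨L.lat.smul_mem _ hx, ?_, fun z hz => ?_⟩
  · obtain ⟨k, hk⟩ := hL.exists_int hx
    exact ⟨p * k, by rw [form_zsmul, hk]; push_cast; ring⟩
  · obtain ⟨k, hk⟩ := hL.exists_int_polar hx hz
    exact ⟨k, by rw [polar_zsmul_left, hk]; push_cast; ring⟩

theorem le_overLat {p : ℕ} {L : QuadLattice V} (hL : L.IsZLattice) : L.lat ≤ overLat p L :=
  fun _ hx => smul_mem_watson hL hx

theorem exists_mem_overLat {p : ℕ} (hp : p ≠ 0) {L : QuadLattice V} {x : V}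
    (hx : x ∈ (watson p L).lat) : ∃ y ∈ overLat p L, x = (p : ℤ) • y := by
  have h : (p : ℤ) • ((p : ℚ)⁻¹ • x) = x := by
    rw [← Int.cast_smul_eq_zsmul ℚ, smul_smul, Int.cast_natCast,
      mul_inv_cancel₀ (Nat.cast_ne_zero.2 hp), one_smul]
  exact ⟨(p : ℚ)⁻¹ • x, by rw [mem_overLat, h]; exact hx, h.symm⟩

/-- Modulo `p²` the projection to the plane is `polar(x, f) e + polar(x, e) f`, as for a genuine
hyperbolic pair. -/
theorem IsSplitPair.decompose {p : ℕ} {L : QuadLattice V} {e f : V} (hL : L.IsZLattice)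
    (h : L.IsSplitPair p e f) {x : V} (hx : x ∈ L.lat) :
    ∃ a c : ℤ, polar L.form x f = a ∧ polar L.form x e = c ∧ ∃ x' ∈ L.lat,
      x = a • e + c • f + x' ∧ (∃ k : ℤ, polar L.form x' e = p ^ 2 * k) ∧
      ∃ k : ℤ, polar L.form x' f = p ^ 2 * k := by
  obtain ⟨a, ha⟩ := hL.exists_int_polar hx h.mem_right
  obtain ⟨c, hc⟩ := hL.exists_int_polar hx h.mem_left
  obtain ⟨k1, h1⟩ := h.form_left
  obtain ⟨k2, h2⟩ := h.form_right
  obtain ⟨k3, h3⟩ := h.polar_eq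
  refine ⟨a, c, ha, hc, x - (a • e + c • f), sub_mem hx (add_mem (L.lat.smul_mem _ h.mem_left)
    (L.lat.smul_mem _ h.mem_right)), by abel, ⟨-2 * a * k1 - c * k3, ?_⟩,
    ⟨-2 * c * k2 - a * k3, ?_⟩⟩
  · simp only [polar_sub_left, polar_add_left, polar_zsmul_left, polar_self_eq, polar_comm _ f e,
      hc, h1, h3]
    push_cast
    ring
  · simp only [polar_sub_left, polar_add_left, polar_zsmul_left, polar_self_eq,
      ha, h2, h3]
    push_cast
    ring

theorem IsSplitPair.polar_orthogonal {p : ℕ} {L : QuadLattice V} {e f : V}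
    (h : L.IsSplitPair p e f) {x y : V} (hx : x ∈ L.lat) (hy : y ∈ L.lat)
    (hxe : ∃ k : ℤ, polar L.form x e = p ^ 2 * k) (hxf : ∃ k : ℤ, polar L.form x f = p ^ 2 * k)
    (hye : ∃ k : ℤ, polar L.form y e = p ^ 2 * k) (hyf : ∃ k : ℤ, polar L.form y f = p ^ 2 * k) :
    ∃ k : ℤ, polar L.form x y = p ^ 2 * k := by
  obtain ⟨k1, h1⟩ := h.form_orthogonal x hx hxe hxf
  obtain ⟨k2, h2⟩ := h.form_orthogonal y hy hye hyf
  obtain ⟨l1, m1⟩ := hxe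
  obtain ⟨l2, m2⟩ := hxf
  obtain ⟨l3, m3⟩ := hye
  obtain ⟨l4, m4⟩ := hyf
  obtain ⟨k3, h3⟩ := h.form_orthogonal (x + y) (add_mem hx hy)
    ⟨l1 + l3, by rw [polar_add_left, m1, m3]; push_cast; ring⟩
    ⟨l2 + l4, by rw [polar_add_left, m2, m4]; push_cast; ring⟩
  exact ⟨k3 - k1 - k2, by rw [polar, h3, h1, h2]; push_cast; ring⟩

theorem IsSplitPair.mem_watson_of_orthogonal {p : ℕ} {L : QuadLattice V} {e f : V}
    (hL : L.IsZLattice) (h : L.IsSplitPair p e f) {x : V} (hx : x ∈ L.lat)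
    (hxe : ∃ k : ℤ, polar L.form x e = p ^ 2 * k)
    (hxf : ∃ k : ℤ, polar L.form x f = p ^ 2 * k) : x ∈ (watson p L).lat := by
  refine mem_watson_iff.2 ⟨hx, ?_, fun z hz => ?_⟩
  · obtain ⟨k, hk⟩ := h.form_orthogonal x hx hxe hxf
    exact ⟨p * k, by rw [hk]; push_cast; ring⟩
  · obtain ⟨a, c, -, -, z', hz', hzz, hze, hzf⟩ := h.decompose hL hz
    obtain ⟨k1, h1⟩ := h.polar_orthogonal hx hz' hxe hxf hze hzf
    obtain ⟨k2, h2⟩ := hxe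
    obtain ⟨k3, h3⟩ := hxf
    refine ⟨p * (a * k2 + c * k3 + k1), ?_⟩
    rw [hzz, polar_add_right, polar_add_right, polar_zsmul_right, polar_zsmul_right, h1, h2, h3]
    push_cast
    ring

variable {p : ℕ} {L : QuadLattice V} {e f : V}

/-- The content is `p² ∣ Q(x)` for `x ∈ Λ_p(L)`: in the decomposition of `x` the plane coefficients
are divisible by `p`, and the orthogonal part has value divisible by `p²`. -/
theorem IsSplitPair.form_overLat (hp : p ≠ 0) (hL : L.IsZLattice) (h : L.IsSplitPair p e f)
    {y : V} (hy : y ∈ overLat p L) : ∃ k : ℤ, L.form y = k := by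
  obtain ⟨hx, -, hxp⟩ := mem_watson_iff.1 (mem_overLat.1 hy)
  obtain ⟨a, c, ha, hc, x', hx', hxx, ⟨k1, h1⟩, ⟨k2, h2⟩⟩ := h.decompose hL hx
  obtain ⟨k3, h3⟩ := h.form_orthogonal x' hx' ⟨k1, h1⟩ ⟨k2, h2⟩
  -- The plane coefficients are pairings of a vector of `Λ_p(L)` with `f` and `e`, hence divisible
  -- by `p`.
  obtain ⟨a', ha'⟩ := hxp f h.mem_right
  obtain ⟨c', hc'⟩ := hxp e h.mem_left
  rw [ha] at ha'
  rw [hc] at hc'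
  obtain ⟨l1, m1⟩ := hL.exists_int h.mem_left
  obtain ⟨l2, m2⟩ := hL.exists_int h.mem_right
  obtain ⟨l3, m3⟩ := hL.exists_int_polar h.mem_left h.mem_right
  have hp0 : (p : ℚ) ^ 2 ≠ 0 := pow_ne_zero 2 (Nat.cast_ne_zero.2 hp)
  refine ⟨a' ^ 2 * l1 + c' ^ 2 * l2 + a' * c' * l3 + p * (a' * k1 + c' * k2) + k3,
    mul_left_cancel₀ hp0 ?_⟩
  have h4 : (p : ℚ) ^ 2 * L.form y = L.form ((p : ℤ) • y) := by rw [form_zsmul, Int.cast_natCast]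
  rw [h4, hxx, QuadraticMap.map_add (⇑L.form), QuadraticMap.map_add (⇑L.form), form_zsmul,
    form_zsmul, polar_zsmul_left, polar_zsmul_right, polar_add_left, polar_zsmul_left,
    polar_zsmul_left, polar_comm _ e x', polar_comm _ f x', h1, h2, h3, m1, m2, m3, ha', hc']
  push_cast
  ring

theorem IsSplitPair.isZLattice_overLat (hp : p ≠ 0) (hL : L.IsZLattice)
    (h : L.IsSplitPair p e f) : IsZLattice ⟨L.form, overLat p L⟩ where
  posDef := hL.posDef
  fg := by
    have hinj : Function.Injective ((p : ℤ) • (LinearMap.id : V →ₗ[ℤ] V)) := by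
      have : IsTorsionFree ℤ V := IsTorsionFree.trans_faithfulSMul ℤ ℚ V
      intro x y hxy
      exact smul_right_injective V (Int.natCast_ne_zero.2 hp) hxy
    refine Submodule.fg_of_fg_map_injective _ hinj (hL.fg.of_le ?_)
    rintro _ ⟨x, hx, rfl⟩
    exact (mem_watson_iff.1 (mem_overLat.1 hx)).1
  span_eq_top := by
    rw [eq_top_iff, ← hL.span_eq_top]
    exact Submodule.span_mono (le_overLat hL)
  norm_le := norm_le_one_iff.2 fun _ hx => h.form_overLat hp hL hx

theorem IsSplitPair.isHypPair (hL : L.IsZLattice) (h : L.IsSplitPair p e f) :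
    IsHypPair p L.form (overLat p L) e f := by
  obtain ⟨k1, h1⟩ := h.form_left
  obtain ⟨k2, h2⟩ := h.form_right
  obtain ⟨k3, h3⟩ := h.polar_eq
  exact ⟨le_overLat hL h.mem_left, le_overLat hL h.mem_right,
    ⟨p * k1, by rw [h1]; push_cast; ring⟩, ⟨p * k2, by rw [h2]; push_cast; ring⟩,
    ⟨p * k3, by rw [h3]; push_cast; ring⟩⟩

/-- The orthogonal part of any vector of `L` lies in `Λ_p(L) = pM`, so `L` is generated by the pair
and `pM`. -/
theorem IsSplitPair.lat_eq (hp : p ≠ 0) (hL : L.IsZLattice) (h : L.IsSplitPair p e f) :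
    L.lat = hypLat p (overLat p L) e f := by
  ext x
  rw [mem_hypLat]
  constructor
  · intro hx
    obtain ⟨a, c, -, -, x', hx', hxx, h1, h2⟩ := h.decompose hL hx
    obtain ⟨y, hy, rfl⟩ := exists_mem_overLat hp (h.mem_watson_of_orthogonal hL hx' h1 h2)
    exact ⟨a, c, y, hy, hxx⟩
  · rintro ⟨m, n, y, hy, rfl⟩
    exact add_mem (add_mem (L.lat.smul_mem _ h.mem_left) (L.lat.smul_mem _ h.mem_right))
      (mem_watson_iff.1 (mem_overLat.1 hy)).1

/-- The sublattice remembers `M`: being orthogonal modulo `p` to the pair forces the plane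
coefficients into `pℤ`, so `Λ_p` of the sublattice is `pM`. -/
theorem IsHypPair.overLat_hypLat (hp : p ≠ 0) {Q : QuadraticForm ℚ V} {M : Submodule ℤ V}
    (hM : IsZLattice ⟨Q, M⟩) (h : IsHypPair p Q M e f) :
    overLat p ⟨Q, hypLat p M e f⟩ = M := by
  have hpQ : (p : ℚ) ≠ 0 := Nat.cast_ne_zero.2 hp
  ext y
  rw [mem_overLat, mem_watson_iff]
  constructor
  · rintro ⟨hy, -, hyp⟩
    obtain ⟨m, n, w, hw, hpy⟩ := mem_hypLat.1 hy
    obtain ⟨k1, h1⟩ := h.form_left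
    obtain ⟨k2, h2⟩ := h.form_right
    obtain ⟨k3, h3⟩ := h.polar_eq
    -- Pairing `p y = m e + n f + p w` with `f` and `e` reads off `m` and `n` modulo `p`.
    obtain ⟨l1, m1⟩ := hyp f right_mem_hypLat
    obtain ⟨l2, m2⟩ := hyp e left_mem_hypLat
    obtain ⟨l3, m3⟩ := hM.exists_int_polar hw h.mem_left
    obtain ⟨l4, m4⟩ := hM.exists_int_polar hw h.mem_right
    simp only [] at m1 m2 m3 m4
    rw [hpy, polar_add_left, polar_add_left, polar_zsmul_left, polar_zsmul_left, polar_zsmul_left,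
      polar_self_eq] at m1 m2
    rw [h3, h2, m4] at m1
    rw [h1, polar_comm _ f e, h3, m3] at m2
    obtain ⟨m', hm'⟩ : ∃ m', m = p * m' := ⟨l1 - m * k3 - 2 * n * k2 - l4, by
      have : (m : ℚ) = p * (l1 - m * k3 - 2 * n * k2 - l4) := by
        push_cast at m1
        linear_combination m1
      exact_mod_cast this⟩
    obtain ⟨n', hn'⟩ : ∃ n', n = p * n' := ⟨l2 - n * k3 - 2 * m * k1 - l3, by
      have : (n : ℚ) = p * (l2 - n * k3 - 2 * m * k1 - l3) := by
        push_cast at m2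
        linear_combination m2
      exact_mod_cast this⟩
    have : IsTorsionFree ℤ V := IsTorsionFree.trans_faithfulSMul ℤ ℚ V
    have hy' : y = m' • e + n' • f + w := by
      apply smul_right_injective V (Int.natCast_ne_zero.2 hp)
      change (p : ℤ) • y = (p : ℤ) • _
      rw [hpy, hm', hn', smul_add, smul_add, smul_smul, smul_smul]
    rw [hy']
    exact add_mem (add_mem (M.smul_mem _ h.mem_left) (M.smul_mem _ h.mem_right)) hw
  · intro hy
    refine ⟨smul_mem_hypLat hy, ?_, fun z hz => ?_⟩
    · obtain ⟨k, hk⟩ := hM.exists_int hy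
      have hk' : Q y = k := hk
      exact ⟨p * k, by change Q _ = _; rw [form_zsmul, hk']; push_cast; ring⟩
    · obtain ⟨k, hk⟩ := hM.exists_int_polar hy (h.hypLat_le hz)
      have hk' : polar Q y z = k := hk
      exact ⟨k, by change polar Q _ _ = _; rw [polar_zsmul_left, hk']; push_cast; ring⟩

end GlobalSplitting

/-! ### Finiteness of representation numbers and automorphism groups -/

section Finiteness

variable {V : Type*} [AddCommGroup V] [Module ℚ V]

/-- Each coordinate is the pairing with a dual vector `d i`, so Cauchy–Schwarz bounds its square by
`Q(d i) t`; the coordinates are integers. -/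
theorem finite_vectors {L : QuadLattice V} (hV : finrank ℚ V = 3) (hL : L.IsZLattice) (t : ℚ) :
    {x | x ∈ L.lat ∧ L.form x = t}.Finite := by
  obtain ⟨β⟩ := hL.exists_basis hV
  obtain ⟨b, hb⟩ := exists_rat_basis hL.span_eq_top β
  have : FiniteDimensional ℚ V := FiniteDimensional.of_finrank_pos (by omega)
  let B : LinearMap.BilinForm ℚ V := associated' L.form
  have hBs : LinearMap.IsSymm B := QuadraticForm.associated_isSymm ℤ L.form
  have hBq : ∀ x, B x x = L.form x := fun x => associated_eq_self_apply ℤ L.form x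
  have hB : B.Nondegenerate := hBs.isRefl.nondegenerate_iff_separatingLeft.2
    (separatingLeft_of_anisotropic L.form hL.posDef.anisotropic)
  let d : Fin 3 → V := fun i => (B.toDual hB).symm (b.coord i)
  have hd : ∀ i x, B (d i) x = b.repr x i := fun i x => by
    rw [← LinearMap.BilinForm.toDual_def hB, LinearEquiv.apply_symm_apply, Basis.coord_apply]
  have hbound : ∀ i x, (b.repr x i) ^ 2 ≤ L.form (d i) * L.form x := fun i x => by
    rw [← hd, ← hBq, ← hBq]
    exact LinearMap.BilinForm.apply_sq_le_of_symm B
      (fun y => by rw [hBq]; exact hL.posDef.nonneg y) hBs (d i) x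
  have hint : ∀ x ∈ L.lat, ∀ i, ∃ n : ℤ, b.repr x i = n := by
    intro x hx i
    refine ⟨β.repr ⟨x, hx⟩ i, ?_⟩
    have h1 := congrArg (fun y : L.lat => b.repr (y : V)) (β.sum_repr ⟨x, hx⟩)
    simp only [Submodule.coe_sum, Submodule.coe_smul, ← hb, map_sum] at h1
    rw [← h1, Finsupp.finsetSum_apply]
    simp_rw [← Int.cast_smul_eq_zsmul ℚ, map_smul]
    simp [Finsupp.single_apply]
  have hfin : ∀ i, {r : ℚ | (∃ n : ℤ, r = n) ∧ r ^ 2 ≤ L.form (d i) * t}.Finite := by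
    intro i
    set C := L.form (d i) * t
    refine ((Set.finite_Icc (-⌈C⌉) ⌈C⌉).image (fun n : ℤ => (n : ℚ))).subset ?_
    rintro r ⟨⟨n, rfl⟩, hr⟩
    refine ⟨n, ?_, rfl⟩
    have h1 : n ^ 2 ≤ ⌈C⌉ := by
      have : ((n ^ 2 : ℤ) : ℚ) ≤ (⌈C⌉ : ℚ) := by
        push_cast
        exact hr.trans (Int.le_ceil C)
      exact_mod_cast this
    constructor <;> nlinarith [sq_nonneg n, sq_nonneg (n - 1), sq_nonneg (n + 1),
      Int.le_self_sq n, Int.le_self_sq (-n)]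
  refine Set.Finite.of_injOn (f := fun x => (fun i => b.repr x i : Fin 3 → ℚ)) ?_ ?_
    (Set.Finite.pi hfin)
  · rintro x ⟨hx, hxt⟩ i -
    exact ⟨hint x hx i, by rw [← hxt]; exact hbound i x⟩
  · intro x _ y _ hxy
    exact b.repr.injective (DFunLike.coe_injective hxy)

theorem finite_isom {L : QuadLattice V} (hV : finrank ℚ V = 3) (hL : L.IsZLattice) :
    Finite (Isom L L) := by
  obtain ⟨β⟩ := hL.exists_basis hV
  obtain ⟨b, hb⟩ := exists_rat_basis hL.span_eq_top β
  have hfin : (Set.univ.pi fun i : Fin 3 => {x | x ∈ L.lat ∧ L.form x = L.form (β i)}).Finite :=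
    Set.Finite.pi fun i => finite_vectors hV hL _
  have := hfin.to_subtype
  refine Finite.of_injective (β := Set.univ.pi fun i : Fin 3 =>
    {x | x ∈ L.lat ∧ L.form x = L.form (β i)})
    (fun σ => ⟨fun i => σ.1 (β i), fun i _ => ⟨(σ.2 _).2 (β i).2, σ.1.map_app _⟩⟩) ?_
  intro σ τ h
  have h1 : ∀ i, σ.1 (β i) = τ.1 (β i) := fun i => congrFun (congrArg Subtype.val h) i
  apply Subtype.ext
  apply DFunLike.ext
  intro x
  have h2 : σ.1.toLinearEquiv.toLinearMap = τ.1.toLinearEquiv.toLinearMap :=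
    b.ext fun i => by
      rw [hb]
      exact h1 i
  exact LinearMap.congr_fun h2 x

/-- `Nat.card` of an infinite type is 0, so finiteness of `O(L)` is what permits dividing by `o(L)`.
-/
theorem autCard_ne_zero {L : QuadLattice V} (hV : finrank ℚ V = 3) (hL : L.IsZLattice) :
    L.autCard ≠ 0 := by
  have := finite_isom hV hL
  have : Nonempty (Isom L L) := ⟨Isom.refl L⟩
  exact Nat.card_pos.ne'

end Finiteness

/-! ### Isometry invariance, the lattice λ_p(L), and primitivity in the genus -/

section Functoriality

variable {V : Type*} [AddCommGroup V] [Module ℚ V]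

theorem Isom.map_form {L M : QuadLattice V} (σ : Isom L M) (x : V) :
    M.form (σ.1 x) = L.form x := σ.1.map_app x

theorem Isom.map_polar {L M : QuadLattice V} (σ : Isom L M) (x y : V) :
    polar M.form (σ.1 x) (σ.1 y) = polar L.form x y := by
  rw [polar, ← map_add, σ.map_form, σ.map_form, σ.map_form]
  rfl

theorem Isom.surjective {L M : QuadLattice V} (σ : Isom L M) (y : V) : ∃ x, σ.1 x = y :=
  ⟨σ.1.symm y, σ.1.apply_symm_apply y⟩

theorem Isom.map_zsmul {L M : QuadLattice V} (σ : Isom L M) (n : ℤ) (x : V) :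
    σ.1 (n • x) = n • σ.1 x := _root_.map_zsmul σ.1.toLinearEquiv n x

/-- An isometry of lattices restricts to their Watson transforms. -/
def Isom.watson {L M : QuadLattice V} (p : ℕ) (σ : Isom L M) :
    Isom (QuadLattice.watson p L) (QuadLattice.watson p M) :=
  ⟨σ.1, fun x => by
    change σ.1 x ∈ (QuadLattice.watson p M).lat ↔ _
    rw [mem_watson_iff, mem_watson_iff, σ.2, σ.map_form]
    refine and_congr_right fun _ => and_congr_right fun _ => ⟨fun h z hz => ?_, fun h z hz => ?_⟩
    · rw [← σ.map_polar]
      exact h _ ((σ.2 z).2 hz)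
    · obtain ⟨w, rfl⟩ := σ.surjective z
      rw [σ.map_polar]
      exact h _ ((σ.2 w).1 hz)⟩

theorem Isom.mem_overLat_iff {L M : QuadLattice V} (p : ℕ) (σ : Isom L M) (x : V) :
    σ.1 x ∈ overLat p M ↔ x ∈ overLat p L := by
  rw [mem_overLat, mem_overLat, ← σ.map_zsmul]
  exact (σ.watson p).2 _

theorem Isom.isHypPair {p : ℕ} {Q Q' : QuadraticForm ℚ V} {M M' : Submodule ℤ V}
    (σ : Isom (⟨Q, M⟩ : QuadLattice V) ⟨Q', M'⟩) {e f : V} (h : IsHypPair p Q M e f) :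
    IsHypPair p Q' M' (σ.1 e) (σ.1 f) := by
  obtain ⟨h1, h2, h3, h4, h5⟩ := h
  refine ⟨(σ.2 _).2 h1, (σ.2 _).2 h2, ?_, ?_, ?_⟩
  · rw [← σ.map_form] at h3
    exact h3
  · rw [← σ.map_form] at h4
    exact h4
  · obtain ⟨k, hk⟩ := h5
    exact ⟨k, (σ.map_polar _ _).trans hk⟩

theorem Isom.mem_hypLat_iff {p : ℕ} {Q Q' : QuadraticForm ℚ V} {M M' : Submodule ℤ V}
    (σ : Isom (⟨Q, M⟩ : QuadLattice V) ⟨Q', M'⟩) (e f x : V) :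
    σ.1 x ∈ hypLat p M' (σ.1 e) (σ.1 f) ↔ x ∈ hypLat p M e f := by
  rw [mem_hypLat, mem_hypLat]
  constructor
  · rintro ⟨m, n, y, hy, h⟩
    obtain ⟨w, rfl⟩ := σ.surjective y
    refine ⟨m, n, w, (σ.2 w).1 hy, σ.1.toLinearEquiv.injective ?_⟩
    refine h.trans ?_
    rw [← σ.map_zsmul, ← σ.map_zsmul, ← σ.map_zsmul, ← map_add, ← map_add]
    rfl
  · rintro ⟨m, n, y, hy, rfl⟩
    exact ⟨m, n, _, (σ.2 y).2 hy, by rw [map_add, map_add, σ.map_zsmul, σ.map_zsmul, σ.map_zsmul]⟩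

/-- An isometry of lattices restricts to the sublattices `Λ₁`. -/
theorem IsIso.lambdaOne {K M : QuadLattice V} (h : IsIso K M) :
    IsIso K.LambdaOne M.LambdaOne := by
  obtain ⟨σ⟩ := h
  have hb : ∀ x y, M.bilin (σ.1 x) (σ.1 y) = K.bilin x y := fun x y => by
    have h2 : (2 : ℚ) ≠ 0 := two_ne_zero
    apply mul_left_cancel₀ h2
    rw [two_mul_bilin, two_mul_bilin, σ.map_polar]
  refine ⟨⟨σ.1, fun x => ?_⟩⟩
  change (σ.1 x ∈ M.lat ∧ ∀ y ∈ M.lat, ∃ m : ℤ, M.bilin (σ.1 x) y = m) ↔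
    (x ∈ K.lat ∧ ∀ y ∈ K.lat, ∃ m : ℤ, K.bilin x y = m)
  rw [σ.2]
  refine and_congr_right fun _ => ⟨fun h z hz => ?_, fun h z hz => ?_⟩
  · rw [← hb]
    exact h _ ((σ.2 z).2 hz)
  · obtain ⟨w, rfl⟩ := σ.surjective z
    rw [hb]
    exact h _ ((σ.2 w).1 hz)

theorem disc_congr {K M : QuadLattice V} (h : IsIso K M) (β : Basis (Fin 3) ℤ K.lat) :
    K.disc = M.disc := by
  obtain ⟨σ⟩ := h
  let φ : K.lat ≃ₗ[ℤ] M.lat :=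
    { toFun := fun x => ⟨σ.1 x, (σ.2 x).2 x.2⟩
      invFun := fun x => ⟨σ.1.symm x, (σ.symm.2 x).2 x.2⟩
      map_add' := fun x y => Subtype.ext (map_add σ.1 (x : V) y)
      map_smul' := fun n x => Subtype.ext (σ.map_zsmul n x)
      left_inv := fun x => Subtype.ext (σ.1.symm_apply_apply _)
      right_inv := fun x => Subtype.ext (σ.1.apply_symm_apply _) }
  have h8 : (2 : ℚ) * 4 ≠ 0 := by norm_num
  have h1 := polarGram_eq_gramDet K β
  have h2 := polarGram_eq_gramDet M (β.map φ)
  rw [disc_eq_gramDet K β, disc_eq_gramDet M (β.map φ)]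
  apply mul_left_cancel₀ h8
  rw [mul_assoc, mul_assoc, ← h1, ← h2, polarGram, polarGram]
  congr 1
  ext i j
  exact (σ.map_polar (β i) (β j)).symm

theorem isPrimitive_of_le {L M : QuadLattice V} (hM : M.norm ≤ 1) (hLM : L.lat ≤ M.lat)
    (hform : M.form = L.form) (hL : L.IsPrimitive) : M.IsPrimitive := by
  refine le_antisymm hM ?_
  rw [← hL, norm, norm, hform]
  exact Submodule.span_mono (Set.image_mono hLM)

theorem norm_scale_watson {p : ℕ} (hp : p ≠ 0) (L : QuadLattice V) (c : ℚ) :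
    (scale c (watson p L)).norm =
      Submodule.map (LinearMap.mulLeft ℤ (c * (p : ℚ) ^ 2))
        (norm (⟨L.form, overLat p L⟩ : QuadLattice V)) := by
  rw [norm, norm, Submodule.map_span, ← Set.image_comp]
  congr 1
  ext t
  constructor
  · rintro ⟨x, hx, rfl⟩
    obtain ⟨y, hy, rfl⟩ := exists_mem_overLat hp hx
    refine ⟨y, hy, ?_⟩
    change c * (p : ℚ) ^ 2 * L.form y = c * L.form _
    rw [form_zsmul]
    push_cast
    ring
  · rintro ⟨y, hy, rfl⟩
    refine ⟨(p : ℤ) • y, hy, ?_⟩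
    change c * L.form _ = c * (p : ℚ) ^ 2 * L.form y
    rw [form_zsmul]
    push_cast
    ring

/-- This identifies the chosen scaling factor: the norm of `Λ_p(L)` is `p²ℤ`, so `c p²` is a
positive unit of `ℤ`, that is, 1. -/
theorem lambda_eq_scale {p : ℕ} (hp : p ≠ 0) {L : QuadLattice V}
    (h : IsPrimitive (⟨L.form, overLat p L⟩ : QuadLattice V)) :
    lambda p L = scale ((p : ℚ) ^ 2)⁻¹ (watson p L) := by
  have hp0 : (0 : ℚ) < (p : ℚ) ^ 2 := by positivity
  have hnorm : ∀ c, (scale c (watson p L)).IsPrimitive ↔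
      Submodule.map (LinearMap.mulLeft ℤ (c * (p : ℚ) ^ 2)) 1 = 1 := fun c => by
    rw [IsPrimitive, norm_scale_watson hp, h]
  have hex : ∃ c : ℚ, 0 < c ∧ (scale c (watson p L)).IsPrimitive := by
    refine ⟨((p : ℚ) ^ 2)⁻¹, by positivity, (hnorm _).2 ?_⟩
    rw [inv_mul_cancel₀ hp0.ne', LinearMap.mulLeft_one, Submodule.map_id]
  rw [lambda, dif_pos hex]
  obtain ⟨hc, hc2⟩ := hex.choose_spec
  set c := hex.choose
  rw [hnorm] at hc2
  congr 1
  have h1 : (1 : ℚ) ∈ (1 : Submodule ℤ ℚ) := Submodule.mem_one.2 ⟨1, by simp⟩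
  have h2 : c * (p : ℚ) ^ 2 ∈ (1 : Submodule ℤ ℚ) := by
    rw [← hc2]
    exact ⟨1, h1, by simp⟩
  rw [← hc2] at h1
  obtain ⟨d, hd, hd1⟩ := h1
  obtain ⟨m, hm⟩ := Submodule.mem_one.1 hd
  obtain ⟨n, hn⟩ := Submodule.mem_one.1 h2
  have hm' : (m : ℚ) = d := hm
  have hn' : (n : ℚ) = c * (p : ℚ) ^ 2 := hn
  have hd1' : c * (p : ℚ) ^ 2 * d = 1 := hd1
  rw [← hm', ← hn'] at hd1'
  have hnm : n * m = 1 := by exact_mod_cast hd1'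
  have hn0 : 0 < n := by
    have : (0 : ℚ) < n := by
      rw [hn']
      positivity
    exact_mod_cast this
  have hn1 : n = 1 := by
    rcases Int.isUnit_iff.1 (IsUnit.of_mul_eq_one m hnm) with h | h <;> omega
  rw [hn1] at hn'
  exact eq_inv_of_mul_eq_one_left (by rw [← hn']; simp)

theorem lambda_isIso {p : ℕ} (hp : p ≠ 0) {L : QuadLattice V}
    (h : IsPrimitive (⟨L.form, overLat p L⟩ : QuadLattice V)) :
    IsIso (lambda p L) ⟨L.form, overLat p L⟩ := by
  rw [lambda_eq_scale hp h]
  have hp0 : (p : ℚ) ≠ 0 := Nat.cast_ne_zero.2 hp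
  -- Scaling the form by `p⁻²` has the same effect as multiplying vectors by `p⁻¹`.
  refine ⟨⟨⟨LinearEquiv.smulOfNeZero ℚ V (p : ℚ)⁻¹ (inv_ne_zero hp0), fun x => ?_⟩, fun x => ?_⟩⟩
  · change L.form ((p : ℚ)⁻¹ • x) = ((p : ℚ) ^ 2)⁻¹ • L.form x
    rw [L.form.map_smul, smul_eq_mul, smul_eq_mul]
    field_simp
  · change (p : ℤ) • ((p : ℚ)⁻¹ • x) ∈ (watson p L).lat ↔ x ∈ (watson p L).lat
    rw [← Int.cast_smul_eq_zsmul ℚ, smul_smul, Int.cast_natCast, mul_inv_cancel₀ hp0, one_smul]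

/-- Primitivity is local: a prime dividing all values on `M` divides all values on `M_q ≃ L_q`,
hence on `L`. -/
theorem InGenus.isPrimitive (hV : finrank ℚ V = 3) {L M : QuadLattice V}
    (h : InGenus L M) (hL : L.IsZLattice) (hLp : L.IsPrimitive) : M.IsPrimitive := by
  by_contra hne
  let I : Ideal ℤ := Submodule.comap (Algebra.linearMap ℤ ℚ) M.norm
  have hI : ∀ k : ℤ, k ∈ I ↔ (k : ℚ) ∈ M.norm := fun k => Iff.rfl
  have h1 : (1 : ℤ) ∉ I := by
    intro h1
    rw [hI] at h1
    refine hne (le_antisymm h.isZLattice.norm_le ?_)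
    rw [Submodule.one_eq_span, Submodule.span_singleton_le_iff_mem]
    exact_mod_cast h1
  -- A prime divisor `q` of the generator divides every value of the form on `M`; it also exists
  -- when the generator is 0.
  set g := Submodule.IsPrincipal.generator I with hg
  have hdvd : ∀ k : ℤ, k ∈ I ↔ g ∣ k := fun k => Submodule.IsPrincipal.mem_iff_generator_dvd I
  have hg1 : g.natAbs ≠ 1 := by
    intro hg1
    apply h1
    rw [hdvd]
    exact (Int.isUnit_iff_natAbs_eq.2 hg1).dvd
  obtain ⟨q, hq, hqg⟩ := Nat.exists_prime_and_dvd hg1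
  have : Fact q.Prime := ⟨hq⟩
  have hM : ∀ x ∈ M.lat, ∃ k : ℤ, M.form x = (q : ℤ) * k := by
    intro x hx
    obtain ⟨k, hk⟩ := h.isZLattice.exists_int hx
    have h2 : k ∈ I := by
      rw [hI, ← hk]
      exact Submodule.subset_span ⟨x, hx, rfl⟩
    obtain ⟨l, hl⟩ := (Int.natCast_dvd.2 hqg).trans ((hdvd k).1 h2)
    exact ⟨l, by rw [hk, hl]; push_cast; ring⟩
  obtain ⟨β⟩ := h.isZLattice.exists_basis hV
  obtain ⟨σ, hσ⟩ := h.localIso q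
  have hLq : L.norm ≤ Submodule.span ℤ {(q : ℚ)} := by
    rw [norm, Submodule.span_le]
    rintro _ ⟨x, hx, rfl⟩
    obtain ⟨k, hk⟩ := hL.exists_int hx
    obtain ⟨t, ht⟩ := localForm_multiple β hM ((hσ _).2 (one_tmul_mem q hx))
    have h2 : M.localForm q (σ (1 ⊗ₜ x)) = L.localForm q (1 ⊗ₜ x) := σ.map_app _
    rw [h2, localForm_one_tmul, hk] at ht
    have h3 : (q : ℤ_[q]) ^ 1 ∣ (k : ℤ_[q]) := by
      refine ⟨t, Subtype.ext ?_⟩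
      push_cast at ht ⊢
      rw [ht, pow_one]
    obtain ⟨l, hl⟩ := (PadicInt.pow_p_dvd_int_iff 1 k).1 h3
    refine Submodule.mem_span_singleton.2 ⟨l, ?_⟩
    change l • (q : ℚ) = L.form x
    rw [hk, hl]
    push_cast
    rw [zsmul_eq_mul]
    ring
  rw [hLp, Submodule.one_eq_span, Submodule.span_singleton_le_iff_mem,
    Submodule.mem_span_singleton] at hLq
  obtain ⟨a, ha⟩ := hLq
  rw [zsmul_eq_mul] at ha
  have ha' : a * (q : ℤ) = 1 := by exact_mod_cast ha
  have := Int.isUnit_iff.1 (IsUnit.of_mul_eq_one_right a ha')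
  have := hq.two_le
  omega

end Functoriality

/-! ### The quadratic space M/pM in coordinates -/

section Reduction

variable {p : ℕ} [Fact p.Prime] {N : Type*} [AddCommGroup N]

/-- Coordinates modulo `p`. -/
def reduction (p : ℕ) (β : Basis (Fin 3) ℤ N) : N →+ (Fin 3 → ZMod p) where
  toFun x i := (β.repr x i : ZMod p)
  map_zero' := by
    ext
    simp
  map_add' x y := by
    ext
    simp

theorem reduction_apply (β : Basis (Fin 3) ℤ N) (x : N) (i : Fin 3) :
    reduction p β x i = (β.repr x i : ZMod p) := rfl

theorem reduction_surjective (β : Basis (Fin 3) ℤ N) : Function.Surjective (reduction p β) := by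
  intro u
  refine ⟨β.equivFun.symm fun i => (u i).val, ?_⟩
  ext i
  rw [reduction_apply, ← β.equivFun_apply, LinearEquiv.apply_symm_apply]
  simp

theorem reduction_zsmul (β : Basis (Fin 3) ℤ N) (n : ℤ) (x : N) :
    reduction p β (n • x) = (n : ZMod p) • reduction p β x := by
  ext i
  simp [reduction_apply]

theorem reduction_eq_zero_iff (β : Basis (Fin 3) ℤ N) {x : N} :
    reduction p β x = 0 ↔ ∃ y, x = (p : ℤ) • y := by
  constructor
  · intro h
    have h1 : ∀ i, ∃ k : ℤ, β.repr x i = p * k := fun i =>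
      (ZMod.intCast_zmod_eq_zero_iff_dvd _ p).1 (congrFun h i)
    choose k hk using h1
    refine ⟨β.equivFun.symm k, β.repr.injective ?_⟩
    ext i
    rw [map_smul, Finsupp.smul_apply, hk, ← β.equivFun_apply, LinearEquiv.apply_symm_apply]
    rfl
  · rintro ⟨y, rfl⟩
    rw [reduction_zsmul]
    simp

theorem form_eq_of_reduction_eq (β : Basis (Fin 3) ℤ N) (qN : QuadraticForm ℤ N) {x y : N}
    (h : reduction p β x = reduction p β y) : (qN x : ZMod p) = qN y := by
  obtain ⟨z, hz⟩ := (reduction_eq_zero_iff (p := p) β).1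
    (show reduction p β (x - y) = 0 by rw [map_sub, h, sub_self])
  rw [sub_eq_iff_eq_add] at hz
  rw [hz, QuadraticMap.map_add (⇑qN), qN.map_smul, polar_smul_left]
  simp

/-- The reduction modulo `p` of an integral quadratic form. -/
def reducedForm (p : ℕ) [Fact p.Prime] (β : Basis (Fin 3) ℤ N) (qN : QuadraticForm ℤ N) :
    QuadraticForm (ZMod p) (Fin 3 → ZMod p) :=
  have hs := reduction_surjective (p := p) β
  have hq : ∀ x, ((qN (Function.surjInv hs (reduction p β x)) : ℤ) : ZMod p) = qN x := fun x =>
    form_eq_of_reduction_eq β qN (Function.surjInv_eq hs _)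
  have hp : ∀ x y, polar (fun u => ((qN (Function.surjInv hs u) : ℤ) : ZMod p))
      (reduction p β x) (reduction p β y) = (polar qN x y : ℤ) := fun x y => by
    rw [polar, ← map_add, hq, hq, hq, polar]
    push_cast
    rfl
  QuadraticMap.ofPolar (fun u => ((qN (Function.surjInv hs u) : ℤ) : ZMod p))
    (fun a u => by
      obtain ⟨x, rfl⟩ := hs u
      obtain ⟨n, rfl⟩ := ZMod.intCast_surjective a
      rw [← reduction_zsmul, hq, hq, qN.map_smul, smul_eq_mul, smul_eq_mul]
      push_cast
      rfl)
    (fun u v w => by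
      obtain ⟨x, rfl⟩ := hs u
      obtain ⟨y, rfl⟩ := hs v
      obtain ⟨z, rfl⟩ := hs w
      rw [← map_add, hp, hp, hp, polar_add_left]
      push_cast
      rfl)
    (fun a u v => by
      obtain ⟨x, rfl⟩ := hs u
      obtain ⟨y, rfl⟩ := hs v
      obtain ⟨n, rfl⟩ := ZMod.intCast_surjective a
      rw [← reduction_zsmul, hp, hp, polar_smul_left, smul_eq_mul, smul_eq_mul]
      push_cast
      rfl)

theorem reducedForm_apply (β : Basis (Fin 3) ℤ N) (qN : QuadraticForm ℤ N) (x : N) :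
    reducedForm p β qN (reduction p β x) = (qN x : ZMod p) :=
  form_eq_of_reduction_eq β qN (Function.surjInv_eq (reduction_surjective (p := p) β) _)

theorem polar_reducedForm (β : Basis (Fin 3) ℤ N) (qN : QuadraticForm ℤ N) (x y : N) :
    polar (reducedForm p β qN) (reduction p β x) (reduction p β y) = (polar qN x y : ℤ) := by
  rw [polar, ← map_add, reducedForm_apply, reducedForm_apply, reducedForm_apply, polar]
  push_cast
  rfl

/-- Half the Gram determinant is used because the full one is even and would carry no information
modulo 2. -/
theorem halfGram_reducedForm (β : Basis (Fin 3) ℤ N) (qN : QuadraticForm ℤ N) (v : Fin 3 → N) :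
    halfGram (reducedForm p β qN) (fun i => reduction p β (v i)) = (halfGram qN v : ℤ) := by
  simp only [halfGram, reducedForm_apply, polar_reducedForm]
  push_cast
  rfl

theorem det_toMatrix_reduction (β : Basis (Fin 3) ℤ N) (v : Fin 3 → N) :
    (((β.toMatrix v).det : ℤ) : ZMod p) =
      (Matrix.of fun i j => reduction p β (v j) i).det := by
  have h := (Int.castRingHom (ZMod p)).map_det (β.toMatrix v)
  refine Eq.trans h ?_
  congr 1

theorem det_reduction_ne_zero (β : Basis (Fin 3) ℤ N) (v : Fin 3 → N)
    (b : Basis (Fin 3) (ZMod p) (Fin 3 → ZMod p)) (hb : ∀ i, b i = reduction p β (v i)) :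
    (((β.toMatrix v).det : ℤ) : ZMod p) ≠ 0 := by
  rw [det_toMatrix_reduction]
  have h := isUnit_det_toMatrix (Pi.basisFun (ZMod p) (Fin 3)) b
  have h1 : (Pi.basisFun (ZMod p) (Fin 3)).toMatrix b =
      Matrix.of fun i j => reduction p β (v j) i := by
    ext i j
    rw [Basis.toMatrix_apply, Pi.basisFun_repr, hb]
    rfl
  rw [h1] at h
  exact h.ne_zero

/-- Three vectors in a proper subspace are dependent modulo `p`. -/
theorem dvd_det_of_reduction_mem (β : Basis (Fin 3) ℤ N) (v : Fin 3 → N)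
    {W : Submodule (ZMod p) (Fin 3 → ZMod p)} (hW : W ≠ ⊤) (hv : ∀ i, reduction p β (v i) ∈ W) :
    (p : ℤ) ∣ (β.toMatrix v).det := by
  rw [← ZMod.intCast_zmod_eq_zero_iff_dvd, det_toMatrix_reduction]
  by_contra hne
  apply hW
  have h1 : LinearIndependent (ZMod p) (fun i => reduction p β (v i)) := by
    have h2 := Matrix.linearIndependent_rows_iff_isUnit.2
      ((Matrix.isUnit_iff_isUnit_det _).2 (Matrix.isUnit_det_transpose _ (IsUnit.mk0 _ hne)))
    exact h2
  have h3 : Submodule.span (ZMod p) (Set.range fun i => reduction p β (v i)) = ⊤ :=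
    h1.span_eq_top_of_card_eq_finrank (by simp)
  rw [eq_top_iff, ← h3, Submodule.span_le]
  rintro _ ⟨i, rfl⟩
  exact hv i

end Reduction

/-! ### Sublattices as preimages of hyperbolic planes -/

section Planes

variable {V : Type*} [AddCommGroup V] [Module ℚ V] {p : ℕ} [Fact p.Prime]
  {Q : QuadraticForm ℚ V} {M : Submodule ℤ V}

/-- The sublattices `ℤe + ℤf + pM` for the hyperbolic pairs `e, f ∈ M` modulo `p`. -/
def hypSublattices (p : ℕ) (Q : QuadraticForm ℚ V) (M : Submodule ℤ V) : Set (Submodule ℤ V) :=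
  {N | ∃ e f, IsHypPair p Q M e f ∧ N = hypLat p M e f}

/-- The integral form on a lattice. -/
def latForm (hM : IsZLattice (⟨Q, M⟩ : QuadLattice V)) : QuadraticForm ℤ M :=
  intForm Q M fun _ hx => hM.exists_int hx

theorem coe_latForm (hM : IsZLattice (⟨Q, M⟩ : QuadLattice V)) (x : M) :
    ((latForm hM x : ℤ) : ℚ) = Q x := algebraMap_intForm Q M _ x

theorem coe_polar_latForm (hM : IsZLattice (⟨Q, M⟩ : QuadLattice V)) (x y : M) :
    ((polar (latForm hM) x y : ℤ) : ℚ) = polar Q (x : V) y := algebraMap_polar_intForm Q M _ x y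

theorem coe_halfGram_latForm (hM : IsZLattice (⟨Q, M⟩ : QuadLattice V)) (v : Fin 3 → M) :
    ((halfGram (latForm hM) v : ℤ) : ℚ) = halfGram Q (fun i => (v i : V)) := by
  simp only [halfGram, ← coe_latForm hM, ← coe_polar_latForm hM]
  push_cast
  rfl

theorem halfGram_latForm_basis (hM : IsZLattice (⟨Q, M⟩ : QuadLattice V))
    (β : Basis (Fin 3) ℤ M) :
    ((halfGram (latForm hM) β : ℤ) : ℚ) = 4 * disc (⟨Q, M⟩ : QuadLattice V) := by
  have h := polarGram_eq_gramDet (⟨Q, M⟩ : QuadLattice V) β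
  rw [← two_mul_halfGram, ← disc_eq_gramDet] at h
  rw [coe_halfGram_latForm]
  exact mul_left_cancel₀ two_ne_zero h

/-- The preimage in `M` of a subspace of the reduction modulo `p`. -/
def preimageLat (β : Basis (Fin 3) ℤ M) (W : Submodule (ZMod p) (Fin 3 → ZMod p)) :
    Submodule ℤ V where
  carrier := {x | ∃ h : x ∈ M, reduction p β ⟨x, h⟩ ∈ W}
  zero_mem' := ⟨zero_mem _, by
    rw [show (⟨0, zero_mem M⟩ : M) = 0 from rfl, map_zero]
    exact zero_mem W⟩
  add_mem' := by
    rintro x y ⟨hx, hx'⟩ ⟨hy, hy'⟩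
    refine ⟨add_mem hx hy, ?_⟩
    rw [show (⟨x + y, add_mem hx hy⟩ : M) = ⟨x, hx⟩ + ⟨y, hy⟩ from rfl, map_add]
    exact add_mem hx' hy'
  smul_mem' := by
    rintro n x ⟨hx, hx'⟩
    refine ⟨M.smul_mem n hx, ?_⟩
    rw [show (⟨n • x, M.smul_mem n hx⟩ : M) = n • ⟨x, hx⟩ from rfl, reduction_zsmul]
    exact W.smul_mem _ hx'

theorem coe_mem_preimageLat {β : Basis (Fin 3) ℤ M}
    {W : Submodule (ZMod p) (Fin 3 → ZMod p)} (x : M) :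
    (x : V) ∈ preimageLat β W ↔ reduction p β x ∈ W :=
  ⟨fun ⟨_, h⟩ => h, fun h => ⟨x.2, h⟩⟩

theorem preimageLat_injective (β : Basis (Fin 3) ℤ M) :
    Function.Injective (preimageLat (p := p) β) := by
  intro W W' h
  ext u
  obtain ⟨x, rfl⟩ := reduction_surjective β u
  rw [← coe_mem_preimageLat, h, coe_mem_preimageLat]

theorem hypLat_eq_preimageLat (β : Basis (Fin 3) ℤ M) (e f : M) :
    hypLat p M (e : V) f =
      preimageLat β (Submodule.span (ZMod p) {reduction p β e, reduction p β f}) := by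
  ext x
  rw [mem_hypLat]
  constructor
  · rintro ⟨m, n, y, hy, rfl⟩
    have h : m • (e : V) + n • (f : V) + (p : ℤ) • y =
        ((m • e + n • f + (p : ℤ) • ⟨y, hy⟩ : M) : V) := rfl
    rw [h, coe_mem_preimageLat, map_add, map_add, reduction_zsmul, reduction_zsmul,
      (reduction_eq_zero_iff β).2 ⟨_, rfl⟩, add_zero]
    exact Submodule.mem_span_pair.2 ⟨_, _, rfl⟩
  · rintro ⟨hx, hW⟩
    obtain ⟨s, t, hst⟩ := Submodule.mem_span_pair.1 hW
    obtain ⟨m, rfl⟩ := ZMod.intCast_surjective s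
    obtain ⟨n, rfl⟩ := ZMod.intCast_surjective t
    obtain ⟨y, hy⟩ := (reduction_eq_zero_iff (p := p) (x := ⟨x, hx⟩ - (m • e + n • f)) β).1 (by
      rw [map_sub, map_add, reduction_zsmul, reduction_zsmul, hst, sub_self])
    refine ⟨m, n, y, y.2, ?_⟩
    rw [sub_eq_iff_eq_add'] at hy
    exact congrArg Subtype.val hy

theorem IsHypPair.reduction {e f : V} (hM : IsZLattice (⟨Q, M⟩ : QuadLattice V))
    (β : Basis (Fin 3) ℤ M) (h : IsHypPair p Q M e f) :
    reducedForm p β (latForm hM) (reduction p β ⟨e, h.mem_left⟩) = 0 ∧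
    reducedForm p β (latForm hM) (reduction p β ⟨f, h.mem_right⟩) = 0 ∧
    polar (reducedForm p β (latForm hM)) (QuadLattice.reduction p β ⟨e, h.mem_left⟩)
      (QuadLattice.reduction p β ⟨f, h.mem_right⟩) = 1 := by
  obtain ⟨k1, h1⟩ := h.form_left
  obtain ⟨k2, h2⟩ := h.form_right
  obtain ⟨k3, h3⟩ := h.polar_eq
  rw [reducedForm_apply, reducedForm_apply, polar_reducedForm]
  have m1 : latForm hM ⟨e, h.mem_left⟩ = p * k1 := by
    have := coe_latForm hM ⟨e, h.mem_left⟩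
    rw [h1] at this
    exact_mod_cast this
  have m2 : latForm hM ⟨f, h.mem_right⟩ = p * k2 := by
    have := coe_latForm hM ⟨f, h.mem_right⟩
    rw [h2] at this
    exact_mod_cast this
  have m3 : polar (latForm hM) ⟨e, h.mem_left⟩ ⟨f, h.mem_right⟩ = 1 + p * k3 := by
    have := coe_polar_latForm hM ⟨e, h.mem_left⟩ ⟨f, h.mem_right⟩
    rw [h3] at this
    exact_mod_cast this
  rw [m1, m2, m3]
  simp

theorem hypSublattices_eq (hM : IsZLattice (⟨Q, M⟩ : QuadLattice V)) (β : Basis (Fin 3) ℤ M) :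
    hypSublattices p Q M = preimageLat β '' hypPlanes (reducedForm p β (latForm hM)) := by
  ext N
  constructor
  · rintro ⟨e, f, h, rfl⟩
    obtain ⟨h1, h2, h3⟩ := h.reduction hM β
    exact ⟨_, ⟨_, _, h1, h2, h3, rfl⟩,
      (hypLat_eq_preimageLat β ⟨e, h.mem_left⟩ ⟨f, h.mem_right⟩).symm⟩
  · rintro ⟨_, ⟨u, v, hu, hv, huv, rfl⟩, rfl⟩
    obtain ⟨e, rfl⟩ := reduction_surjective β u
    obtain ⟨f, rfl⟩ := reduction_surjective β v
    rw [reducedForm_apply] at hu hv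
    rw [polar_reducedForm] at huv
    refine ⟨e, f, ⟨e.2, f.2, ?_, ?_, ?_⟩, (hypLat_eq_preimageLat β e f).symm⟩
    · obtain ⟨k, hk⟩ := (ZMod.intCast_zmod_eq_zero_iff_dvd _ p).1 hu
      exact ⟨k, by rw [← coe_latForm hM, hk]; push_cast; ring⟩
    · obtain ⟨k, hk⟩ := (ZMod.intCast_zmod_eq_zero_iff_dvd _ p).1 hv
      exact ⟨k, by rw [← coe_latForm hM, hk]; push_cast; ring⟩
    · obtain ⟨k, hk⟩ := (ZMod.intCast_zmod_eq_zero_iff_dvd (polar (latForm hM) e f - 1) p).1 (by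
        rw [Int.cast_sub, huv, Int.cast_one, sub_self])
      exact ⟨k, by rw [← coe_polar_latForm hM, eq_add_of_sub_eq hk]; push_cast; ring⟩

theorem finite_hypSublattices (hV : finrank ℚ V = 3)
    (hM : IsZLattice (⟨Q, M⟩ : QuadLattice V)) : (hypSublattices p Q M).Finite := by
  obtain ⟨β⟩ := hM.exists_basis hV
  rw [hypSublattices_eq hM β]
  exact (Set.toFinite _).image _

/-- Taking preimages is a bijection between the hyperbolic planes of `M/pM` and the sublattices, and
it respects incidence with a vector. -/
theorem ncard_hypSublattices_through (hM : IsZLattice (⟨Q, M⟩ : QuadLattice V))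
    (β : Basis (Fin 3) ℤ M) (x : M) :
    {N | N ∈ hypSublattices p Q M ∧ (x : V) ∈ N}.ncard =
      planeCount (reducedForm p β (latForm hM)) (reduction p β x) := by
  have h : {N | N ∈ hypSublattices p Q M ∧ (x : V) ∈ N} = preimageLat β ''
      {W | W ∈ hypPlanes (reducedForm p β (latForm hM)) ∧ reduction p β x ∈ W} := by
    rw [hypSublattices_eq hM β]
    ext N
    constructor
    · rintro ⟨⟨W, hW, rfl⟩, hx⟩
      exact ⟨W, ⟨hW, (coe_mem_preimageLat x).1 hx⟩, rfl⟩
    · rintro ⟨W, ⟨hW, hx⟩, rfl⟩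
      exact ⟨⟨W, hW, rfl⟩, (coe_mem_preimageLat x).2 hx⟩
  rw [h, Set.ncard_image_of_injective _ (preimageLat_injective β), planeCount]

end Planes

/-! ### Classes as orbits of O(M), and double counting -/

section Classes

variable {V : Type*} [AddCommGroup V] [Module ℚ V] {p : ℕ} [Fact p.Prime]
  {Q : QuadraticForm ℚ V} {M : Submodule ℤ V}

/-- The image of a lattice under an isometry. -/
def imageLat (σ : Q.IsometryEquiv Q) (N : Submodule ℤ V) : Submodule ℤ V :=
  N.comap (σ.symm.toLinearEquiv.toLinearMap.restrictScalars ℤ)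

theorem mem_imageLat {σ : Q.IsometryEquiv Q} {N : Submodule ℤ V} (x : V) :
    σ x ∈ imageLat σ N ↔ x ∈ N := by
  change σ.symm (σ x) ∈ N ↔ _
  rw [QuadraticMap.IsometryEquiv.symm_apply_apply]

theorem imageLat_eq {σ : Q.IsometryEquiv Q} {N N' : Submodule ℤ V}
    (h : ∀ x, σ x ∈ N' ↔ x ∈ N) : imageLat σ N = N' := by
  ext x
  obtain ⟨y, rfl⟩ : ∃ y, σ y = x := ⟨σ.symm x, σ.apply_symm_apply x⟩
  rw [mem_imageLat, h]

theorem overLat_of_mem_hypSublattices (hM : IsZLattice (⟨Q, M⟩ : QuadLattice V))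
    {N : Submodule ℤ V} (hN : N ∈ hypSublattices p Q M) : overLat p ⟨Q, N⟩ = M := by
  obtain ⟨e, f, h, rfl⟩ := hN
  exact h.overLat_hypLat (Fact.out : p.Prime).ne_zero hM

theorem isZLattice_of_mem_hypSublattices (hM : IsZLattice (⟨Q, M⟩ : QuadLattice V))
    {N : Submodule ℤ V} (hN : N ∈ hypSublattices p Q M) :
    IsZLattice (⟨Q, N⟩ : QuadLattice V) := by
  obtain ⟨e, f, h, rfl⟩ := hN
  exact h.isZLattice (Fact.out : p.Prime).ne_zero hM

theorem imageLat_mem_hypSublattices {N : Submodule ℤ V} (hN : N ∈ hypSublattices p Q M)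
    {M' : Submodule ℤ V} (σ : Isom (⟨Q, M⟩ : QuadLattice V) ⟨Q, M'⟩) :
    imageLat σ.1 N ∈ hypSublattices p Q M' := by
  obtain ⟨e, f, h, rfl⟩ := hN
  exact ⟨_, _, σ.isHypPair h, imageLat_eq fun x => σ.mem_hypLat_iff e f x⟩

/-- The class of a lattice on a fixed quadratic space. -/
def latClass (Q : QuadraticForm ℚ V) (N : Submodule ℤ V) : IsoClass V :=
  Quotient.mk _ ⟨Q, N⟩

/-- Orbit counting: the number of lattices in a class, times the number of automorphisms of a
member of the class. -/
theorem ncard_class_mul_autCard (hM : IsZLattice (⟨Q, M⟩ : QuadLattice V)) {N₀ : Submodule ℤ V}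
    (hN₀ : N₀ ∈ hypSublattices p Q M) :
    {N | N ∈ hypSublattices p Q M ∧ latClass Q N = latClass Q N₀}.ncard *
      autCard (⟨Q, N₀⟩ : QuadLattice V) = autCard (⟨Q, M⟩ : QuadLattice V) := by
  set T := {N | N ∈ hypSublattices p Q M ∧ latClass Q N = latClass Q N₀} with hT
  have hτ : ∀ N : T, Nonempty (Isom (⟨Q, N₀⟩ : QuadLattice V) ⟨Q, N.1⟩) := fun N =>
    Quotient.exact N.2.2.symm
  let τ : ∀ N : T, Isom (⟨Q, N₀⟩ : QuadLattice V) ⟨Q, N.1⟩ := fun N => (hτ N).some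
  have hover : ∀ N : T, overLat p ⟨Q, N.1⟩ = M := fun N =>
    overLat_of_mem_hypSublattices hM N.2.1
  have hover₀ := overLat_of_mem_hypSublattices hM hN₀
  -- `τ N ∘ α` carries `p⁻¹Λ_p(N₀)` to `p⁻¹Λ_p(N)`, and both are `M`, so it lies in `O(M)`. From it,
  -- `N` is recovered as the image of `N₀`, and then `α` by cancelling `τ N`.
  let Φ : T × Isom (⟨Q, N₀⟩ : QuadLattice V) ⟨Q, N₀⟩ → Isom (⟨Q, M⟩ : QuadLattice V) ⟨Q, M⟩ :=
    fun t => ⟨(t.2.trans (τ t.1)).1, fun x => by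
      have h := (t.2.trans (τ t.1)).mem_overLat_iff p x
      rwa [hover, hover₀] at h⟩
  have hΦ : ∀ t x, (Φ t).1 x = (τ t.1).1 (t.2.1 x) := fun t x => rfl
  have hbij : Function.Bijective Φ := by
    constructor
    · rintro ⟨N, α⟩ ⟨N', α'⟩ h
      have hx : ∀ x, (τ N).1 (α.1 x) = (τ N').1 (α'.1 x) := fun x =>
        congrArg (fun σ : Isom (⟨Q, M⟩ : QuadLattice V) ⟨Q, M⟩ => σ.1 x) h
      have hNN : N = N' := by
        apply Subtype.ext
        have h1 : imageLat (α.trans (τ N)).1 N₀ = N.1 := imageLat_eq (α.trans (τ N)).2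
        have h2 : imageLat (α'.trans (τ N')).1 N₀ = N'.1 := imageLat_eq (α'.trans (τ N')).2
        have h3 : (α.trans (τ N)).1 = (α'.trans (τ N')).1 := DFunLike.ext _ _ hx
        exact h1.symm.trans ((congrArg (fun ρ => imageLat ρ N₀) h3).trans h2)
      subst hNN
      refine Prod.ext rfl (Subtype.ext (DFunLike.ext _ _ fun x => ?_))
      exact (τ N).1.toLinearEquiv.injective (hx x)
    · intro σ
      have hNS := imageLat_mem_hypSublattices hN₀ σ
      let σ' : Isom (⟨Q, N₀⟩ : QuadLattice V) ⟨Q, imageLat σ.1 N₀⟩ :=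
        ⟨σ.1, fun x => mem_imageLat x⟩
      let N : T := ⟨imageLat σ.1 N₀, hNS, Quotient.sound ⟨σ'.symm⟩⟩
      refine ⟨(N, σ'.trans (τ N).symm), Subtype.ext (DFunLike.ext _ _ fun x => ?_)⟩
      rw [hΦ]
      exact (τ N).1.apply_symm_apply (σ.1 x)
  rw [autCard, autCard, ← Nat.card_coe_set_eq, ← Nat.card_prod]
  exact Nat.card_congr (Equiv.ofBijective Φ hbij)

theorem ncard_rep (t : ℚ) (L : QuadLattice V) : L.rep t = {x | x ∈ L.lat ∧ L.form x = t}.ncard :=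
  rfl

/-- Group the sublattices by class: a class contains `o(M)/o(N₀)` of them, all with the same
representation number. -/
theorem repGen_eq_sum (hV : finrank ℚ V = 3) (hM : IsZLattice (⟨Q, M⟩ : QuadLattice V))
    {K L : QuadLattice V} (hgen : genClasses p K L = latClass Q '' hypSublattices p Q M)
    (n : ℤ) : repGen p n K L =
      (∑ N ∈ (finite_hypSublattices (p := p) hV hM).toFinset,
        (rep (n : ℚ) (⟨Q, N⟩ : QuadLattice V) : ℚ)) / autCard (⟨Q, M⟩ : QuadLattice V) := by
  classical
  set S := (finite_hypSublattices (p := p) hV hM).toFinset with hS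
  have hSm : ∀ N, N ∈ S ↔ N ∈ hypSublattices p Q M := fun N => Set.Finite.mem_toFinset _
  have hgen' : genClasses p K L = ((S.image (latClass Q) : Finset (IsoClass V)) : Set _) := by
    rw [hgen, Finset.coe_image, hS, Set.Finite.coe_toFinset]
  rw [repGen, hgen', finsum_mem_coe_finset, eq_div_iff
    (Nat.cast_ne_zero.2 (autCard_ne_zero hV hM)), Finset.sum_mul,
    ← Finset.sum_fiberwise_of_maps_to (s := S) (t := S.image (latClass Q)) (g := latClass Q)
      (fun N hN => Finset.mem_image_of_mem _ hN)]
  refine Finset.sum_congr rfl fun c hc => ?_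
  obtain ⟨N₀, hN₀, rfl⟩ := Finset.mem_image.1 hc
  have h1 := ncard_class_mul_autCard hM ((hSm N₀).1 hN₀)
  have h2 : {N | N ∈ hypSublattices p Q M ∧ latClass Q N = latClass Q N₀}.ncard =
      (S.filter fun N => latClass Q N = latClass Q N₀).card := by
    rw [← Set.ncard_coe_finset]
    congr 1
    ext N
    simp [hSm]
  have h3 : ∀ N ∈ S.filter fun N => latClass Q N = latClass Q N₀,
      (rep (n : ℚ) (⟨Q, N⟩ : QuadLattice V) : ℚ) = IsoClass.rep (n : ℚ) (latClass Q N₀) := by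
    intro N hN
    rw [← (Finset.mem_filter.1 hN).2]
    rfl
  rw [Finset.sum_congr rfl h3, Finset.sum_const, nsmul_eq_mul, ← h2, ← h1]
  have h4 : IsoClass.autCard (latClass Q N₀) = autCard (⟨Q, N₀⟩ : QuadLattice V) := rfl
  have h5 : (autCard (⟨Q, N₀⟩ : QuadLattice V) : ℚ) ≠ 0 := Nat.cast_ne_zero.2
    (autCard_ne_zero hV (isZLattice_of_mem_hypSublattices hM ((hSm N₀).1 hN₀)))
  rw [h4]
  push_cast
  field_simp

/-- Double counting of the pairs of a sublattice and a vector in it. -/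
theorem sum_rep_eq (hV : finrank ℚ V = 3) (hM : IsZLattice (⟨Q, M⟩ : QuadLattice V)) (t : ℚ) :
    ∑ N ∈ (finite_hypSublattices (p := p) hV hM).toFinset, rep t (⟨Q, N⟩ : QuadLattice V) =
      ∑ x ∈ (finite_vectors hV hM t).toFinset, {N | N ∈ hypSublattices p Q M ∧ x ∈ N}.ncard := by
  classical
  have h := Finset.sum_card_bipartiteAbove_eq_sum_card_bipartiteBelow
    (s := (finite_hypSublattices (p := p) hV hM).toFinset)
    (t := (finite_vectors hV hM t).toFinset) (fun N x => x ∈ N)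
  refine Eq.trans (Finset.sum_congr rfl fun N hN => ?_)
    (h.trans (Finset.sum_congr rfl fun x hx => ?_))
  · rw [Set.Finite.mem_toFinset] at hN
    obtain ⟨e, f, hef, rfl⟩ := hN
    rw [ncard_rep, ← Set.ncard_coe_finset]
    congr 1
    ext x
    simp only [Finset.bipartiteAbove, Finset.coe_filter, Set.Finite.mem_toFinset,
      Set.mem_ofPred_eq]
    exact ⟨fun h => ⟨⟨hef.hypLat_le h.1, h.2⟩, h.1⟩, fun h => ⟨h.2, h.1.2⟩⟩
  · rw [← Set.ncard_coe_finset]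
    congr 1
    ext N
    simp [Finset.bipartiteBelow]

/-- A lattice in the genus with the same `λ_p` sits in its own overlattice, which is isometric to
`K` and so to `M`; transporting along this isometry places it inside `M`. Conversely each sublattice
is in the genus and has overlattice `M`. -/
theorem genClasses_eq (hV : finrank ℚ V = 3) {N : Submodule ℤ V}
    (hN : IsZLattice (⟨Q, N⟩ : QuadLattice V)) (hNp : IsPrimitive (⟨Q, N⟩ : QuadLattice V))
    (hsplit : HasLocalSplit p (⟨Q, N⟩ : QuadLattice V)) {K : QuadLattice V}
    (hK : K = lambda p ⟨Q, N⟩) :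
    genClasses p K ⟨Q, N⟩ = latClass Q '' hypSublattices p Q (overLat p ⟨Q, N⟩) := by
  have hp : p ≠ 0 := (Fact.out : p.Prime).ne_zero
  obtain ⟨e, f, h⟩ := exists_isSplitPair hV hN hsplit
  have hM := h.isZLattice_overLat hp hN
  have hMp : IsPrimitive (⟨Q, overLat p ⟨Q, N⟩⟩ : QuadLattice V) :=
    isPrimitive_of_le hM.norm_le (le_overLat hN) rfl hNp
  have hKM : IsIso K ⟨Q, overLat p ⟨Q, N⟩⟩ := hK ▸ lambda_isIso hp hMp
  have hhyp := h.isHypPair hN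
  have hlat : N = hypLat p (overLat p ⟨Q, N⟩) e f := h.lat_eq hp hN
  set M := overLat p (⟨Q, N⟩ : QuadLattice V) with hMdef
  ext c
  constructor
  · rintro ⟨⟨Q', N'⟩, hgen, hiso, rfl⟩
    obtain rfl : Q' = Q := hgen.form_eq
    have hN' := hgen.isZLattice
    have hN'p := hgen.isPrimitive hV hN hNp
    obtain ⟨e', f', h'⟩ := exists_isSplitPair hV hN' (hsplit.congr (hgen.localIso p))
    have hM' := h'.isZLattice_overLat hp hN'
    have hM'p : IsPrimitive (⟨Q', overLat p ⟨Q', N'⟩⟩ : QuadLattice V) :=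
      isPrimitive_of_le hM'.norm_le (le_overLat hN') rfl hN'p
    have hhyp' := h'.isHypPair hN'
    have hlat' : N' = hypLat p (overLat p ⟨Q', N'⟩) e' f' := h'.lat_eq hp hN'
    obtain ⟨ρ⟩ := lambda_isIso hp hM'p
    obtain ⟨σ₁⟩ := hiso
    obtain ⟨σ₂⟩ := hKM
    let σ := (ρ.symm.trans σ₁).trans σ₂
    have hmem : N' ∈ hypSublattices p Q' (overLat p ⟨Q', N'⟩) := ⟨e', f', hhyp', hlat'⟩
    refine ⟨imageLat σ.1 N', imageLat_mem_hypSublattices hmem σ, Quotient.sound ?_⟩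
    exact (isoSetoid V).symm ⟨⟨σ.1, fun x => mem_imageLat x⟩⟩
  · rintro ⟨N', hN', rfl⟩
    have hover := overLat_of_mem_hypSublattices hM hN'
    refine ⟨⟨Q, N'⟩, ?_, ?_, rfl⟩
    · obtain ⟨e', f', hhyp', rfl⟩ := hN'
      have hg := inGenus_hypLat hV hM hhyp hhyp'
      rwa [← hlat] at hg
    · have h1 : IsIso (lambda p ⟨Q, N'⟩) ⟨Q, overLat p ⟨Q, N'⟩⟩ := lambda_isIso hp (by
        change IsPrimitive (⟨Q, overLat p ⟨Q, N'⟩⟩ : QuadLattice V)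
        rw [hover]
        exact hMp)
      rw [hover] at h1
      exact (isoSetoid V).trans h1 ((isoSetoid V).symm hKM)

end Classes

/-! ### Reading off degeneracy, radical and pM from the lattice -/

section Evaluation

variable {V : Type*} [AddCommGroup V] [Module ℚ V] {p : ℕ} [Fact p.Prime]
  {Q : QuadraticForm ℚ V} {M : Submodule ℤ V}

theorem padicValRat_intCast_eq_two {D : ℤ} (h : padicValRat p (D : ℚ) = 2) :
    ¬ (p : ℤ) ^ 3 ∣ D := by
  intro hd
  rw [padicValRat.of_int] at h
  -- `D = 0` is excluded because its valuation is 0 by convention, not 2.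
  rcases (padicValInt_dvd_iff 3 D).1 hd with h1 | h1
  · rw [h1] at h
    simp at h
  · omega

theorem pow_dvd_of_le_padicValRat {D : ℤ} {m : ℕ} (h : (m : ℤ) ≤ padicValRat p (D : ℚ)) :
    (p : ℤ) ^ m ∣ D := by
  rw [padicValRat.of_int] at h
  exact (padicValInt_dvd_iff m D).2 (Or.inr (by exact_mod_cast h))

theorem exists_reduced_frame (hM : IsZLattice (⟨Q, M⟩ : QuadLattice V)) (β : Basis (Fin 3) ℤ M)
    {e f : V} (h : IsHypPair p Q M e f) :
    ∃ b : Basis (Fin 3) (ZMod p) (Fin 3 → ZMod p), IsFrame (reducedForm p β (latForm hM)) b ∧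
      b 0 = reduction p β ⟨e, h.mem_left⟩ ∧ b 1 = reduction p β ⟨f, h.mem_right⟩ := by
  obtain ⟨h1, h2, h3⟩ := h.reduction hM β
  exact exists_frame (by simp) h1 h2 h3

/-- The orthogonal part of a frame is determined by the discriminant up to squares. -/
theorem neg_form_two_eq (hM : IsZLattice (⟨Q, M⟩ : QuadLattice V)) (β : Basis (Fin 3) ℤ M)
    {b : Basis (Fin 3) (ZMod p) (Fin 3 → ZMod p)}
    (hb : IsFrame (reducedForm p β (latForm hM)) b) :
    ∃ d : ZMod p, d ≠ 0 ∧ -reducedForm p β (latForm hM) (b 2) =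
      (halfGram (latForm hM) β : ℤ) * d ^ 2 := by
  choose v hv using fun i => reduction_surjective β (b i)
  refine ⟨_, det_reduction_ne_zero β v b fun i => (hv i).symm, ?_⟩
  have h1 := halfGram_eq (q := latForm hM) β v
  rw [← hb.halfGram_eq]
  have h2 : (b : Fin 3 → Fin 3 → ZMod p) = fun i => reduction p β (v i) :=
    funext fun i => (hv i).symm
  rw [h2, halfGram_reducedForm, h1]
  push_cast
  rfl

theorem exists_halfGram_eq (hM : IsZLattice (⟨Q, M⟩ : QuadLattice V)) {N : Submodule ℤ V}
    (hNM : N ≤ M) (γ : Basis (Fin 3) ℤ N) :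
    ((halfGram (latForm hM) (fun i => ⟨γ i, hNM (γ i).2⟩) : ℤ) : ℚ) =
      4 * disc (⟨Q, N⟩ : QuadLattice V) := by
  have h := polarGram_eq_gramDet (⟨Q, N⟩ : QuadLattice V) γ
  rw [← two_mul_halfGram, ← disc_eq_gramDet] at h
  rw [coe_halfGram_latForm]
  exact mul_left_cancel₀ two_ne_zero h

/-- If the third value vanished, `p` would divide `4dM`. The sublattice lies over a proper subspace,
so `p` also divides its index determinant, and `p³` would divide its `4d`. -/
theorem form_two_ne_zero (hV : finrank ℚ V = 3) (hM : IsZLattice (⟨Q, M⟩ : QuadLattice V))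
    (β : Basis (Fin 3) ℤ M) {e f : V} (h : IsHypPair p Q M e f)
    (hord : padicValRat p (4 * disc (⟨Q, hypLat p M e f⟩ : QuadLattice V)) = 2)
    {b : Basis (Fin 3) (ZMod p) (Fin 3 → ZMod p)}
    (hb : IsFrame (reducedForm p β (latForm hM)) b)
    (hb0 : b 0 = reduction p β ⟨e, h.mem_left⟩) (hb1 : b 1 = reduction p β ⟨f, h.mem_right⟩) :
    reducedForm p β (latForm hM) (b 2) ≠ 0 := by
  intro hc
  obtain ⟨d, hd, hD⟩ := neg_form_two_eq hM β hb
  have hN := h.isZLattice (Fact.out : p.Prime).ne_zero hM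
  obtain ⟨γ⟩ := hN.exists_basis hV
  rw [← exists_halfGram_eq hM h.hypLat_le γ] at hord
  refine padicValRat_intCast_eq_two hord ?_
  rw [hc, neg_zero, zero_eq_mul, or_iff_left (pow_ne_zero 2 hd),
    ZMod.intCast_zmod_eq_zero_iff_dvd] at hD
  obtain ⟨k, hk⟩ := hD
  have hspan : Submodule.span (ZMod p) {b 0, b 1} ≠ ⊤ := by
    intro htop
    have h2 : b 2 ∈ Submodule.span (ZMod p) {b 0, b 1} := by
      rw [htop]
      trivial
    obtain ⟨s, t, hst⟩ := Submodule.mem_span_pair.1 h2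
    have h3 : s • b 0 + t • b 1 + (0 : ZMod p) • b 2 =
        (0 : ZMod p) • b 0 + (0 : ZMod p) • b 1 + (1 : ZMod p) • b 2 := by
      rw [hst]
      simp
    exact zero_ne_one (combination_inj b h3).2.2
  obtain ⟨l, hl⟩ := dvd_det_of_reduction_mem β (fun i => ⟨γ i, h.hypLat_le (γ i).2⟩) hspan (by
    intro i
    have h4 := (γ i).2
    have h5 := hypLat_eq_preimageLat (p := p) β ⟨e, h.mem_left⟩ ⟨f, h.mem_right⟩
    change (γ i : V) ∈ hypLat p M e f at h4
    rw [hb0, hb1]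
    exact (coe_mem_preimageLat (⟨γ i, h.hypLat_le (γ i).2⟩ : M)).1 (h5.le h4))
  rw [halfGram_eq (q := latForm hM) β, hk, hl]
  exact ⟨k * l ^ 2, by ring⟩

/-- For `g` lifting the third vector, `e, f, pg` lie in the sublattice and have `p²` times the half
Gram determinant of `e, f, g`. Since `p³` divides the former, `p` divides the latter, which reduces
to minus the third value. -/
theorem form_two_eq_zero (hV : finrank ℚ V = 3) (hM : IsZLattice (⟨Q, M⟩ : QuadLattice V))
    (β : Basis (Fin 3) ℤ M) {e f : V} (h : IsHypPair p Q M e f)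
    (hord : 3 ≤ padicValRat p (4 * disc (⟨Q, hypLat p M e f⟩ : QuadLattice V)))
    {b : Basis (Fin 3) (ZMod p) (Fin 3 → ZMod p)}
    (hb : IsFrame (reducedForm p β (latForm hM)) b)
    (hb0 : b 0 = reduction p β ⟨e, h.mem_left⟩) (hb1 : b 1 = reduction p β ⟨f, h.mem_right⟩) :
    reducedForm p β (latForm hM) (b 2) = 0 := by
  have hp0 : (p : ℤ) ≠ 0 := Int.natCast_ne_zero.2 (Fact.out : p.Prime).ne_zero
  have hN := h.isZLattice (Fact.out : p.Prime).ne_zero hM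
  obtain ⟨γ⟩ := hN.exists_basis hV
  obtain ⟨g, hg⟩ := reduction_surjective β (b 2)
  set v : Fin 3 → M := ![⟨e, h.mem_left⟩, ⟨f, h.mem_right⟩, g] with hv
  have hbv : (b : Fin 3 → Fin 3 → ZMod p) = fun i => reduction p β (v i) := by
    funext i
    fin_cases i
    exacts [hb0, hb1, hg.symm]
  have h1 := hb.halfGram_eq
  have h6 := halfGram_reducedForm (p := p) β (latForm hM) v
  rw [← hbv, h1] at h6
  set w : Fin 3 → hypLat p M e f :=
    ![⟨e, left_mem_hypLat⟩, ⟨f, right_mem_hypLat⟩, ⟨(p : ℤ) • (g : V), smul_mem_hypLat g.2⟩] with hw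
  have h2 := halfGram_eq (q := latForm hN) γ w
  have h3 : halfGram (latForm hN) w = p ^ 2 * halfGram (latForm hM) v := by
    have h4 : ((halfGram (latForm hN) w : ℤ) : ℚ) =
        ((p ^ 2 * halfGram (latForm hM) v : ℤ) : ℚ) := by
      rw [coe_halfGram_latForm]
      push_cast
      rw [coe_halfGram_latForm]
      simp only [halfGram, hv, hw, Matrix.cons_val_zero, Matrix.cons_val_one, Matrix.cons_val,
        form_zsmul, polar_zsmul_right]
      push_cast
      ring
    exact_mod_cast h4
  rw [← halfGram_latForm_basis hN γ] at hord
  obtain ⟨k, hk⟩ := pow_dvd_of_le_padicValRat (m := 3) hord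
  rw [h3, hk] at h2
  have h5 : (p : ℤ) ∣ halfGram (latForm hM) v := by
    refine ⟨k * (γ.toMatrix w).det ^ 2, mul_left_cancel₀ (pow_ne_zero 2 hp0) ?_⟩
    rw [h2]
    ring
  rw [(ZMod.intCast_zmod_eq_zero_iff_dvd _ p).2 h5] at h6
  exact neg_eq_zero.1 h6

theorem radical_iff (hM : IsZLattice (⟨Q, M⟩ : QuadLattice V)) (β : Basis (Fin 3) ℤ M) (x : M) :
    (∀ w, polar (reducedForm p β (latForm hM)) (reduction p β x) w = 0) ↔
      ∀ z ∈ M, ∃ k : ℤ, polar Q (x : V) z = p * k := by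
  constructor
  · intro h z hz
    have h1 := h (reduction p β ⟨z, hz⟩)
    rw [polar_reducedForm] at h1
    obtain ⟨k, hk⟩ := (ZMod.intCast_zmod_eq_zero_iff_dvd _ p).1 h1
    refine ⟨k, ?_⟩
    have h2 := coe_polar_latForm hM x ⟨z, hz⟩
    rw [← h2, hk]
    push_cast
    ring
  · intro h w
    obtain ⟨z, rfl⟩ := reduction_surjective β w
    rw [polar_reducedForm, ZMod.intCast_zmod_eq_zero_iff_dvd]
    obtain ⟨k, hk⟩ := h z z.2
    rw [← coe_polar_latForm hM] at hk
    exact ⟨k, by exact_mod_cast hk⟩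

open Classical in
theorem sum_indicator (hV : finrank ℚ V = 3) (hM : IsZLattice (⟨Q, M⟩ : QuadLattice V)) (t : ℚ)
    {N : Submodule ℤ V} (hN : N ≤ M) :
    ∑ x ∈ (finite_vectors hV hM t).toFinset, (if x ∈ N then (1 : ℚ) else 0) =
      rep t (⟨Q, N⟩ : QuadLattice V) := by
  rw [Finset.sum_boole, ncard_rep, ← Set.ncard_coe_finset]
  congr 2
  ext x
  simp only [Finset.coe_filter, Set.Finite.mem_toFinset, Set.mem_ofPred_eq]
  exact ⟨fun h => ⟨h.2, h.1.2⟩, fun h => ⟨⟨hN h.1, h.2⟩, h.1⟩⟩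

theorem rep_smul (hp : p ≠ 0) (t : ℚ) (M : Submodule ℤ V) :
    rep t (⟨Q, M.map ((p : ℤ) • LinearMap.id)⟩ : QuadLattice V) =
      rep (t / (p : ℚ) ^ 2) (⟨Q, M⟩ : QuadLattice V) := by
  have hp0 : (p : ℚ) ≠ 0 := Nat.cast_ne_zero.2 hp
  have : IsTorsionFree ℤ V := IsTorsionFree.trans_faithfulSMul ℤ ℚ V
  have hinj : Function.Injective (fun x : V => (p : ℤ) • x) :=
    smul_right_injective V (Int.natCast_ne_zero.2 hp)
  rw [ncard_rep, ncard_rep]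
  refine Eq.trans (congrArg Set.ncard ?_) (Set.ncard_image_of_injective _ hinj)
  ext x
  constructor
  · rintro ⟨⟨y, hy, rfl⟩, hx⟩
    refine ⟨y, ⟨hy, ?_⟩, rfl⟩
    have h1 : Q ((p : ℤ) • y) = t := hx
    rw [form_zsmul] at h1
    change Q y = _
    rw [eq_div_iff (pow_ne_zero 2 hp0), ← h1]
    push_cast
    ring
  · rintro ⟨y, ⟨hy, hx⟩, rfl⟩
    refine ⟨⟨y, hy, rfl⟩, ?_⟩
    have h1 : Q y = t / (p : ℚ) ^ 2 := hx
    change Q ((p : ℤ) • y) = t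
    rw [form_zsmul, h1]
    push_cast
    field_simp

theorem reduction_eq_zero_iff_mem (β : Basis (Fin 3) ℤ M) (x : M) :
    reduction p β x = 0 ↔ (x : V) ∈ M.map ((p : ℤ) • (LinearMap.id : V →ₗ[ℤ] V)) := by
  rw [reduction_eq_zero_iff]
  constructor
  · rintro ⟨y, rfl⟩
    exact ⟨y, y.2, rfl⟩
  · rintro ⟨y, hy, h⟩
    exact ⟨⟨y, hy⟩, Subtype.ext h.symm⟩

theorem smul_map_le (M : Submodule ℤ V) (n : ℤ) :
    M.map (n • (LinearMap.id : V →ₗ[ℤ] V)) ≤ M := by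
  rintro _ ⟨y, hy, rfl⟩
  exact M.smul_mem n hy

end Evaluation

/-! ### The five cases of the formula -/

section Weights

variable {V : Type*} [AddCommGroup V] [Module ℚ V] {p : ℕ} [Fact p.Prime]
  {Q : QuadraticForm ℚ V} {M : Submodule ℤ V}

theorem repGen_eq_sum_of_planeCount (hV : finrank ℚ V = 3)
    (hM : IsZLattice (⟨Q, M⟩ : QuadLattice V)) {K L : QuadLattice V}
    (hgen : genClasses p K L = latClass Q '' hypSublattices p Q M) (β : Basis (Fin 3) ℤ M)
    (n : ℤ) (w : V → ℚ)
    (hw : ∀ x : M, reducedForm p β (latForm hM) (reduction p β x) = (n : ZMod p) →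
      (planeCount (reducedForm p β (latForm hM)) (reduction p β x) : ℚ) = w x) :
    repGen p n K L = (∑ x ∈ (finite_vectors hV hM (n : ℚ)).toFinset, w x) /
      autCard (⟨Q, M⟩ : QuadLattice V) := by
  rw [repGen_eq_sum hV hM hgen, ← Nat.cast_sum, sum_rep_eq hV hM, Nat.cast_sum]
  congr 1
  refine Finset.sum_congr rfl fun x hx => ?_
  obtain ⟨hxM, hxn⟩ := (Set.Finite.mem_toFinset _).1 hx
  have hxn' : latForm hM ⟨x, hxM⟩ = n := by
    have h := coe_latForm hM ⟨x, hxM⟩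
    rw [show Q ((⟨x, hxM⟩ : M) : V) = n from hxn] at h
    exact_mod_cast h
  rw [ncard_hypSublattices_through hM β ⟨x, hxM⟩]
  exact hw ⟨x, hxM⟩ (by rw [reducedForm_apply, hxn'])

theorem sum_one_eq_rep (hV : finrank ℚ V = 3) (hM : IsZLattice (⟨Q, M⟩ : QuadLattice V)) (t : ℚ) :
    ∑ _x ∈ (finite_vectors hV hM t).toFinset, (1 : ℚ) = rep t (⟨Q, M⟩ : QuadLattice V) := by
  classical
  rw [← sum_indicator hV hM t le_rfl]
  exact Finset.sum_congr rfl fun x hx =>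
    (if_pos ((Set.Finite.mem_toFinset _).1 hx).1).symm

/-- Modulo `p` the third value is `-4dM` up to a nonzero square, and 4 is itself a square. -/
theorem quadraticChar_eq_ratLegendre (hp : p ≠ 2) (hM : IsZLattice (⟨Q, M⟩ : QuadLattice V))
    (β : Basis (Fin 3) ℤ M) {b : Basis (Fin 3) (ZMod p) (Fin 3 → ZMod p)}
    (hb : IsFrame (reducedForm p β (latForm hM)) b) (n : ℤ) :
    quadraticChar (ZMod p) ((n : ZMod p) * reducedForm p β (latForm hM) (b 2)) =
      ratLegendre p (-(n : ℚ) * disc (⟨Q, M⟩ : QuadLattice V)) := by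
  obtain ⟨d, hd, hD⟩ := neg_form_two_eq hM β hb
  have h2 : (2 : ZMod p) ≠ 0 := Ring.two_ne_zero (by rwa [ZMod.ringChar_zmod_n])
  have h4 : ((4 : ℤ) : ZMod p) ≠ 0 := by
    rw [show ((4 : ℤ) : ZMod p) = 2 ^ 2 by norm_num]
    exact pow_ne_zero 2 h2
  have hdisc : -(n : ℚ) * disc (⟨Q, M⟩ : QuadLattice V) =
      Rat.divInt (-n * halfGram (latForm hM) β) 4 := by
    rw [Rat.divInt_eq_div]
    push_cast
    rw [halfGram_latForm_basis]
    ring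
  rw [ratLegendre, hdisc, Rat.cast_divInt_of_ne_zero _ h4]
  have h5 : (n : ZMod p) * reducedForm p β (latForm hM) (b 2) =
      ((-n * halfGram (latForm hM) β : ℤ) : ZMod p) / ((4 : ℤ) : ZMod p) * (2 * d) ^ 2 := by
    rw [div_mul_eq_mul_div, eq_div_iff h4]
    push_cast
    linear_combination (-4 * (n : ZMod p)) * hD
  rw [h5, map_mul, quadraticChar_sq_one' (mul_ne_zero h2 hd), mul_one]

theorem radical_iff_mem_lambdaOne (hM : IsZLattice (⟨Q, M⟩ : QuadLattice V)) (hp : p = 2)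
    (β : Basis (Fin 3) ℤ M) (x : M) :
    (∀ w, polar (reducedForm p β (latForm hM)) (reduction p β x) w = 0) ↔
      (x : V) ∈ (LambdaOne (⟨Q, M⟩ : QuadLattice V)).lat := by
  rw [radical_iff]
  have h : ∀ z, (∃ k : ℤ, polar Q (x : V) z = p * k) ↔
      ∃ k : ℤ, bilin (⟨Q, M⟩ : QuadLattice V) x z = k := by
    intro z
    refine exists_congr fun k => ?_
    rw [← two_mul_bilin (⟨Q, M⟩ : QuadLattice V), hp, Nat.cast_ofNat]
    exact mul_right_inj' two_ne_zero
  simp only [h]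
  exact ⟨fun h => ⟨x.2, h⟩, fun h => h.2⟩

/-- For a vector with `p ∣ Q(x)`, membership in `Λ_p(M)` reduces to orthogonality to `M` modulo `p`.
-/
theorem radical_iff_mem_watson (hM : IsZLattice (⟨Q, M⟩ : QuadLattice V))
    (β : Basis (Fin 3) ℤ M) (x : M) (hx : reducedForm p β (latForm hM) (reduction p β x) = 0) :
    (∀ w, polar (reducedForm p β (latForm hM)) (reduction p β x) w = 0) ↔
      (x : V) ∈ (watson p (⟨Q, M⟩ : QuadLattice V)).lat := by
  rw [radical_iff, mem_watson_iff]
  rw [reducedForm_apply] at hx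
  obtain ⟨k, hk⟩ := (ZMod.intCast_zmod_eq_zero_iff_dvd _ p).1 hx
  refine ⟨fun h => ⟨x.2, ⟨k, ?_⟩, h⟩, fun h => h.2.2⟩
  change Q (x : V) = _
  rw [← coe_latForm hM, hk]
  push_cast
  rfl

theorem repGen_of_odd
    (hV : finrank ℚ V = 3) (hM : IsZLattice (⟨Q, M⟩ : QuadLattice V)) {K L : QuadLattice V}
    (hgen : genClasses p K L = latClass Q '' hypSublattices p Q M) (β : Basis (Fin 3) ℤ M)
    {b : Basis (Fin 3) (ZMod p) (Fin 3 → ZMod p)}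
    (hb : IsFrame (reducedForm p β (latForm hM)) b) {n : ℤ}
    (hp : p ≠ 2) (hc : reducedForm p β (latForm hM) (b 2) ≠ 0)
    (hn : ¬ (p : ℤ) ∣ n) :
    repGen p n K L =
      ((p : ℚ) - (ratLegendre p (-(n : ℚ) * disc (⟨Q, M⟩ : QuadLattice V)) : ℚ)) / 2 *
        ((rep n (⟨Q, M⟩ : QuadLattice V) : ℚ) / autCard (⟨Q, M⟩ : QuadLattice V)) := by
  rw [repGen_eq_sum_of_planeCount hV hM hgen β n
    (fun _ => ((p : ℚ) - (ratLegendre p (-(n : ℚ) * disc (⟨Q, M⟩ : QuadLattice V)) : ℚ)) / 2 * 1),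
    ← Finset.mul_sum, sum_one_eq_rep hV hM, mul_div_assoc]
  intro x hx
  have hx0 : reducedForm p β (latForm hM) (reduction p β x) ≠ 0 := by
    rwa [hx, Ne, ZMod.intCast_zmod_eq_zero_iff_dvd]
  have h := two_mul_planeCount_of_odd (by rwa [ZMod.ringChar_zmod_n]) (by simp) hb hc hx0
  rw [hx, quadraticChar_eq_ratLegendre hp hM β hb, ZMod.card] at h
  have h' : (2 * planeCount (reducedForm p β (latForm hM)) (reduction p β x) : ℚ) =
      (p : ℚ) - (ratLegendre p (-(n : ℚ) * disc (⟨Q, M⟩ : QuadLattice V)) : ℚ) := by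
    exact_mod_cast h
  rw [← h']
  ring

theorem repGen_of_two
    (hV : finrank ℚ V = 3) (hM : IsZLattice (⟨Q, M⟩ : QuadLattice V)) {K L : QuadLattice V}
    (hgen : genClasses p K L = latClass Q '' hypSublattices p Q M) (β : Basis (Fin 3) ℤ M)
    {b : Basis (Fin 3) (ZMod p) (Fin 3 → ZMod p)}
    (hb : IsFrame (reducedForm p β (latForm hM)) b) {n : ℤ}
    (hp : p = 2) (hc : reducedForm p β (latForm hM) (b 2) ≠ 0)
    (hn : ¬ (p : ℤ) ∣ n) :
    repGen p n K L = ((rep n (⟨Q, M⟩ : QuadLattice V) : ℚ) -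
      (rep n (LambdaOne (⟨Q, M⟩ : QuadLattice V)) : ℚ)) / autCard (⟨Q, M⟩ : QuadLattice V) := by
  classical
  have hle : (LambdaOne (⟨Q, M⟩ : QuadLattice V)).lat ≤ M := fun x hx => hx.1
  rw [repGen_eq_sum_of_planeCount hV hM hgen β n
    (fun x => 1 - if x ∈ (LambdaOne (⟨Q, M⟩ : QuadLattice V)).lat then 1 else 0),
    Finset.sum_sub_distrib, sum_one_eq_rep hV hM, sum_indicator hV hM n hle]
  · rfl
  intro x hx
  have hx0 : reducedForm p β (latForm hM) (reduction p β x) ≠ 0 := by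
    rwa [hx, Ne, ZMod.intCast_zmod_eq_zero_iff_dvd]
  rw [← radical_iff_mem_lambdaOne hM hp β x]
  split_ifs with h
  · rw [planeCount_radical_of_ne hx0 h]
    simp
  · push Not at h
    obtain ⟨w, hw⟩ := h
    rw [planeCount_of_card_two _ (by simp) hb hc hx0 hw]
    · simp
    · have h2 : ∀ y : ZMod 2, y ≠ 0 → y = 1 := by decide
      subst hp
      exact h2

theorem repGen_of_degenerate
    (hV : finrank ℚ V = 3) (hM : IsZLattice (⟨Q, M⟩ : QuadLattice V)) {K L : QuadLattice V}
    (hgen : genClasses p K L = latClass Q '' hypSublattices p Q M) (β : Basis (Fin 3) ℤ M)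
    {b : Basis (Fin 3) (ZMod p) (Fin 3 → ZMod p)}
    (hb : IsFrame (reducedForm p β (latForm hM)) b) {n : ℤ}
    (hc : reducedForm p β (latForm hM) (b 2) = 0)
    (hn : ¬ (p : ℤ) ∣ n) :
    repGen p n K L = (p : ℚ) *
      ((rep n (⟨Q, M⟩ : QuadLattice V) : ℚ) / autCard (⟨Q, M⟩ : QuadLattice V)) := by
  rw [repGen_eq_sum_of_planeCount hV hM hgen β n (fun _ => (p : ℚ) * 1),
    ← Finset.mul_sum, sum_one_eq_rep hV hM, mul_div_assoc]
  intro x hx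
  have hx0 : reducedForm p β (latForm hM) (reduction p β x) ≠ 0 := by
    rwa [hx, Ne, ZMod.intCast_zmod_eq_zero_iff_dvd]
  rw [planeCount_of_degenerate (by simp) hb hc hx0, Nat.card_zmod, mul_one]

theorem repGen_of_dvd
    (hV : finrank ℚ V = 3) (hM : IsZLattice (⟨Q, M⟩ : QuadLattice V)) {K L : QuadLattice V}
    (hgen : genClasses p K L = latClass Q '' hypSublattices p Q M) (β : Basis (Fin 3) ℤ M)
    {b : Basis (Fin 3) (ZMod p) (Fin 3 → ZMod p)}
    (hb : IsFrame (reducedForm p β (latForm hM)) b) {n : ℤ}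
    (hc : reducedForm p β (latForm hM) (b 2) ≠ 0) (hn : (p : ℤ) ∣ n) :
    repGen p n K L = (p : ℚ) *
        ((rep n (⟨Q, M⟩ : QuadLattice V) : ℚ) / autCard (⟨Q, M⟩ : QuadLattice V)) +
      (p : ℚ) * ((p : ℚ) - 1) / 2 * ((rep ((n : ℚ) / (p : ℚ) ^ 2) (⟨Q, M⟩ : QuadLattice V) : ℚ) /
        autCard (⟨Q, M⟩ : QuadLattice V)) := by
  classical
  -- Weight `p` off `pM`; on `pM` the correction raises it to `p + p(p-1)/2 = p(p+1)/2`.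
  rw [repGen_eq_sum_of_planeCount hV hM hgen β n (fun x => (p : ℚ) * 1 +
    (p : ℚ) * ((p : ℚ) - 1) / 2 * if x ∈ M.map ((p : ℤ) • LinearMap.id) then 1 else 0),
    Finset.sum_add_distrib, ← Finset.mul_sum, ← Finset.mul_sum, sum_one_eq_rep hV hM,
    sum_indicator hV hM n (smul_map_le M _), rep_smul (Fact.out : p.Prime).ne_zero]
  · ring
  intro x hx
  rw [(ZMod.intCast_zmod_eq_zero_iff_dvd n p).2 hn] at hx
  rw [← reduction_eq_zero_iff_mem β x]
  split_ifs with h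
  · have h1 := two_mul_ncard_hypPlanes (by simp) hb hc
    rw [h, ← mul_right_inj' (two_ne_zero (α := ℚ))]
    rw [Nat.card_zmod] at h1
    have h2 : (2 * planeCount (reducedForm p β (latForm hM)) 0 : ℚ) = p * (p + 1) := by
      exact_mod_cast h1
    rw [h2]
    ring
  · have h1 : ∃ w, polar (reducedForm p β (latForm hM)) (reduction p β x) w ≠ 0 := by
      by_contra! h2
      exact hc (hb.form_two_eq_zero_iff.2 ⟨_, h, hx, h2⟩)
    obtain ⟨w, hw⟩ := h1
    rw [planeCount_eq_card (by simp) hx hw, Nat.card_zmod]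
    ring

theorem repGen_of_dvd_of_degenerate
    (hV : finrank ℚ V = 3) (hM : IsZLattice (⟨Q, M⟩ : QuadLattice V)) {K L : QuadLattice V}
    (hgen : genClasses p K L = latClass Q '' hypSublattices p Q M) (β : Basis (Fin 3) ℤ M)
    {b : Basis (Fin 3) (ZMod p) (Fin 3 → ZMod p)}
    (hb : IsFrame (reducedForm p β (latForm hM)) b) {n : ℤ}
    (hc : reducedForm p β (latForm hM) (b 2) = 0)
    (hn : (p : ℤ) ∣ n) :
    repGen p n K L = (p : ℚ) *
        ((rep n (⟨Q, M⟩ : QuadLattice V) : ℚ) / autCard (⟨Q, M⟩ : QuadLattice V)) +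
      (p : ℚ) ^ 2 * ((rep ((n : ℚ) / (p : ℚ) ^ 2) (⟨Q, M⟩ : QuadLattice V) : ℚ) /
        autCard (⟨Q, M⟩ : QuadLattice V)) -
      (p : ℚ) * ((rep n (watson p (⟨Q, M⟩ : QuadLattice V)) : ℚ) /
        autCard (⟨Q, M⟩ : QuadLattice V)) := by
  classical
  have hle : (watson p (⟨Q, M⟩ : QuadLattice V)).lat ≤ M := fun x hx => (mem_watson_iff.1 hx).1
  -- The weights are `p` outside the radical, `p - p = 0` on its nonzero isotropic vectors, and `p +
  -- p² - p = p²` on `pM`, which lies in `Λ_p(M)`.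
  rw [repGen_eq_sum_of_planeCount hV hM hgen β n (fun x => (p : ℚ) * 1 +
    (p : ℚ) ^ 2 * (if x ∈ M.map ((p : ℤ) • LinearMap.id) then 1 else 0) -
    (p : ℚ) * if x ∈ (watson p (⟨Q, M⟩ : QuadLattice V)).lat then 1 else 0),
    Finset.sum_sub_distrib, Finset.sum_add_distrib, ← Finset.mul_sum, ← Finset.mul_sum,
    ← Finset.mul_sum, sum_one_eq_rep hV hM, sum_indicator hV hM n (smul_map_le M _),
    rep_smul (Fact.out : p.Prime).ne_zero, sum_indicator hV hM n hle]
  · change _ = _ - (p : ℚ) * ((rep n (⟨Q, (watson p (⟨Q, M⟩ : QuadLattice V)).lat⟩ :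
      QuadLattice V) : ℚ) / _)
    ring
  intro x hx
  rw [(ZMod.intCast_zmod_eq_zero_iff_dvd n p).2 hn] at hx
  rw [← reduction_eq_zero_iff_mem β x, ← radical_iff_mem_watson hM β x hx]
  by_cases h : reduction p β x = 0
  · rw [if_pos h, if_pos (by rw [h]; intro w; simp [polar]), h,
      ncard_hypPlanes_of_eq_zero (by simp) hb hc, Nat.card_zmod]
    push_cast
    ring
  · rw [if_neg h]
    split_ifs with h1
    · rw [planeCount_radical h hx h1]
      simp
    · push Not at h1
      obtain ⟨w, hw⟩ := h1
      rw [planeCount_eq_card (by simp) hx hw, Nat.card_zmod]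
      ring

end Weights

end QuadLattice
end

/-! ### The main theorem -/

open QuadLattice in
theorem mainTheorem10 {V : Type*} [AddCommGroup V] [Module ℚ V] (hV : Module.finrank ℚ V = 3)
    (p : ℕ) [Fact p.Prime] (L K : QuadLattice V)
    (hL : L.IsZLattice) (hLprim : L.IsPrimitive)
    (hLp : L.HalfModularIsotropic p)
    (hord : 2 ≤ padicValRat p (4 * L.disc))
    (hK : K = L.lambda p) :
    (QuadLattice.genClasses p K L).Finite ∧
    (∀ n : ℤ, ¬ (p : ℤ) ∣ n →
      (p ≠ 2 → padicValRat p (4 * L.disc) = 2 →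
        QuadLattice.repGen p n K L =
          ((p : ℚ) - (ratLegendre p (-(n : ℚ) * K.disc) : ℚ)) / 2 *
            ((K.rep n : ℚ) / (K.autCard : ℚ))) ∧
      (p = 2 → padicValRat p (4 * L.disc) = 2 →
        QuadLattice.repGen p n K L =
          ((K.rep n : ℚ) - (K.LambdaOne.rep n : ℚ)) / (K.autCard : ℚ)) ∧
      (3 ≤ padicValRat p (4 * L.disc) →
        QuadLattice.repGen p n K L = (p : ℚ) * ((K.rep n : ℚ) / (K.autCard : ℚ)))) ∧
    (∀ n : ℤ, (p : ℤ) ∣ n →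
      (padicValRat p (4 * L.disc) = 2 →
        QuadLattice.repGen p n K L =
          (p : ℚ) * ((K.rep n : ℚ) / (K.autCard : ℚ)) +
            (p : ℚ) * ((p : ℚ) - 1) / 2 * ((K.rep ((n : ℚ) / (p : ℚ) ^ 2) : ℚ) / (K.autCard : ℚ))) ∧
      (3 ≤ padicValRat p (4 * L.disc) →
        QuadLattice.repGen p n K L =
          (p : ℚ) * ((K.rep n : ℚ) / (K.autCard : ℚ)) +
            (p : ℚ) ^ 2 * ((K.rep ((n : ℚ) / (p : ℚ) ^ 2) : ℚ) / (K.autCard : ℚ)) -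
            (p : ℚ) * (((K.watson p).rep n : ℚ) / (K.autCard : ℚ)))) := by
  have hp : p ≠ 0 := (Fact.out : p.Prime).ne_zero
  have hsplit := hasLocalSplit_of_halfModularIsotropic hV hL hLp hord
  obtain ⟨e, f, h⟩ := exists_isSplitPair hV hL hsplit
  have hM := h.isZLattice_overLat hp hL
  have hgen := genClasses_eq hV hL hLprim hsplit hK
  have hKM : IsIso K ⟨L.form, overLat p L⟩ :=
    hK ▸ lambda_isIso hp (isPrimitive_of_le hM.norm_le (le_overLat hL) rfl hLprim)
  have hhyp := h.isHypPair hL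
  have hLdisc : L.disc = disc (⟨L.form, hypLat p (overLat p L) e f⟩ : QuadLattice V) :=
    congrArg (fun N => disc (⟨L.form, N⟩ : QuadLattice V)) (h.lat_eq hp hL)
  obtain ⟨β⟩ := hM.exists_basis hV
  obtain ⟨b, hb, hb0, hb1⟩ := exists_reduced_frame (p := p) hM β hhyp
  have hne : padicValRat p (4 * L.disc) = 2 → reducedForm p β (latForm hM) (b 2) ≠ 0 :=
    fun h2 => form_two_ne_zero hV hM β hhyp (hLdisc ▸ h2) hb hb0 hb1
  have heq : 3 ≤ padicValRat p (4 * L.disc) → reducedForm p β (latForm hM) (b 2) = 0 :=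
    fun h3 => form_two_eq_zero hV hM β hhyp (hLdisc ▸ h3) hb hb0 hb1
  have hdisc : K.disc = disc (⟨L.form, overLat p L⟩ : QuadLattice V) :=
    (disc_congr ((isoSetoid V).symm hKM) β).symm
  obtain ⟨σ⟩ := id hKM
  -- Every quantity attached to `K` is an isometry invariant, so it may be computed on `M =
  -- p⁻¹Λ_p(L)`.
  rw [hdisc, autCard_congr hKM]
  simp only [rep_congr _ hKM, rep_congr _ hKM.lambdaOne,
    rep_congr _ (show IsIso (watson p K) _ from ⟨σ.watson p⟩)]
  refine ⟨?_, fun n hn => ⟨fun hp2 h2 => repGen_of_odd hV hM hgen β hb hp2 (hne h2) hn,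
    fun hp2 h2 => repGen_of_two hV hM hgen β hb hp2 (hne h2) hn,
    fun h3 => repGen_of_degenerate hV hM hgen β hb (heq h3) hn⟩, fun n hn =>
    ⟨fun h2 => repGen_of_dvd hV hM hgen β hb (hne h2) hn,
    fun h3 => repGen_of_dvd_of_degenerate hV hM hgen β hb (heq h3) hn⟩⟩
  rw [hgen]
  exact (finite_hypSublattices hV hM).image _
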